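/- Setting. Let $d\ge 2$, $\gamma\in[0,1]$, $\nu\in[0,1)$, and let $b:(-1,1)\to[0,\infty)$ vanish on $(-1,0)$, be convex on $[0,1)$, and be such that $\beta(\theta):=b(\cos\theta)$ is comparable to $\theta^{-1-\nu}$ (bounded above and below by positive multiples of it) as $\theta\downarrow 0$. For $v\in\mathbb{R}^d$, $\sigma\in\mathbb{S}^{d-1}$ with $\cos\theta=\sigma\cdot v/|v|$, let $B(v,\sigma)=|v|^\gamma(\sin\theta)^{2-d}\beta(\theta)$, and for $K>0$ let $B_K(v,\sigma)=B(v,\sigma)1(\theta>\theta_0(K))$, where $\theta_0(K)$ is such that $\int_{\mathbb{S}^{d-1}}B_K(v,\sigma)\,d\sigma=K|v|^\gamma$ for all $v\ne0$. Let $\mathcal{S}_N$ be the set of measures $\mu=N^{-1}\sum_{i=1}^N\delta_{v_i}$ on $\mathbb{R}^d$ with $\langle 1,\mu\rangle=1$, $\langle v,\mu\rangle=0$, $\langle|v|^2,\mu\rangle=1$, equipped with the Wasserstein distance $w_1(\mu,\nu)=\inf_\pi\int|v-w|\,\pi(dv,dw)$ (infimum over couplings of $\mu$ and $\nu$). A noncutoff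 (respectively $K$-cutoff) Kac process on $N$ particles is an $\mathcal{S}_N$-valued process $(\mu^N_t)_{t\ge0}$, adapted to some filtration, with càdlàg paths in $(\mathcal{S}_N,w_1)$, such that for every Lipschitz $F:(\mathcal{S}_N,w_1)\to\mathbb{R}$ the process $F(\mu^N_t)-F(\mu^N_0)-\int_0^t(\mathcal{G}F)(\mu^N_s)\,ds$ is a martingale, where $$(\mathcal{G}F)(\mu)=N\int_{\mathbb{R}^d\times\mathbb{R}^d\times\mathbb{S}^{d-1}}\bigl(F(\mu^{v,v_\star,\sigma})-F(\mu)\bigr)\,B(v-v_\star,\sigma)\,d\sigma\,\mu(dv)\,\mu(dv_\star)$$ (respectively with $B_K$ in place of $B$), and $\mu^{v,v_\star,\sigma}=\mu+N^{-1}(\delta_{v'}+\delta_{v_\star'}-\delta_v-\delta_{v_\star})$ with $v'=\frac{v+v_\star}2+\frac{|v-v_\star|}2\sigma$, $v_\star'=\frac{v+v_\star}2-\frac{|v-v_\star|}2\sigma$. Write $\Lambda_k(\mu)=\langle(1+|v|^2)^{k/2},\mu\rangle$. Lemma (Concentration of moments). Fix $p\ge2$. (1) There exist constants $C_1,C_2\in(0,\infty)$,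 depending only on $p$, $d$, $\gamma$ and $b$, such that the following holds for every $q\ge2p+\gamma$. Whenever $(\mu^N_t)_{t\ge 0}$ is a noncutoff Kac process, or a $K$-cutoff Kac process for some $K>0$, on $N$ particles with $\Lambda_q(\mu^N_0)\le a_3$ almost surely, then for all $t_{\rm fin}\ge0$ and $\epsilon>0$, $$\mathbb{P}\Bigl(\sup_{t\le t_{\rm fin}}\langle|v|^p,\mu^N_t\rangle\ge\max\bigl(\langle|v|^p,\mu^N_0\rangle,C_1\bigr)+\epsilon\Bigr)\le C_2\,t_{\rm fin}\,a_3\,N^{-1}\epsilon^{-2}.$$ (2) For $c\ge1$ let $T^N_c=\inf\{t\ge0:\Lambda_p(\mu^N_t)>c\,2^{-(p/2+1)}\}$, with $\inf\emptyset=\infty$. There exists $C\ge1$, depending only on $p$, $d$, $\gamma$ and $b$, such that for every $q\ge2p+\gamma$ and every noncutoff or $K$-cutoff ($K>0$) Kac process on $N$ particles with $\Lambda_p(\mu^N_0)\le a_1$ and $\Lambda_q(\mu^N_0)\le a_3$ almost surely, for all $t_{\rm fin}\ge0$, $$\mathbb{P}\bigl(T^N_{Ca_1}\le t_{\rm fin}\bigr)\le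 C\,t_{\rm fin}\,a_3\,N^{-1}.$$ -/

import Mathlib

open MeasureTheory ProbabilityTheory Filter Topology
open scoped NNReal ENNReal

universe u

noncomputable section

namespace Kac

/-! ## Collision kernels -/

/-- Assumptions on the angular part `β(θ) = b(cos θ)` of a noncutoff kernel: `b ≥ 0` is convex on
`[0,1)`, it vanishes on `(-1,0)`, and `β(θ)` is comparable to `θ^(-1-ν)` as `θ ↓ 0`. -/
structure IsAngularProfile (ν : ℝ) (b : ℝ → ℝ) : Prop where
  nonneg : ∀ x ∈ Set.Ico (0 : ℝ) 1, 0 ≤ b x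
  convex : ConvexOn ℝ (Set.Ico (0 : ℝ) 1) b
  support : ∀ x ∈ Set.Ioo (-1 : ℝ) 0, b x = 0
  grazing : (fun θ : ℝ => b (Real.cos θ)) =Θ[𝓝[>] 0] (fun θ : ℝ => θ ^ (-1 - ν))

variable {d : ℕ}

/-- The deflection angle `θ ∈ [0, π]`, with `cos θ = σ · v / |v|`. -/
def deflection (v σ : EuclideanSpace ℝ (Fin d)) : ℝ := InnerProductGeometry.angle v σ

/-- `B(v,σ) = |v|^γ (sin θ)^(2-d) β(θ)` with `β(θ) = b(cos θ)`. -/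
def noncutoffKernel (γ : ℝ) (b : ℝ → ℝ) (v σ : EuclideanSpace ℝ (Fin d)) : ℝ :=
  ‖v‖ ^ γ * Real.sin (deflection v σ) ^ (2 - (d : ℤ)) * b (Real.cos (deflection v σ))

/-- The kernel `B(v,σ) 1(θ > θ₀)`. -/
def truncatedKernel (γ : ℝ) (b : ℝ → ℝ) (θ₀ : ℝ) (v σ : EuclideanSpace ℝ (Fin d)) : ℝ :=
  open Classical in if θ₀ < deflection v σ then noncutoffKernel γ b v σ else 0

variable (d) in
/-- The surface measure `dσ` of the unit sphere of `ℝ^d`. -/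
def surface : Measure (Metric.sphere (0 : EuclideanSpace ℝ (Fin d)) 1) :=
  (volume : Measure (EuclideanSpace ℝ (Fin d))).toSphere

variable (d) in
/-- `θ₀ = θ₀(K)`: the truncated kernel has total rate `∫ B_K(v,σ) dσ = K |v|^γ`. -/
def IsCutoffAngle (γ : ℝ) (b : ℝ → ℝ) (K θ₀ : ℝ) : Prop :=
  ∀ v : EuclideanSpace ℝ (Fin d), v ≠ 0 →
    Integrable (fun σ : Metric.sphere (0 : EuclideanSpace ℝ (Fin d)) 1 =>
      truncatedKernel γ b θ₀ v σ) (surface d) ∧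
    ∫ σ : Metric.sphere (0 : EuclideanSpace ℝ (Fin d)) 1,
      truncatedKernel γ b θ₀ v σ ∂(surface d) = K * ‖v‖ ^ γ

/-- `B` is the noncutoff kernel, or its `K`-cutoff version `B_K` for some `K > 0`. -/
def IsKacKernel (γ : ℝ) (b : ℝ → ℝ)
    (B : EuclideanSpace ℝ (Fin d) → EuclideanSpace ℝ (Fin d) → ℝ) : Prop :=
  B = noncutoffKernel γ b ∨
    ∃ K > 0, ∃ θ₀ : ℝ, IsCutoffAngle d γ b K θ₀ ∧ B = truncatedKernel γ b θ₀

/-! ## The state space `𝒮_N` -/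

/-- `N⁻¹ ∑ᵢ δ_{Vᵢ}`. -/
def empirical (N : ℕ) (V : Fin N → EuclideanSpace ℝ (Fin d)) :
    Measure (EuclideanSpace ℝ (Fin d)) :=
  (N : ℝ≥0∞)⁻¹ • ∑ i, Measure.dirac (V i)

variable (d) in
/-- The Boltzmann sphere `𝒮`: mass one, momentum zero, energy one. -/
def boltzmannSphere : Set (Measure (EuclideanSpace ℝ (Fin d))) :=
  {μ | IsProbabilityMeasure μ ∧ Integrable (fun v => ‖v‖ ^ 2) μ ∧
    ∫ v, v ∂μ = 0 ∧ ∫ v, ‖v‖ ^ 2 ∂μ = 1}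

variable (d) in
/-- `𝒮_N`: the normalised empirical measures on `N` points. -/
def kacSphere (N : ℕ) : Set (Measure (EuclideanSpace ℝ (Fin d))) :=
  {μ | μ ∈ boltzmannSphere d ∧ ∃ V, μ = empirical N V}

/-- The Wasserstein distance `w₁(μ,ν) = inf_π ∫ |v - w| π(dv,dw)` over couplings `π`. -/
def w1 (μ ν : Measure (EuclideanSpace ℝ (Fin d))) : ℝ≥0∞ :=
  ⨅ π ∈ {π : Measure (EuclideanSpace ℝ (Fin d) × EuclideanSpace ℝ (Fin d)) |
      π.map Prod.fst = μ ∧ π.map Prod.snd = ν},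
    ∫⁻ z, edist z.1 z.2 ∂π

/-- `F` is Lipschitz on `(𝒮_N, w₁)`; its values off `𝒮_N` are irrelevant. -/
def IsLipschitzOnKacSphere (N : ℕ) (F : Measure (EuclideanSpace ℝ (Fin d)) → ℝ) : Prop :=
  ∃ L : ℝ≥0, ∀ μ ∈ kacSphere d N, ∀ ν ∈ kacSphere d N, edist (F μ) (F ν) ≤ L * w1 μ ν

/-! ## The generator and the process -/

/-- `v' = (v + v⋆)/2 + (|v - v⋆|/2) σ`. -/
def post (v vs σ : EuclideanSpace ℝ (Fin d)) : EuclideanSpace ℝ (Fin d) :=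
  (2 : ℝ)⁻¹ • (v + vs) + (‖v - vs‖ / 2) • σ

/-- `v⋆' = (v + v⋆)/2 - (|v - v⋆|/2) σ`. -/
def postStar (v vs σ : EuclideanSpace ℝ (Fin d)) : EuclideanSpace ℝ (Fin d) :=
  (2 : ℝ)⁻¹ • (v + vs) - (‖v - vs‖ / 2) • σ

/-- `μ + N⁻¹ (δ_{v'} + δ_{v⋆'} - δ_v - δ_{v⋆})`; the positive masses are added first, so that the
subtraction of measures is exact for all atoms `v, v⋆` of `μ ∈ 𝒮_N`, also for `v = v⋆`. -/
def collide (N : ℕ) (μ : Measure (EuclideanSpace ℝ (Fin d)))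
    (v vs σ : EuclideanSpace ℝ (Fin d)) : Measure (EuclideanSpace ℝ (Fin d)) :=
  (μ + (N : ℝ≥0∞)⁻¹ • (Measure.dirac (post v vs σ) + Measure.dirac (postStar v vs σ)))
    - (N : ℝ≥0∞)⁻¹ • (Measure.dirac v + Measure.dirac vs)

/-- The generator
`(𝒢F)(μ) = N ∫∫∫ (F(μ^{v,v⋆,σ}) - F(μ)) B(v - v⋆,σ) dσ μ(dv⋆) μ(dv)`. -/
def generator (N : ℕ) (B : EuclideanSpace ℝ (Fin d) → EuclideanSpace ℝ (Fin d) → ℝ)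
    (F : Measure (EuclideanSpace ℝ (Fin d)) → ℝ) (μ : Measure (EuclideanSpace ℝ (Fin d))) : ℝ :=
  N * ∫ v, ∫ vs, ∫ σ : Metric.sphere (0 : EuclideanSpace ℝ (Fin d)) 1,
    (F (collide N μ v vs σ) - F μ) * B (v - vs) σ ∂(surface d) ∂μ ∂μ

/-- `(μ_t)_{t ≥ 0}` is a Kac process on `N` particles with kernel `B`: it is `𝒮_N`-valued and
adapted, has càdlàg paths in `(𝒮_N, w₁)`, and solves the martingale problem for the generator
on Lipschitz functions. -/
structure IsKacProcess {Ω : Type*} [mΩ : MeasurableSpace Ω] (P : Measure Ω)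
    (ℱ : Filtration ℝ≥0 mΩ) (N : ℕ)
    (B : EuclideanSpace ℝ (Fin d) → EuclideanSpace ℝ (Fin d) → ℝ)
    (μ : ℝ≥0 → Ω → Measure (EuclideanSpace ℝ (Fin d))) : Prop where
  mem : ∀ t ω, μ t ω ∈ kacSphere d N
  adapted : ∀ t, Measurable[ℱ t] (μ t)
  right_cont : ∀ ω t, Tendsto (fun s => w1 (μ s ω) (μ t ω)) (𝓝[>] t) (𝓝 0)
  left_lim : ∀ ω t, ∃ ν ∈ kacSphere d N, Tendsto (fun s => w1 (μ s ω) ν) (𝓝[<] t) (𝓝 0)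
  martingale : ∀ F, IsLipschitzOnKacSphere N F →
    Martingale (fun (t : ℝ≥0) ω => F (μ t ω) - F (μ 0 ω)
      - ∫ s in (0 : ℝ)..t, generator N B F (μ s.toNNReal ω)) ℱ P

/-! ## Moments -/

/-- `⟨|v|^p, μ⟩`. -/
def absMoment (p : ℝ) (μ : Measure (EuclideanSpace ℝ (Fin d))) : ℝ := ∫ v, ‖v‖ ^ p ∂μ

/-- `Λ_k(μ) = ⟨(1 + |v|²)^(k/2), μ⟩`. -/
def Lam (k : ℝ) (μ : Measure (EuclideanSpace ℝ (Fin d))) : ℝ :=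
  ∫ v, (1 + ‖v‖ ^ 2) ^ (k / 2) ∂μ

/-- `T_b = inf {t ≥ 0 : Λ_p(μ_t) > b / 2^(p/2+1)}`, with value `∞` if there is no such `t`. -/
def hittingTime {Ω : Type*} (p : ℝ) (μ : ℝ≥0 → Ω → Measure (EuclideanSpace ℝ (Fin d)))
    (b : ℝ) (ω : Ω) : ℝ≥0∞ :=
  sInf ((fun t : ℝ≥0 => (t : ℝ≥0∞)) '' {t : ℝ≥0 | b / 2 ^ (p / 2 + 1) < Lam p (μ t ω)})

end Kac

end

noncomputable section

namespace Kac

/-! ## Elementary inequalities for powers -/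

/-! Fix the particle number `N`. Energy one forces `‖v‖ ≤ √N` on the support of every state, so the
moment `X_t = ⟨|v|^p, μ_t⟩` and its square are bounded Lipschitz functionals, and the martingale
problem makes `X` a bounded semimartingale with explicit drift and bracket rate. Constants that
depend on `N` or on the cutoff serve only to justify integrability; the quantitative estimates are
uniform in both.

Drift. For `p > 2` the Povzner inequality (`povzner_pointwise`, integrated in
`collisionMean_momentJump_le`) bounds the mean change of `|v|^p + |w|^p` by a cross section `κ = ∫
sin²(θ/2) k dσ` times a negative term of order `p` and a mixed term whose highest power is strictly
smaller. The first order effect of a collision, of size `sin(θ/2)`, is odd under reflection of `σ`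
in the axis `v - w` and cancels, which is why grazing collisions are harmless. Integrating against
`μ` and using energy one gives drift `≤ κ (C - c X)` (`exists_momentDrift_le`). The kernel enters
only through the factor `κ ≥ 0`, so the level `C / c` above which the drift is nonpositive is the
same for all cutoffs.

Fluctuation. A collision changes `X` by `N⁻¹` times a jump of size `O((‖v‖ + ‖w‖)^p sin(θ/2))`. The
bracket rate is therefore at most a constant times `N⁻¹ κ ⟨|v|^(2p+γ), μ⟩`, with `κ` at most the
noncutoff cross section. The same drift inequality at order `2p + γ` keeps the expectation of that
moment below a constant times `a₃`, uniformly in time.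

Conclusion. After the last time that `X` is below `L = max(X_0, C/c)` the drift cannot raise it, so
an excess of `ε` over `L` requires the martingale part to exceed `ε/2` in absolute value
(`le_add_of_drift_nonpos`). Doob's inequality bounds that probability by a multiple of `t a₃ N⁻¹
ε⁻²`. The hitting time estimate is the case `ε = 1`, since `Λ_p` is comparable with `1 + X`. For `p
= 2` the moment is the conserved energy and nothing happens. -/

theorem rpow_sub_rpow_le {r x y : ℝ} (hr : 1 ≤ r) (hx : 0 ≤ x) (hy : 0 ≤ y) :
    x ^ r - y ^ r ≤ r * x ^ (r - 1) * (x - y) := by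
  rcases hx.eq_or_lt with rfl | hx
  · rcases hr.eq_or_lt with rfl | hr
    · simp
    · rw [Real.zero_rpow (by linarith), Real.zero_rpow (by linarith)]
      have := Real.rpow_nonneg hy r
      simpa using this
  -- Bernoulli at `y / x - 1`, multiplied by `x ^ r`: the graph lies above its tangent at `x`.
  · have h := one_add_mul_self_le_rpow_one_add (s := y / x - 1) (by
      have : 0 ≤ y / x := by positivity
      linarith) hr
    have e : (1 + (y / x - 1)) ^ r = y ^ r / x ^ r := by
      rw [add_sub_cancel, Real.div_rpow hy hx.le]
    rw [e, le_div_iff₀ (by positivity)] at h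
    have e2 : x ^ r = x ^ (r - 1) * x := by
      rw [← Real.rpow_add_one hx.ne']; ring_nf
    have e3 : (1 + r * (y / x - 1)) * x ^ r = x ^ r + r * x ^ (r - 1) * (y - x) := by
      rw [e2]; field_simp
    rw [e3] at h
    linarith

theorem abs_rpow_sub_rpow_le {r x y R : ℝ} (hr : 1 ≤ r) (hx : 0 ≤ x) (hy : 0 ≤ y)
    (hxR : x ≤ R) (hyR : y ≤ R) :
    |x ^ r - y ^ r| ≤ r * R ^ (r - 1) * |x - y| := by
  have key : ∀ {x y : ℝ}, 0 ≤ x → 0 ≤ y → x ≤ R → y ≤ x →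
      |x ^ r - y ^ r| ≤ r * R ^ (r - 1) * |x - y| := by
    intro x y hx hy hxR hyx
    rw [abs_of_nonneg (sub_nonneg.2 (Real.rpow_le_rpow hy hyx (by linarith))),
      abs_of_nonneg (sub_nonneg.2 hyx)]
    refine (rpow_sub_rpow_le hr hx hy).trans ?_
    gcongr
  rcases le_total y x with h | h
  · exact key hx hy hxR h
  · rw [abs_sub_comm, abs_sub_comm x]; exact key hy hx hyR h

/-- Second differences of `x ↦ x ^ r`. -/
theorem rpow_second_difference_le {r y δ : ℝ} (hr : 1 < r) (hy : 0 < y) (hδ : |δ| ≤ y) :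
    (y + δ) ^ r + (y - δ) ^ r - 2 * y ^ r ≤ r ^ 2 * 2 ^ r * δ ^ 2 * y ^ (r - 2) := by
  wlog hδ0 : 0 ≤ δ generalizing δ
  · have := this (δ := -δ) (by simpa using hδ) (by linarith)
    simpa [add_comm, ← sub_eq_add_neg] using this
  rw [abs_of_nonneg hδ0] at hδ
  have e0 : y ^ r = y ^ (r - 2) * y ^ 2 := by
    rw [← Real.rpow_natCast y 2, ← Real.rpow_add hy]; norm_num
  have h2 : (1 : ℝ) ≤ 2 ^ r := Real.one_le_rpow (by norm_num) (by linarith)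
  have hyr : 0 < y ^ (r - 2) := by positivity
  rcases le_total r 2 with hr2 | hr2
  -- For `r ≤ 2` the power is concave in `x ^ 2`. The two squares have mean `y ^ 2 + δ ^ 2`, and
  -- Bernoulli with exponent `r / 2 ≤ 1` expands the result.
  · have hsq : ∀ x : ℝ, 0 ≤ x → x ^ r = (x ^ 2) ^ (r / 2) := by
      intro x hx
      rw [← Real.rpow_natCast x 2, ← Real.rpow_mul hx]; congr 1; push_cast; ring
    have hc := (Real.concaveOn_rpow (p := r / 2) (by linarith) (by linarith)).2
      (Set.mem_Ici.2 (sq_nonneg (y + δ))) (Set.mem_Ici.2 (sq_nonneg (y - δ)))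
      (by norm_num : (0 : ℝ) ≤ 1 / 2) (by norm_num : (0 : ℝ) ≤ 1 / 2) (by norm_num)
    simp only [smul_eq_mul] at hc
    rw [← hsq _ (by linarith), ← hsq _ (by linarith)] at hc
    have e1 : (1 / 2 * (y + δ) ^ 2 + 1 / 2 * (y - δ) ^ 2 : ℝ) = y ^ 2 * (1 + δ ^ 2 / y ^ 2) := by
      field_simp; ring
    rw [e1, Real.mul_rpow (by positivity) (by positivity), ← hsq _ hy.le] at hc
    have hb := rpow_one_add_le_one_add_mul_self (s := δ ^ 2 / y ^ 2) (p := r / 2)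
      (by have : 0 ≤ δ ^ 2 / y ^ 2 := by positivity
          linarith) (by linarith) (by linarith)
    have : y ^ r * (1 + δ ^ 2 / y ^ 2) ^ (r / 2) ≤ y ^ r + r / 2 * δ ^ 2 * y ^ (r - 2) := by
      refine (mul_le_mul_of_nonneg_left hb (by positivity)).trans (le_of_eq ?_)
      rw [e0]; field_simp
    have h3 : r * δ ^ 2 * y ^ (r - 2) ≤ r ^ 2 * 2 ^ r * δ ^ 2 * y ^ (r - 2) := by
      gcongr
      nlinarith
    linarith
  -- For `r ≥ 2` the tangents at `y ± δ` leave `r δ` times an increment of `x ^ (r - 1)`, to which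
  -- the tangent bound applies once more; `y + δ ≤ 2 y`.
  · have t1 := rpow_sub_rpow_le hr.le (by linarith : 0 ≤ y + δ) hy.le
    have t2 := rpow_sub_rpow_le hr.le (by linarith : 0 ≤ y - δ) hy.le
    have t3 := rpow_sub_rpow_le (by linarith : 1 ≤ r - 1) (by linarith : 0 ≤ y + δ)
      (by linarith : 0 ≤ y - δ)
    have t4 : (y + δ) ^ (r - 1 - 1) ≤ 2 ^ (r - 2) * y ^ (r - 2) := by
      rw [← Real.mul_rpow (by norm_num) hy.le, show r - 1 - 1 = r - 2 by ring]
      exact Real.rpow_le_rpow (by linarith) (by linarith) (by linarith)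
    have e4 : (2 : ℝ) ^ r = 2 ^ (r - 2) * 4 := by
      rw [show (4 : ℝ) = 2 ^ (2 : ℝ) by norm_num, ← Real.rpow_add (by norm_num)]; norm_num
    calc (y + δ) ^ r + (y - δ) ^ r - 2 * y ^ r
        ≤ r * δ * ((y + δ) ^ (r - 1) - (y - δ) ^ (r - 1)) := by linarith
      _ ≤ r * δ * ((r - 1) * (2 ^ (r - 2) * y ^ (r - 2)) * (2 * δ)) := by
          gcongr
          rw [show y + δ - (y - δ) = 2 * δ by ring] at t3
          exact t3.trans (mul_le_mul_of_nonneg_right (mul_le_mul_of_nonneg_left t4 (by linarith))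
            (by linarith : 0 ≤ 2 * δ))
      _ ≤ r ^ 2 * 2 ^ r * δ ^ 2 * y ^ (r - 2) := by
          rw [e4]
          have : 0 ≤ δ ^ 2 * 2 ^ (r - 2) * y ^ (r - 2) := by positivity
          nlinarith

theorem rpow_add_le_of_le {r a b : ℝ} (hr : 1 < r) (hb : 0 ≤ b) (hab : b ≤ a) :
    (a + b) ^ r ≤ a ^ r + r * 2 ^ r * (a ^ (r - 1) * b) := by
  have ha : 0 ≤ a := hb.trans hab
  have h := rpow_sub_rpow_le hr.le (by linarith : 0 ≤ a + b) ha
  have h2 : (a + b) ^ (r - 1) ≤ 2 ^ r * a ^ (r - 1) := by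
    calc (a + b) ^ (r - 1) ≤ (2 * a) ^ (r - 1) :=
          Real.rpow_le_rpow (by linarith) (by linarith) (by linarith)
      _ = 2 ^ (r - 1) * a ^ (r - 1) := Real.mul_rpow (by norm_num) ha
      _ ≤ _ := by gcongr <;> linarith
  have h3 : r * (a + b) ^ (r - 1) * (a + b - a) ≤ r * (2 ^ r * a ^ (r - 1)) * b := by
    rw [add_sub_cancel_left]; gcongr
  linarith

/-- The mixed term of the Povzner inequality. -/
def povznerMixed (r a b : ℝ) : ℝ :=
  max a b ^ max (r - 1) 1 * min a b ^ min (r - 1) 1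

theorem povznerMixed_nonneg {r a b : ℝ} (ha : 0 ≤ a) (hb : 0 ≤ b) : 0 ≤ povznerMixed r a b := by
  have : 0 ≤ max a b := ha.trans (le_max_left _ _)
  have : 0 ≤ min a b := le_min ha hb
  unfold povznerMixed; positivity

theorem povznerMixed_comm (r a b : ℝ) : povznerMixed r a b = povznerMixed r b a := by
  unfold povznerMixed; rw [max_comm, min_comm]

/-- For `b ≤ a` the mixed term is `a * b ^ (r - 1)` when `r ≤ 2` and `a ^ (r - 1) * b` when `r ≥ 2`.
In the first case the claim amounts to `b ^ (2 - r) ≤ a ^ (2 - r)`. -/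
theorem rpow_mul_le_povznerMixed {r a b : ℝ} (hr : 1 < r) (hb : 0 ≤ b) (hab : b ≤ a) :
    a ^ (r - 1) * b ≤ povznerMixed r a b := by
  have ha : 0 ≤ a := hb.trans hab
  unfold povznerMixed
  rw [max_eq_left hab, min_eq_right hab]
  rcases le_total (r - 1) 1 with h | h
  · rw [max_eq_right h, min_eq_left h]
    rcases hb.eq_or_lt with rfl | hb'
    · simp [Real.zero_rpow (by linarith : r - 1 ≠ 0)]
    have ha' : 0 < a := hb'.trans_le hab
    have e1 : a ^ (1 : ℝ) = a ^ (r - 1) * a ^ (2 - r) := by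
      rw [← Real.rpow_add ha']; ring_nf
    have e2 : b = b ^ (r - 1) * b ^ (2 - r) := by
      rw [← Real.rpow_add hb']; ring_nf; simp
    rw [e1]
    nth_rw 1 [e2]
    have : b ^ (2 - r) ≤ a ^ (2 - r) := Real.rpow_le_rpow hb hab (by linarith)
    have h0 : 0 ≤ a ^ (r - 1) * b ^ (r - 1) := by positivity
    nlinarith
  · rw [max_eq_left h, min_eq_right h]; simp

/-- Controls the second order term, with `y` a mean energy after collision. For `r ≤ 2` the power of
`y` decreases and the lower bound on `y` matters, which forces the weaker factor `b ^ (r - 1)` in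
the mixed term; for `r ≥ 2` the upper bound matters. -/
theorem mul_rpow_sub_two_le_povznerMixed {r a b y : ℝ} (hr : 1 < r) (hb : 0 < b) (hab : b ≤ a)
    (hy1 : b / 2 ≤ y) (hy2 : y ≤ 2 * a) :
    a * b * y ^ (r - 2) ≤ 2 ^ r * povznerMixed r a b := by
  have ha : 0 < a := hb.trans_le hab
  have hy : 0 < y := by linarith
  unfold povznerMixed
  rw [max_eq_left hab, min_eq_right hab]
  rcases le_total (r - 1) 1 with h | h
  · rw [max_eq_right h, min_eq_left h]
    have h1 : y ^ (r - 2) ≤ (b / 2) ^ (r - 2) :=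
      Real.rpow_le_rpow_of_nonpos (by positivity) hy1 (by linarith)
    have h2 : (b / 2) ^ (r - 2) = b ^ (r - 2) * 2 ^ (2 - r) := by
      rw [Real.div_rpow hb.le (by norm_num), div_eq_mul_inv, ← Real.rpow_neg (by norm_num)]
      ring_nf
    have h3 : (2 : ℝ) ^ (2 - r) ≤ 2 ^ r :=
      Real.rpow_le_rpow_of_exponent_le (by norm_num) (by linarith)
    have h4 : b * b ^ (r - 2) = b ^ (r - 1) := by
      rw [mul_comm, ← Real.rpow_add_one hb.ne']; ring_nf
    calc a * b * y ^ (r - 2) ≤ a * b * (b ^ (r - 2) * 2 ^ r) := by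
          rw [h2] at h1
          gcongr
          exact h1.trans (by gcongr)
      _ = 2 ^ r * (a ^ (1 : ℝ) * (b * b ^ (r - 2))) := by rw [Real.rpow_one]; ring
      _ = _ := by rw [h4]
  · rw [max_eq_left h, min_eq_right h]
    have h1 : y ^ (r - 2) ≤ (2 * a) ^ (r - 2) := Real.rpow_le_rpow hy.le hy2 (by linarith)
    rw [Real.mul_rpow (by norm_num) ha.le] at h1
    have h3 : (2 : ℝ) ^ (r - 2) ≤ 2 ^ r :=
      Real.rpow_le_rpow_of_exponent_le (by norm_num) (by linarith)
    have h4 : a * a ^ (r - 2) = a ^ (r - 1) := by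
      rw [mul_comm, ← Real.rpow_add_one ha.ne']; ring_nf
    calc a * b * y ^ (r - 2) ≤ a * b * (2 ^ r * a ^ (r - 2)) := by
          gcongr
          exact h1.trans (by gcongr)
      _ = 2 ^ r * ((a * a ^ (r - 2)) * b ^ (1 : ℝ)) := by rw [Real.rpow_one]; ring
      _ = _ := by rw [h4]

/-- The coercivity constant of the Povzner inequality. -/
def povznerGain (r : ℝ) : ℝ := 2 - 2 ^ (2 - r)

/-- The constant of the mixed term of the Povzner inequality. -/
def povznerLoss (r : ℝ) : ℝ := 4 * r ^ 2 * 2 ^ r * 2 ^ r + 2 * r * 2 ^ r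

theorem povznerGain_pos {r : ℝ} (hr : 1 < r) : 0 < povznerGain r := by
  have : (2 : ℝ) ^ (2 - r) < 2 ^ (1 : ℝ) :=
    Real.rpow_lt_rpow_of_exponent_lt (by norm_num) (by linarith)
  unfold povznerGain
  norm_num at this; linarith

theorem povznerLoss_nonneg {r : ℝ} (hr : 1 < r) : 0 ≤ povznerLoss r := by
  unfold povznerLoss; positivity

/-- Symmetrised Povzner inequality for the energies before and after a collision. -/
theorem povzner_pointwise {r a b s δ : ℝ} (hr : 1 < r) (ha : 0 ≤ a) (hb : 0 ≤ b)
    (hs : 0 ≤ s) (hs' : s ≤ 1 / 2) (hδ : δ ^ 2 ≤ 4 * a * b * s * (1 - s)) :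
    ((1 - s) * a + s * b + δ) ^ r + (s * a + (1 - s) * b - δ) ^ r
      + (((1 - s) * a + s * b - δ) ^ r + (s * a + (1 - s) * b + δ) ^ r) - 2 * (a ^ r + b ^ r)
    ≤ 2 * s * (-povznerGain r * (a ^ r + b ^ r) + povznerLoss r * povznerMixed r a b) := by
  wlog hab : b ≤ a generalizing a b δ
  · have h := this hb ha (δ := -δ) (by linarith [neg_sq δ]) (le_of_not_ge hab)
    rw [povznerMixed_comm r b a, add_comm (b ^ r)] at h
    have e1 : (1 - s) * b + s * a + -δ = s * a + (1 - s) * b - δ := by ring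
    have e2 : s * b + (1 - s) * a - -δ = (1 - s) * a + s * b + δ := by ring
    have e3 : (1 - s) * b + s * a - -δ = s * a + (1 - s) * b + δ := by ring
    have e4 : s * b + (1 - s) * a + -δ = (1 - s) * a + s * b - δ := by ring
    rw [e1, e2, e3, e4] at h
    linarith
  set m := (1 - s) * a + s * b with hm
  set n := s * a + (1 - s) * b with hn
  have hm0 : 0 ≤ m := by
    have : 0 ≤ (1 - s) * a := mul_nonneg (by linarith) ha
    have : 0 ≤ s * b := mul_nonneg hs hb
    linarith
  have hn0 : 0 ≤ n := by
    have : 0 ≤ (1 - s) * b := mul_nonneg (by linarith) hb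
    have : 0 ≤ s * a := mul_nonneg hs ha
    linarith
  -- By the arithmetic-geometric mean inequality for `(1 - s) * a` and `s * b`; likewise for `n`
  -- below.
  have hδm : |δ| ≤ m := by
    refine abs_le_of_sq_le_sq ?_ hm0
    nlinarith [sq_nonneg ((1 - s) * a - s * b)]
  have hδn : |δ| ≤ n := by
    refine abs_le_of_sq_le_sq ?_ hn0
    nlinarith [sq_nonneg (s * a - (1 - s) * b)]
  -- first order part
  have conv : m ^ r + n ^ r - (a ^ r + b ^ r)
      ≤ -povznerGain r * s * (a ^ r + b ^ r) + s * (2 * r * 2 ^ r * povznerMixed r a b) := by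
    -- `m` and `n` arise from `a` and `b` by moving the fraction `2 s ≤ 1` of the way to the
    -- midpoint. Convexity replaces the fraction `2 s` of `a ^ r + b ^ r` by the midpoint value, and
    -- the loss `2 ^ (2 - r) < 2` produces the gain.
    have hc := convexOn_rpow hr.le
    have c1 := hc.2 (Set.mem_Ici.2 ha) (Set.mem_Ici.2 (by linarith : 0 ≤ (a + b) / 2))
      (by linarith : 0 ≤ 1 - 2 * s) (by linarith : 0 ≤ 2 * s) (by ring)
    have c2 := hc.2 (Set.mem_Ici.2 hb) (Set.mem_Ici.2 (by linarith : 0 ≤ (a + b) / 2))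
      (by linarith : 0 ≤ 1 - 2 * s) (by linarith : 0 ≤ 2 * s) (by ring)
    simp only [smul_eq_mul] at c1 c2
    rw [show (1 - 2 * s) * a + 2 * s * ((a + b) / 2) = m by rw [hm]; ring] at c1
    rw [show (1 - 2 * s) * b + 2 * s * ((a + b) / 2) = n by rw [hn]; ring] at c2
    have e1 : 4 * ((a + b) / 2) ^ r = 2 ^ (2 - r) * (a + b) ^ r := by
      rw [Real.div_rpow (by linarith) (by norm_num), Real.rpow_sub (by norm_num)]
      norm_num; ring
    have h1 := rpow_add_le_of_le hr hb hab
    have h2 := rpow_mul_le_povznerMixed hr hb hab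
    have h3 : (2 : ℝ) ^ (2 - r) ≤ 2 := by have := povznerGain_pos hr; unfold povznerGain at this; linarith
    have h4 : (2 : ℝ) ^ (2 - r) * (a + b) ^ r
        ≤ 2 ^ (2 - r) * (a ^ r + b ^ r) + 2 * (r * 2 ^ r * povznerMixed r a b) := by
      have hb' : 0 ≤ b ^ r := by positivity
      have hp : (0 : ℝ) < 2 ^ (2 - r) := by positivity
      have hQ : 0 ≤ r * 2 ^ r * povznerMixed r a b :=
        mul_nonneg (by positivity) (povznerMixed_nonneg ha hb)
      have h5 : (a + b) ^ r ≤ (a ^ r + b ^ r) + r * 2 ^ r * povznerMixed r a b := by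
        have : r * 2 ^ r * (a ^ (r - 1) * b) ≤ r * 2 ^ r * povznerMixed r a b := by gcongr
        linarith
      have h6 := mul_le_mul_of_nonneg_left h5 hp.le
      nlinarith
    have h7 := mul_le_mul_of_nonneg_left h4 hs
    rw [← e1] at h7
    unfold povznerGain
    nlinarith
  -- The two signs of `δ` combine to second differences at `m` and `n`; since `δ ^ 2 ≤ 4 s a b`,
  -- they keep the factor `s`.
  have second : ∀ y : ℝ, b / 2 ≤ y → y ≤ 2 * a → |δ| ≤ y →
      (y + δ) ^ r + (y - δ) ^ r - 2 * y ^ r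
        ≤ s * (4 * r ^ 2 * 2 ^ r * 2 ^ r * povznerMixed r a b) := by
    intro y h1 h2 h3
    rcases hb.eq_or_lt with rfl | hb'
    · have : δ = 0 := by
        have : δ ^ 2 ≤ 0 := by simpa using hδ
        nlinarith
      subst this
      have : 0 ≤ s * (4 * r ^ 2 * 2 ^ r * 2 ^ r * povznerMixed r a 0) :=
        mul_nonneg hs (mul_nonneg (by positivity) (povznerMixed_nonneg ha hb))
      simp only [add_zero, sub_zero]; linarith
    have hy : 0 < y := by linarith
    have h4 := rpow_second_difference_le hr hy h3
    have h5 := mul_rpow_sub_two_le_povznerMixed hr hb' hab h1 h2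
    have h6 : δ ^ 2 ≤ 4 * s * (a * b) := by
      have : 0 ≤ a * b * s * s := by positivity
      nlinarith
    calc _ ≤ _ := h4
      _ ≤ r ^ 2 * 2 ^ r * (4 * s * (a * b)) * y ^ (r - 2) := by gcongr
      _ = r ^ 2 * 2 ^ r * (4 * s) * (a * b * y ^ (r - 2)) := by ring
      _ ≤ r ^ 2 * 2 ^ r * (4 * s) * (2 ^ r * povznerMixed r a b) := by gcongr
      _ = _ := by ring
  have s1 := second m (by rw [hm]; nlinarith) (by rw [hm]; nlinarith) hδm
  have s2 := second n (by rw [hn]; nlinarith) (by rw [hn]; nlinarith) hδn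
  unfold povznerLoss
  linarith

variable {d : ℕ}

/-! ## The surface measure -/

/-- The homeomorphism of the unit sphere induced by a linear isometry. -/
def sphereHomeomorph (L : EuclideanSpace ℝ (Fin d) ≃ₗᵢ[ℝ] EuclideanSpace ℝ (Fin d)) :
    Metric.sphere (0 : EuclideanSpace ℝ (Fin d)) 1 ≃ₜ
      Metric.sphere (0 : EuclideanSpace ℝ (Fin d)) 1 :=
  L.toHomeomorph.subtype (fun x => by simp)

@[simp]
theorem coe_sphereHomeomorph (L : EuclideanSpace ℝ (Fin d) ≃ₗᵢ[ℝ] EuclideanSpace ℝ (Fin d))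
    (σ : Metric.sphere (0 : EuclideanSpace ℝ (Fin d)) 1) :
    (sphereHomeomorph L σ : EuclideanSpace ℝ (Fin d)) = L σ := rfl

instance : IsFiniteMeasure (surface d) := by unfold surface; infer_instance

open scoped Pointwise in
-- The surface measure of a set is `d` times the volume of the cone over it; a linear isometry
-- commutes with forming cones and preserves volume.
theorem measurePreserving_sphereHomeomorph
    (L : EuclideanSpace ℝ (Fin d) ≃ₗᵢ[ℝ] EuclideanSpace ℝ (Fin d)) :
    MeasurePreserving (sphereHomeomorph L) (surface d) (surface d) := by
  refine ⟨(sphereHomeomorph L).continuous.measurable, ?_⟩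
  ext s hs
  have hs' := (sphereHomeomorph L).continuous.measurable hs
  rw [Measure.map_apply (sphereHomeomorph L).continuous.measurable hs, surface,
    Measure.toSphere_apply' _ hs, Measure.toSphere_apply' _ hs']
  congr 1
  rw [← (L.measurePreserving).measure_preimage_emb L.toHomeomorph.measurableEmbedding
    (Set.Ioo (0 : ℝ) 1 • (Subtype.val '' s))]
  congr 1
  ext x
  simp only [Set.mem_preimage, Set.mem_smul, Set.mem_image, Subtype.exists]
  constructor
  · rintro ⟨t, ht, _, ⟨y, hy, hys, rfl⟩, rfl⟩
    exact ⟨t, ht, L y, ⟨L y, by simpa using hy, hys, rfl⟩, by simp⟩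
  · rintro ⟨t, ht, _, ⟨y, hy, hys, rfl⟩, hx⟩
    refine ⟨t, ht, L.symm y, ⟨L.symm y, by simpa using hy, ?_, rfl⟩, ?_⟩
    · convert hys using 1
      ext1; simp
    · apply L.injective; simpa using hx

theorem integral_sphereHomeomorph
    (L : EuclideanSpace ℝ (Fin d) ≃ₗᵢ[ℝ] EuclideanSpace ℝ (Fin d))
    (f : Metric.sphere (0 : EuclideanSpace ℝ (Fin d)) 1 → ℝ) :
    ∫ σ, f (sphereHomeomorph L σ) ∂(surface d) = ∫ σ, f σ ∂(surface d) :=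
  (measurePreserving_sphereHomeomorph L).integral_comp
    (sphereHomeomorph L).measurableEmbedding f

theorem exists_isometry_apply_eq {e e' : EuclideanSpace ℝ (Fin d)} (h : ‖e‖ = ‖e'‖) :
    ∃ L : EuclideanSpace ℝ (Fin d) ≃ₗᵢ[ℝ] EuclideanSpace ℝ (Fin d), L e = e' :=
  ⟨_, Submodule.reflection_sub h⟩

/-- The spherical cap of the points `σ` whose angle `θ` with `e` satisfies `sin(θ/2) ≤ ρ`. -/
def cap (e : EuclideanSpace ℝ (Fin d)) (ρ : ℝ) :
    Set (Metric.sphere (0 : EuclideanSpace ℝ (Fin d)) 1) :=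
  {σ | (1 - inner ℝ e (σ : EuclideanSpace ℝ (Fin d))) / 2 ≤ ρ ^ 2}

theorem measurableSet_cap (e : EuclideanSpace ℝ (Fin d)) (ρ : ℝ) : MeasurableSet (cap e ρ) := by
  refine measurableSet_le ?_ measurable_const
  fun_prop

theorem surface_cap_eq {e e' : EuclideanSpace ℝ (Fin d)} (h : ‖e‖ = ‖e'‖) (ρ : ℝ) :
    surface d (cap e ρ) = surface d (cap e' ρ) := by
  obtain ⟨L, rfl⟩ := exists_isometry_apply_eq h
  rw [← (measurePreserving_sphereHomeomorph L).measure_preimage_emb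
    (sphereHomeomorph L).measurableEmbedding (cap (L e) ρ)]
  congr 1
  ext σ
  simp [cap]

theorem norm_sphere (σ : Metric.sphere (0 : EuclideanSpace ℝ (Fin d)) 1) :
    ‖(σ : EuclideanSpace ℝ (Fin d))‖ = 1 := by simp

theorem inner_sphere_le_one {e : EuclideanSpace ℝ (Fin d)} (he : ‖e‖ = 1)
    (σ : Metric.sphere (0 : EuclideanSpace ℝ (Fin d)) 1) :
    |inner ℝ e (σ : EuclideanSpace ℝ (Fin d))| ≤ 1 := by
  have := abs_real_inner_le_norm e (σ : EuclideanSpace ℝ (Fin d))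
  rwa [he, norm_sphere, one_mul] at this

open scoped Pointwise in
-- With the axis turned to the coordinate direction `0`, a point `w` of the cap satisfies `w_i² ≤ 1
-- - w_0² ≤ 2 (1 - w_0) ≤ (2 ρ)²` for `i ≠ 0`. The cone over the cap thus lies in a box with one
-- side `2` and `d - 1` sides `4 ρ`.
theorem surface_cap_le (hd : 2 ≤ d) {e : EuclideanSpace ℝ (Fin d)} (he : ‖e‖ = 1) {ρ : ℝ}
    (hρ : 0 ≤ ρ) :
    surface d (cap e ρ) ≤ ENNReal.ofReal (d * 2 * 4 ^ (d - 1) * ρ ^ (d - 1)) := by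
  obtain ⟨n, rfl⟩ : ∃ n, d = n + 1 := ⟨d - 1, by omega⟩
  rw [surface_cap_eq (e' := EuclideanSpace.single 0 1) (by simp [he]), surface,
    Measure.toSphere_apply' _ (measurableSet_cap _ _)]
  set box : Set (Fin (n + 1) → ℝ) := Set.univ.pi
    (fun i => if i = 0 then Set.Icc (-1) 1 else Set.Icc (-(2 * ρ)) (2 * ρ)) with hbox
  have hsub : (Set.Ioo (0 : ℝ) 1 • (Subtype.val '' cap (EuclideanSpace.single 0 1) ρ)
      : Set (EuclideanSpace ℝ (Fin (n + 1)))) ⊆ (WithLp.ofLp) ⁻¹' box := by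
    rintro _ ⟨t, ht, _, ⟨⟨w, hw⟩, hσ, rfl⟩, rfl⟩
    have hnorm : ∑ i, w i ^ 2 = 1 := by
      rw [← EuclideanSpace.real_norm_sq_eq, mem_sphere_zero_iff_norm.1 hw, one_pow]
    have hle : ∀ i, w i ^ 2 ≤ 1 := fun i => by
      rw [← hnorm]
      exact Finset.single_le_sum (f := fun i => w i ^ 2)
        (fun _ _ => sq_nonneg _) (Finset.mem_univ i)
    have h0 : (1 - w 0) / 2 ≤ ρ ^ 2 := by
      simpa [cap, EuclideanSpace.inner_single_left] using hσ
    have hlt : ∀ i ≠ 0, w i ^ 2 ≤ (2 * ρ) ^ 2 := by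
      intro i hi
      have h1 : w 0 ^ 2 +
          w i ^ 2 ≤ 1 := by
        rw [← hnorm, ← Finset.sum_pair hi.symm
          (f := fun i => w i ^ 2)]
        exact Finset.sum_le_sum_of_subset_of_nonneg (Finset.subset_univ _)
          (fun _ _ _ => sq_nonneg _)
      have h2 : |w 0| ≤ 1 := (sq_le_one_iff_abs_le_one _).1 (hle 0)
      have h3 := (abs_le.1 h2).2
      nlinarith
    simp only [hbox, Set.mem_preimage, Set.mem_pi, Set.mem_univ, true_implies]
    intro i
    have aux : ∀ y R : ℝ, 0 ≤ R → y ^ 2 ≤ R ^ 2 → t * y ∈ Set.Icc (-R) R := by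
      intro y R hR hy
      have h1 := abs_le_of_sq_le_sq hy hR
      rw [Set.mem_Icc, ← abs_le, abs_mul, abs_of_pos ht.1]
      calc t * |y| ≤ 1 * R := by
            gcongr
            exact ht.2.le
        _ = R := one_mul R
    split_ifs with hi
    · exact aux (w i) 1 zero_le_one (by simpa only [one_pow] using hle i)
    · exact aux (w i) (2 * ρ) (by positivity) (hlt i hi)
  have hmeas : volume ((WithLp.ofLp) ⁻¹' box : Set (EuclideanSpace ℝ (Fin (n + 1))))
      = ENNReal.ofReal (2 * (4 * ρ) ^ n) := by
    rw [(PiLp.volume_preserving_ofLp _).measure_preimage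
      (MeasurableSet.univ_pi fun i => by split_ifs <;> exact measurableSet_Icc).nullMeasurableSet,
      volume_pi_pi, Fin.prod_univ_succ]
    have h1 : ∀ i : Fin n, volume (if i.succ = 0 then Set.Icc (-1 : ℝ) 1
        else Set.Icc (-(2 * ρ)) (2 * ρ)) = ENNReal.ofReal (4 * ρ) := by
      intro i
      rw [if_neg (Fin.succ_ne_zero i), Real.volume_Icc]; congr 1; ring
    simp only [h1, if_true, Real.volume_Icc, Finset.prod_const, Finset.card_univ,
      Fintype.card_fin]
    rw [← ENNReal.ofReal_pow (by positivity), ← ENNReal.ofReal_mul (by norm_num)]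
    norm_num
  calc _ ≤ (Module.finrank ℝ (EuclideanSpace ℝ (Fin (n + 1))) : ℝ≥0∞)
        * ENNReal.ofReal (2 * (4 * ρ) ^ n) := by
        rw [← hmeas]; gcongr
    _ = _ := by
        rw [finrank_euclideanSpace_fin, ← ENNReal.ofReal_natCast, ← ENNReal.ofReal_mul (by positivity)]
        congr 1
        simp only [Nat.add_sub_cancel, mul_pow]; ring

/-- Dyadic decomposition: where `2^(-n-1) < f ≤ 2^(-n)` the integrand is at most `2^((n+1)a)`, on a
set of measure at most `C 2^(-nD)`. The series is geometric with ratio `2^(a-D) < 1`. -/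
theorem lintegral_rpow_neg_lt_top {X : Type*} [MeasurableSpace X] {m : Measure X} {f : X → ℝ}
    (hf : Measurable f) (hf1 : ∀ x, f x ≤ 1) {C D a : ℝ} (hC : 0 ≤ C) (ha : 0 ≤ a) (haD : a < D)
    (hm : ∀ ρ : ℝ, 0 < ρ → m {x | f x ≤ ρ} ≤ ENNReal.ofReal (C * ρ ^ D)) :
    ∫⁻ x, (if 0 < f x then ENNReal.ofReal (f x ^ (-a)) else 0) ∂m < ∞ := by
  have hpt : ∀ x, (if 0 < f x then ENNReal.ofReal (f x ^ (-a)) else 0) ≤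
      ∑' n : ℕ, Set.indicator {x | f x ≤ (1 / 2) ^ n}
        (fun _ => ENNReal.ofReal (((1 / 2 : ℝ) ^ (n + 1)) ^ (-a))) x := by
    intro x
    split_ifs with hx
    · obtain ⟨n, hn1, hn2⟩ := exists_nat_pow_near_of_lt_one hx (hf1 x)
        (by norm_num : (0 : ℝ) < 1 / 2) (by norm_num)
      refine le_trans ?_ (ENNReal.le_tsum n)
      rw [Set.indicator_of_mem (by exact hn2)]
      exact ENNReal.ofReal_le_ofReal
        (Real.rpow_le_rpow_of_nonpos (by positivity) hn1.le (by linarith))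
    · exact zero_le
  refine (lintegral_mono hpt).trans_lt ?_
  rw [lintegral_tsum fun n => (measurable_const.indicator
    (measurableSet_le hf measurable_const)).aemeasurable]
  have hterm : ∀ n : ℕ, ∫⁻ x, Set.indicator {x | f x ≤ (1 / 2) ^ n}
        (fun _ => ENNReal.ofReal (((1 / 2 : ℝ) ^ (n + 1)) ^ (-a))) x ∂m
      ≤ ENNReal.ofReal (C * 2 ^ a * ((1 / 2 : ℝ) ^ (D - a)) ^ n) := by
    intro n
    rw [lintegral_indicator_const (measurableSet_le hf measurable_const)]
    refine (mul_le_mul_right (hm _ (by positivity)) _).trans (le_of_eq ?_)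
    rw [← ENNReal.ofReal_mul (by positivity)]
    congr 1
    have h2 : ((1 / 2 : ℝ)) = 2 ^ (-1 : ℝ) := by norm_num [Real.rpow_neg_one]
    rw [h2]
    simp only [← Real.rpow_natCast, ← Real.rpow_mul (zero_le_two (α := ℝ))]
    rw [mul_left_comm, ← Real.rpow_add two_pos, mul_assoc C, ← Real.rpow_add two_pos]
    congr 2
    push_cast; ring
  refine (ENNReal.tsum_le_tsum hterm).trans_lt ?_
  rw [← ENNReal.ofReal_tsum_of_nonneg (fun n => by positivity)]
  · exact ENNReal.ofReal_lt_top
  · exact (summable_geometric_of_lt_one (by positivity)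
      (Real.rpow_lt_one (by norm_num) (by norm_num) (by linarith))).mul_left _

/-! ## Angular kernels -/

/-- `cos θ = σ · z / |z|`, equal to zero for `z = 0`. -/
def cosAngle (z σ : EuclideanSpace ℝ (Fin d)) : ℝ := inner ℝ z σ / ‖z‖

theorem cos_deflection (z : EuclideanSpace ℝ (Fin d))
    (σ : Metric.sphere (0 : EuclideanSpace ℝ (Fin d)) 1) :
    Real.cos (deflection z σ) = cosAngle z σ := by
  rw [deflection, InnerProductGeometry.cos_angle, norm_sphere, mul_one, cosAngle]

theorem cosAngle_of_norm_eq_one {e : EuclideanSpace ℝ (Fin d)} (he : ‖e‖ = 1)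
    (σ : EuclideanSpace ℝ (Fin d)) : cosAngle e σ = inner ℝ e σ := by
  rw [cosAngle, he, div_one]

theorem cosAngle_normalize (z : EuclideanSpace ℝ (Fin d)) (σ : EuclideanSpace ℝ (Fin d)) :
    cosAngle z σ = inner ℝ (‖z‖⁻¹ • z) σ := by
  rw [cosAngle, real_inner_smul_left, div_eq_inv_mul]

theorem norm_normalize {z : EuclideanSpace ℝ (Fin d)} (hz : z ≠ 0) : ‖(‖z‖⁻¹ • z)‖ = 1 := by
  rw [norm_smul, norm_inv, norm_norm, inv_mul_cancel₀ (norm_ne_zero_iff.2 hz)]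

theorem abs_cosAngle_le_one (z : EuclideanSpace ℝ (Fin d))
    (σ : Metric.sphere (0 : EuclideanSpace ℝ (Fin d)) 1) : |cosAngle z σ| ≤ 1 := by
  rcases eq_or_ne z 0 with rfl | hz
  · simp [cosAngle]
  · rw [cosAngle_normalize]
    exact inner_sphere_le_one (norm_normalize hz) σ

theorem cosAngle_neg (z σ : EuclideanSpace ℝ (Fin d)) : cosAngle (-z) σ = -cosAngle z σ := by
  simp [cosAngle, neg_div]

/-- `sin²(θ/2)` as a function of `cos θ`. -/
def halfSinSq (x : ℝ) : ℝ := (1 - x) / 2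

theorem measurable_halfSinSq : Measurable halfSinSq := by unfold halfSinSq; fun_prop

variable (d) in
/-- A bounded-in-energy angular kernel `k`, as a function of `cos θ`: it is supported in
`θ ∈ (0, π/2]` and `∫ sin(θ/2) k dσ < ∞`. -/
structure IsAngularKernel (k : ℝ → ℝ) : Prop where
  measurable : Measurable k
  nonneg : ∀ x, 0 ≤ k x
  support : ∀ x, x ∉ Set.Ico (0 : ℝ) 1 → k x = 0
  integrable : ∀ e : EuclideanSpace ℝ (Fin d), ‖e‖ = 1 →
    Integrable (fun σ : Metric.sphere (0 : EuclideanSpace ℝ (Fin d)) 1 =>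
      √(halfSinSq (cosAngle e σ)) * k (cosAngle e σ)) (surface d)

/-- The angular part of the noncutoff kernel, as a function of `cos θ`. -/
def angularPart (d : ℕ) (b : ℝ → ℝ) (x : ℝ) : ℝ :=
  open Classical in if x ∈ Set.Ico (0 : ℝ) 1 then √(1 - x ^ 2) ^ (2 - (d : ℤ)) * b x else 0

/-- The angular part of the kernel truncated at the angle `θ₀`. -/
def truncatedAngularPart (d : ℕ) (b : ℝ → ℝ) (θ₀ x : ℝ) : ℝ :=
  open Classical in if θ₀ < Real.arccos x then angularPart d b x else 0

/-- Convexity on `[0,1)` gives continuity only on the open interval; a possible jump at `0` is added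
as a separate term. -/
theorem IsAngularProfile.measurable_indicator {ν : ℝ} {b : ℝ → ℝ} (hb : IsAngularProfile ν b) :
    Measurable ((Set.Ico (0 : ℝ) 1).indicator b) := by
  have h1 : Measurable ((Set.Ioo (0 : ℝ) 1).indicator b) := by
    have hc : ContinuousOn b (Set.Ioo (0 : ℝ) 1) := by
      have := hb.convex.continuousOn_interior
      rwa [interior_Ico] at this
    classical
    have := hc.measurable_piecewise (g := fun _ => (0 : ℝ)) continuousOn_const measurableSet_Ioo
    rwa [show (Set.Ioo (0 : ℝ) 1).indicator b = (Set.Ioo (0 : ℝ) 1).piecewise b (fun _ => 0) from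
      (Set.piecewise_eq_indicator).symm]
  have h2 : Measurable ((({0} : Set ℝ)).indicator (fun _ => b 0)) :=
    measurable_const.indicator (measurableSet_singleton _)
  convert h2.add h1 using 1
  ext x
  by_cases hx : x = 0
  · subst hx; simp
  · simp only [Set.indicator_apply, Set.mem_Ico, Pi.add_apply, Set.mem_singleton_iff, hx, if_false,
      Set.mem_Ioo, zero_add]
    congr 1
    exact propext ⟨fun h => ⟨lt_of_le_of_ne h.1 (Ne.symm hx), h.2⟩, fun h => ⟨h.1.le, h.2⟩⟩

theorem measurable_angularPart {ν : ℝ} {b : ℝ → ℝ} (hb : IsAngularProfile ν b) :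
    Measurable (angularPart d b) := by
  have h : angularPart d b = fun x =>
      √(1 - x ^ 2) ^ (2 - (d : ℤ)) * (Set.Ico (0 : ℝ) 1).indicator b x := by
    ext x
    unfold angularPart
    by_cases hx : x ∈ Set.Ico (0 : ℝ) 1 <;> simp [hx]
  rw [h]
  refine Measurable.mul ?_ hb.measurable_indicator
  have : Measurable fun x : ℝ => √(1 - x ^ 2) := by fun_prop
  exact this.pow_const _

theorem angularPart_nonneg {ν : ℝ} {b : ℝ → ℝ} (hb : IsAngularProfile ν b) (x : ℝ) :
    0 ≤ angularPart d b x := by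
  unfold angularPart
  split_ifs with hx
  · have := hb.nonneg x hx
    positivity
  · exact le_rfl

/-- Here `√(halfSinSq x) = sin(θ/2)`. For small `θ` this is the grazing asymptotics with `sin(θ/2) ≤
θ`. Away from `θ = 0` convexity bounds `b` by its values at the ends of `[0, cos η]`, and the power
on the right is at least one. -/
theorem IsAngularProfile.exists_le {ν : ℝ} (hν : 0 ≤ ν) {b : ℝ → ℝ} (hb : IsAngularProfile ν b) :
    ∃ C : ℝ, 0 ≤ C ∧ ∀ x ∈ Set.Ico (0 : ℝ) 1, b x ≤ C * √(halfSinSq x) ^ (-1 - ν) := by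
  obtain ⟨C, hC⟩ := hb.grazing.1.bound
  obtain ⟨δ, hδ, hC⟩ := mem_nhdsGT_iff_exists_Ioo_subset.1 hC
  simp only [Set.mem_Ioi] at hδ
  set η := min (δ / 2) 1 with hη
  have hη0 : 0 < η := lt_min (by linarith) one_pos
  have hη1 : η ≤ 1 := min_le_right _ _
  have hpi := Real.pi_gt_three
  have hx1 : Real.cos η ∈ Set.Ico (0 : ℝ) 1 := by
    refine ⟨Real.cos_nonneg_of_mem_Icc ⟨by linarith, by linarith⟩, ?_⟩
    rw [← Real.cos_zero]
    exact Real.cos_lt_cos_of_nonneg_of_le_pi le_rfl (by linarith) hη0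
  have h00 : (0 : ℝ) ∈ Set.Ico (0 : ℝ) 1 := ⟨le_rfl, one_pos⟩
  have hC0 : ∀ x ∈ Set.Ico (0 : ℝ) 1, (0 < √(halfSinSq x) ∧ √(halfSinSq x) ≤ 1) := by
    intro x hx
    refine ⟨Real.sqrt_pos.2 ?_, Real.sqrt_le_one.2 ?_⟩ <;> unfold halfSinSq <;> linarith [hx.1, hx.2]
  refine ⟨max (max C 0) (max (b 0) (b (Real.cos η))), le_max_of_le_left (le_max_right _ _), ?_⟩
  intro x hx
  obtain ⟨hs0, hs1⟩ := hC0 x hx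
  have hge : 1 ≤ √(halfSinSq x) ^ (-1 - ν) :=
    Real.one_le_rpow_of_pos_of_le_one_of_nonpos hs0 hs1 (by linarith)
  rcases le_or_gt x (Real.cos η) with h | h
  · have h1 := hb.convex.le_max_of_mem_Icc h00 hx1 ⟨hx.1, h⟩
    have h2 : 0 ≤ max (b 0) (b (Real.cos η)) := le_max_of_le_left (hb.nonneg 0 h00)
    calc b x ≤ max (b 0) (b (Real.cos η)) * 1 := by rwa [mul_one]
      _ ≤ _ := mul_le_mul (le_max_right _ _) hge zero_le_one (le_max_of_le_right h2)
  · set θ := Real.arccos x with hθ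
    have hcos : Real.cos θ = x := Real.cos_arccos (by linarith [hx.1]) hx.2.le
    have hθ0 : 0 < θ := Real.arccos_pos.2 hx.2
    have hθη : θ < η := by
      by_contra hcon
      push Not at hcon
      have := Real.cos_le_cos_of_nonneg_of_le_pi hη0.le (Real.arccos_le_pi x) hcon
      rw [hcos] at this
      linarith
    have hb1 := hC (show θ ∈ Set.Ioo 0 δ from
      ⟨hθ0, hθη.trans_le ((min_le_left _ _).trans (by linarith))⟩)
    simp only [Set.mem_ofPred_eq, hcos, Real.norm_eq_abs] at hb1
    rw [abs_of_nonneg (Real.rpow_nonneg hθ0.le _)] at hb1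
    have hle : √(halfSinSq x) ≤ θ := by
      have h1 : halfSinSq x = Real.sin (θ / 2) ^ 2 := by
        have := Real.cos_sq (θ / 2)
        rw [mul_div_cancel₀ θ two_ne_zero] at this
        have h3 := Real.sin_sq_add_cos_sq (θ / 2)
        rw [hcos] at this
        unfold halfSinSq; linarith
      rw [h1, Real.sqrt_sq (Real.sin_nonneg_of_nonneg_of_le_pi (by linarith) (by linarith))]
      have := Real.sin_le (show 0 ≤ θ / 2 by linarith)
      linarith
    calc b x ≤ C * θ ^ (-1 - ν) := (le_abs_self _).trans hb1
      _ ≤ max C 0 * √(halfSinSq x) ^ (-1 - ν) := by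
        refine mul_le_mul (le_max_left _ _)
          (Real.rpow_le_rpow_of_nonpos hs0 hle (by linarith)) (by positivity) (le_max_right _ _)
      _ ≤ _ := by
        exact mul_le_mul_of_nonneg_right (le_max_left _ _) (by positivity)

theorem lintegral_halfSinSq_rpow_lt_top (hd : 2 ≤ d) {e : EuclideanSpace ℝ (Fin d)} (he : ‖e‖ = 1)
    {a : ℝ} (ha : 0 ≤ a) (had : a < d - 1) :
    ∫⁻ σ : Metric.sphere (0 : EuclideanSpace ℝ (Fin d)) 1,
      (if 0 < √(halfSinSq (cosAngle e σ)) then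
        ENNReal.ofReal (√(halfSinSq (cosAngle e σ)) ^ (-a)) else 0) ∂(surface d) < ∞ := by
  refine lintegral_rpow_neg_lt_top (C := d * 2 * 4 ^ (d - 1)) (D := d - 1) ?_ ?_ (by positivity)
    ha had ?_
  · unfold halfSinSq cosAngle; fun_prop
  · intro σ
    refine Real.sqrt_le_one.2 ?_
    have := (abs_le.1 (abs_cosAngle_le_one e σ)).1
    unfold halfSinSq; linarith
  · intro ρ hρ
    refine (measure_mono ?_).trans ((surface_cap_le hd he hρ.le).trans (le_of_eq ?_))
    · intro σ hσ
      have := Real.sqrt_le_left hρ.le |>.1 hσ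
      rwa [cosAngle_of_norm_eq_one he] at this
    · congr 2
      rw [← Real.rpow_natCast, Nat.cast_sub (by omega)]; simp

/-- Count of exponents with `t = sin(θ/2)`: since `t ≤ sin θ` for `θ ≤ π/2`, the integrand is at
most `C t^(-(d-2+ν))`, while caps have measure of order `t^(d-1)`. Integrability is exactly where `ν
< 1` enters. -/
theorem integrable_angularPart (hd : 2 ≤ d) {ν : ℝ} (hν : ν ∈ Set.Ico (0 : ℝ) 1) {b : ℝ → ℝ}
    (hb : IsAngularProfile ν b) {e : EuclideanSpace ℝ (Fin d)} (he : ‖e‖ = 1) :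
    Integrable (fun σ : Metric.sphere (0 : EuclideanSpace ℝ (Fin d)) 1 =>
      √(halfSinSq (cosAngle e σ)) * angularPart d b (cosAngle e σ)) (surface d) := by
  obtain ⟨C, hC0, hC⟩ := hb.exists_le hν.1
  have hmeas : Measurable fun σ : Metric.sphere (0 : EuclideanSpace ℝ (Fin d)) 1 =>
      cosAngle e σ := by unfold cosAngle; fun_prop
  have hd' : (2 : ℝ) ≤ d := by exact_mod_cast hd
  refine ⟨((measurable_halfSinSq.comp hmeas).sqrt.mul
    ((measurable_angularPart hb).comp hmeas)).aestronglyMeasurable, ?_⟩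
  have hfin := lintegral_halfSinSq_rpow_lt_top hd he (a := d - 2 + ν) (by linarith [hν.1])
    (by linarith [hν.2])
  refine lt_of_le_of_lt ?_ (ENNReal.mul_lt_top (ENNReal.ofReal_lt_top (r := C)) hfin)
  rw [← lintegral_const_mul' _ _ ENNReal.ofReal_ne_top]
  refine lintegral_mono fun σ => ?_
  rw [Real.enorm_eq_ofReal (mul_nonneg (Real.sqrt_nonneg _) (angularPart_nonneg hb _))]
  set x := cosAngle e σ
  unfold angularPart
  split_ifs with hx h2 h2
  · rw [← ENNReal.ofReal_mul hC0]
    refine ENNReal.ofReal_le_ofReal ?_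
    set t := √(halfSinSq x) with ht
    have ht2 : t ^ 2 = (1 - x) / 2 := Real.sq_sqrt (by unfold halfSinSq; linarith [hx.2])
    have ht1 : t ≤ √(1 - x ^ 2) := by
      refine Real.le_sqrt_of_sq_le ?_
      rw [ht2]; nlinarith [hx.1, hx.2]
    have h3 : √(1 - x ^ 2) ^ (2 - (d : ℤ)) ≤ t ^ (2 - (d : ℝ)) := by
      rw [← Real.rpow_intCast]
      push_cast
      exact Real.rpow_le_rpow_of_nonpos h2 ht1 (by linarith)
    calc t * (√(1 - x ^ 2) ^ (2 - (d : ℤ)) * b x)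
        ≤ t * (t ^ (2 - (d : ℝ)) * (C * t ^ (-1 - ν))) := by
          have := hC x hx
          have := hb.nonneg x hx
          gcongr
      _ = C * (t ^ (1 : ℝ) * t ^ (2 - (d : ℝ)) * t ^ (-1 - ν)) := by rw [Real.rpow_one]; ring
      _ = C * t ^ (-((d : ℝ) - 2 + ν)) := by
          rw [← Real.rpow_add h2, ← Real.rpow_add h2]; ring_nf
  · exact absurd (Real.sqrt_pos.2 (by unfold halfSinSq; linarith [hx.2])) h2
  · simp
  · simp

theorem isAngularKernel_angularPart (hd : 2 ≤ d) {ν : ℝ} (hν : ν ∈ Set.Ico (0 : ℝ) 1) {b : ℝ → ℝ}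
    (hb : IsAngularProfile ν b) : IsAngularKernel d (angularPart d b) where
  measurable := measurable_angularPart hb
  nonneg := angularPart_nonneg hb
  support x hx := by
    unfold angularPart
    exact if_neg hx
  integrable _ he := integrable_angularPart hd hν hb he

theorem IsAngularKernel.of_le {k k' : ℝ → ℝ} (hk : IsAngularKernel d k) (hm : Measurable k')
    (h0 : ∀ x, 0 ≤ k' x) (hle : ∀ x, k' x ≤ k x) : IsAngularKernel d k' where
  measurable := hm
  nonneg := h0
  support x hx := le_antisymm ((hle x).trans (hk.support x hx).le) (h0 x)
  integrable e he := by
    have hmeas : Measurable fun σ : Metric.sphere (0 : EuclideanSpace ℝ (Fin d)) 1 =>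
      cosAngle e σ := by unfold cosAngle; fun_prop
    refine (hk.integrable e he).mono' ((measurable_halfSinSq.comp hmeas).sqrt.mul
      (hm.comp hmeas)).aestronglyMeasurable (ae_of_all _ fun σ => ?_)
    rw [Real.norm_of_nonneg (mul_nonneg (Real.sqrt_nonneg _) (h0 _))]
    exact mul_le_mul_of_nonneg_left (hle _) (Real.sqrt_nonneg _)

theorem isAngularKernel_truncatedAngularPart (hd : 2 ≤ d) {ν : ℝ} (hν : ν ∈ Set.Ico (0 : ℝ) 1)
    {b : ℝ → ℝ} (hb : IsAngularProfile ν b) (θ₀ : ℝ) :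
    IsAngularKernel d (truncatedAngularPart d b θ₀) := by
  refine (isAngularKernel_angularPart hd hν hb).of_le ?_ (fun x => ?_) (fun x => ?_)
  · unfold truncatedAngularPart
    exact Measurable.ite (measurableSet_lt measurable_const Real.continuous_arccos.measurable)
      (measurable_angularPart hb) measurable_const
  all_goals
    have := angularPart_nonneg (d := d) hb x
    unfold truncatedAngularPart
    split_ifs <;> simp [this]

/-- The profile is unconstrained at `cos θ = ±1`, so the poles have to be discarded; they are caps
of radius zero, null because `d ≥ 2`. -/
theorem ae_cosAngle_ne_one (hd : 2 ≤ d) (z : EuclideanSpace ℝ (Fin d)) :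
    ∀ᵐ σ : Metric.sphere (0 : EuclideanSpace ℝ (Fin d)) 1 ∂(surface d), cosAngle z σ ≠ 1 := by
  rcases eq_or_ne z 0 with rfl | hz
  · exact ae_of_all _ fun σ => by simp [cosAngle]
  rw [ae_iff]
  refine measure_mono_null (t := cap (‖z‖⁻¹ • z) 0) (fun σ hσ => ?_) (le_antisymm ?_ zero_le)
  · simp only [ne_eq, not_not, Set.mem_ofPred_eq, cosAngle_normalize] at hσ
    simp [cap, hσ]
  · refine (surface_cap_le hd (norm_normalize hz) le_rfl).trans (le_of_eq ?_)
    rw [zero_pow (by omega)]; simp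

theorem ae_cosAngle_ne_neg_one (hd : 2 ≤ d) (z : EuclideanSpace ℝ (Fin d)) :
    ∀ᵐ σ : Metric.sphere (0 : EuclideanSpace ℝ (Fin d)) 1 ∂(surface d), cosAngle z σ ≠ -1 := by
  filter_upwards [ae_cosAngle_ne_one hd (-z)] with σ hσ h
  exact hσ (by rw [cosAngle_neg, h, neg_neg])

theorem noncutoffKernel_ae_eq (hd : 2 ≤ d) (γ : ℝ) {ν : ℝ} {b : ℝ → ℝ} (hb : IsAngularProfile ν b)
    (z : EuclideanSpace ℝ (Fin d)) :
    ∀ᵐ σ : Metric.sphere (0 : EuclideanSpace ℝ (Fin d)) 1 ∂(surface d),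
      noncutoffKernel γ b z σ = ‖z‖ ^ γ * angularPart d b (cosAngle z σ) := by
  filter_upwards [ae_cosAngle_ne_one hd z, ae_cosAngle_ne_neg_one hd z] with σ h1 h2
  have habs := abs_le.1 (abs_cosAngle_le_one z σ)
  have hsin : Real.sin (deflection z σ) = √(1 - cosAngle z σ ^ 2) := by
    rw [← cos_deflection]
    exact Real.sin_eq_sqrt_one_sub_cos_sq (InnerProductGeometry.angle_nonneg _ _)
      (InnerProductGeometry.angle_le_pi _ _)
  rw [noncutoffKernel, hsin, cos_deflection, angularPart]
  split_ifs with hx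
  · ring
  · rw [hb.support _ ⟨lt_of_le_of_ne habs.1 (Ne.symm h2), ?_⟩]
    · simp
    · by_contra hcon
      exact hx ⟨not_lt.1 hcon, lt_of_le_of_ne habs.2 h1⟩

/-- Every Kac kernel is almost everywhere of the form `|z|^γ k(cos θ)` with `k` dominated by the
angular part of the noncutoff kernel. -/
theorem IsKacKernel.exists_angularKernel (hd : 2 ≤ d) {γ ν : ℝ} (hν : ν ∈ Set.Ico (0 : ℝ) 1)
    {b : ℝ → ℝ} (hb : IsAngularProfile ν b)
    {B : EuclideanSpace ℝ (Fin d) → EuclideanSpace ℝ (Fin d) → ℝ} (hB : IsKacKernel γ b B) :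
    ∃ k : ℝ → ℝ, IsAngularKernel d k ∧ (∀ x, k x ≤ angularPart d b x) ∧
      ∀ z, ∀ᵐ σ : Metric.sphere (0 : EuclideanSpace ℝ (Fin d)) 1 ∂(surface d),
        B z σ = ‖z‖ ^ γ * k (cosAngle z σ) := by
  rcases hB with rfl | ⟨K, hK, θ₀, hθ₀, rfl⟩
  · exact ⟨_, isAngularKernel_angularPart hd hν hb, fun x => le_rfl,
      noncutoffKernel_ae_eq hd γ hb⟩
  · refine ⟨_, isAngularKernel_truncatedAngularPart hd hν hb θ₀, fun x => ?_, fun z => ?_⟩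
    · have := angularPart_nonneg (d := d) hb x
      unfold truncatedAngularPart
      split_ifs <;> simp [this]
    · filter_upwards [noncutoffKernel_ae_eq hd γ hb z] with σ hσ
      have harc : Real.arccos (cosAngle z σ) = deflection z σ := by
        rw [← cos_deflection]
        exact Real.arccos_cos (InnerProductGeometry.angle_nonneg _ _)
          (InnerProductGeometry.angle_le_pi _ _)
      rw [truncatedKernel, truncatedAngularPart, harc]
      split_ifs
      · exact hσ
      · simp

/-- The momentum-transfer cross section `∫ sin²(θ/2) k dσ` in the direction `e`. -/
def crossSection (k : ℝ → ℝ) (e : EuclideanSpace ℝ (Fin d)) : ℝ :=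
  ∫ σ : Metric.sphere (0 : EuclideanSpace ℝ (Fin d)) 1,
    halfSinSq (cosAngle e σ) * k (cosAngle e σ) ∂(surface d)

/-- Integrals of functions of `cos θ` do not depend on the direction of the axis. -/
theorem integral_cosAngle_eq (g : ℝ → ℝ) {e z : EuclideanSpace ℝ (Fin d)} (he : ‖e‖ = 1)
    (hz : z ≠ 0) :
    ∫ σ : Metric.sphere (0 : EuclideanSpace ℝ (Fin d)) 1, g (cosAngle z σ) ∂(surface d)
      = ∫ σ : Metric.sphere (0 : EuclideanSpace ℝ (Fin d)) 1, g (cosAngle e σ) ∂(surface d) := by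
  obtain ⟨L, hL⟩ := exists_isometry_apply_eq (he.trans (norm_normalize hz).symm)
  have h : ∀ σ, cosAngle (L e) σ = cosAngle z σ := fun σ => by
    rw [hL, cosAngle_of_norm_eq_one (norm_normalize hz), cosAngle_normalize]
  rw [← integral_sphereHomeomorph L (fun σ => g (cosAngle z σ))]
  simp only [← h, coe_sphereHomeomorph]
  simp [cosAngle]

theorem crossSection_eq (k : ℝ → ℝ) {e z : EuclideanSpace ℝ (Fin d)} (he : ‖e‖ = 1)
    (hz : z ≠ 0) : crossSection k z = crossSection k e :=
  integral_cosAngle_eq (fun x => halfSinSq x * k x) he hz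

theorem IsAngularKernel.integrable_sqrt {k : ℝ → ℝ} (hk : IsAngularKernel d k)
    {z : EuclideanSpace ℝ (Fin d)} (hz : z ≠ 0) :
    Integrable (fun σ : Metric.sphere (0 : EuclideanSpace ℝ (Fin d)) 1 =>
      √(halfSinSq (cosAngle z σ)) * k (cosAngle z σ)) (surface d) := by
  have h : ∀ σ, cosAngle (‖z‖⁻¹ • z) σ = cosAngle z σ := fun σ => by
    rw [cosAngle_of_norm_eq_one (norm_normalize hz), cosAngle_normalize]
  simpa only [h] using hk.integrable _ (norm_normalize hz)

theorem halfSinSq_mem (z : EuclideanSpace ℝ (Fin d))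
    (σ : Metric.sphere (0 : EuclideanSpace ℝ (Fin d)) 1) :
    0 ≤ halfSinSq (cosAngle z σ) ∧ halfSinSq (cosAngle z σ) ≤ 1 := by
  have := abs_le.1 (abs_cosAngle_le_one z σ)
  unfold halfSinSq
  constructor <;> linarith

theorem measurable_cosAngle_left (z : EuclideanSpace ℝ (Fin d)) :
    Measurable fun σ : Metric.sphere (0 : EuclideanSpace ℝ (Fin d)) 1 => cosAngle z σ := by
  unfold cosAngle; fun_prop

theorem IsAngularKernel.integrable_halfSinSq {k : ℝ → ℝ} (hk : IsAngularKernel d k)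
    {z : EuclideanSpace ℝ (Fin d)} (hz : z ≠ 0) :
    Integrable (fun σ : Metric.sphere (0 : EuclideanSpace ℝ (Fin d)) 1 =>
      halfSinSq (cosAngle z σ) * k (cosAngle z σ)) (surface d) := by
  refine (hk.integrable_sqrt hz).mono' ((measurable_halfSinSq.comp (measurable_cosAngle_left z)).mul
      (hk.measurable.comp (measurable_cosAngle_left z))).aestronglyMeasurable
      (ae_of_all _ fun σ => ?_)
  have h := halfSinSq_mem z σ
  rw [Real.norm_of_nonneg (mul_nonneg h.1 (hk.nonneg _))]
  refine mul_le_mul_of_nonneg_right (Real.le_sqrt_of_sq_le ?_) (hk.nonneg _)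
  nlinarith [h.1, h.2]

theorem IsAngularKernel.crossSection_nonneg {k : ℝ → ℝ} (hk : IsAngularKernel d k)
    (z : EuclideanSpace ℝ (Fin d)) : 0 ≤ crossSection k z :=
  integral_nonneg fun σ => mul_nonneg (halfSinSq_mem z σ).1 (hk.nonneg _)

/-- Lets the noncutoff cross section serve for every cutoff, making the constants independent of
`K`. -/
theorem crossSection_mono {k k' : ℝ → ℝ} (hk : IsAngularKernel d k) (hk' : IsAngularKernel d k')
    (hle : ∀ x, k x ≤ k' x) {z : EuclideanSpace ℝ (Fin d)} (hz : z ≠ 0) :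
    crossSection k z ≤ crossSection k' z :=
  integral_mono (hk.integrable_halfSinSq hz) (hk'.integrable_halfSinSq hz) fun σ =>
    mul_le_mul_of_nonneg_left (hle _) (halfSinSq_mem z σ).1

/-! ## Geometry of collisions -/

/-- The velocity space. -/
abbrev Vel (d : ℕ) : Type := EuclideanSpace ℝ (Fin d)

/-- The sphere of collision directions. -/
abbrev Dir (d : ℕ) : Type := Metric.sphere (0 : EuclideanSpace ℝ (Fin d)) 1

/-- Change of `|v|^p + |w|^p` in a collision. -/
def momentJump (p : ℝ) (v w σ : Vel d) : ℝ :=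
  ‖post v w σ‖ ^ p + ‖postStar v w σ‖ ^ p - ‖v‖ ^ p - ‖w‖ ^ p

theorem inner_eq_norm_mul_cosAngle (z σ : Vel d) : inner ℝ z σ = ‖z‖ * cosAngle z σ := by
  rcases eq_or_ne z 0 with rfl | hz
  · simp
  · rw [cosAngle, mul_div_cancel₀ _ (norm_ne_zero_iff.2 hz)]

theorem post_self (v σ : Vel d) : post v v σ = v := by
  simp [post, ← two_smul ℝ v, smul_smul]

theorem postStar_self (v σ : Vel d) : postStar v v σ = v := by
  simp [postStar, ← two_smul ℝ v, smul_smul]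

theorem momentJump_self (p : ℝ) (v σ : Vel d) : momentJump p v v σ = 0 := by
  rw [momentJump, post_self, postStar_self]; ring

/-- The displacement is half the difference of two vectors of length `‖v - w‖` at angle `θ`, a chord
of length `2 ‖v - w‖ sin(θ/2)`. -/
theorem norm_post_sub_sq (v w : Vel d) (σ : Dir d) :
    ‖post v w σ - v‖ ^ 2 = ‖v - w‖ ^ 2 * halfSinSq (cosAngle (v - w) σ) := by
  have h : post v w σ - v = (‖v - w‖ / 2) • (σ : Vel d) - (2 : ℝ)⁻¹ • (v - w) := by
    unfold post; module
  rw [h, norm_sub_sq_real, norm_smul, norm_smul, real_inner_smul_left, real_inner_smul_right,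
    real_inner_comm, inner_eq_norm_mul_cosAngle, norm_sphere, halfSinSq]
  simp only [Real.norm_eq_abs, abs_div, abs_norm, Nat.abs_ofNat, abs_inv]
  ring

theorem norm_postStar_sub_sq (v w : Vel d) (σ : Dir d) :
    ‖postStar v w σ - w‖ ^ 2 = ‖v - w‖ ^ 2 * halfSinSq (cosAngle (v - w) σ) := by
  have h : postStar v w σ - w = -(post v w σ - v) := by
    unfold post postStar; module
  rw [h, norm_neg, norm_post_sub_sq]

theorem norm_post_sub (v w : Vel d) (σ : Dir d) :
    ‖post v w σ - v‖ = ‖v - w‖ * √(halfSinSq (cosAngle (v - w) σ)) := by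
  rw [← Real.sqrt_sq (norm_nonneg (post v w σ - v)), norm_post_sub_sq,
    Real.sqrt_mul (sq_nonneg _), Real.sqrt_sq (norm_nonneg _)]

theorem norm_postStar_sub (v w : Vel d) (σ : Dir d) :
    ‖postStar v w σ - w‖ = ‖v - w‖ * √(halfSinSq (cosAngle (v - w) σ)) := by
  rw [← Real.sqrt_sq (norm_nonneg (postStar v w σ - w)), norm_postStar_sub_sq,
    Real.sqrt_mul (sq_nonneg _), Real.sqrt_sq (norm_nonneg _)]

theorem norm_post_le (v w : Vel d) (σ : Dir d) : ‖post v w σ‖ ≤ ‖v‖ + ‖w‖ := by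
  have h1 := norm_add_le ((2 : ℝ)⁻¹ • (v + w)) ((‖v - w‖ / 2) • (σ : Vel d))
  rw [norm_smul, norm_smul, norm_sphere] at h1
  simp only [Real.norm_eq_abs, abs_div, abs_norm, Nat.abs_ofNat, abs_inv] at h1
  have := norm_add_le v w
  have := norm_sub_le v w
  unfold post; linarith

theorem norm_postStar_le (v w : Vel d) (σ : Dir d) : ‖postStar v w σ‖ ≤ ‖v‖ + ‖w‖ := by
  have h1 := norm_sub_le ((2 : ℝ)⁻¹ • (v + w)) ((‖v - w‖ / 2) • (σ : Vel d))
  rw [norm_smul, norm_smul, norm_sphere] at h1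
  simp only [Real.norm_eq_abs, abs_div, abs_norm, Nat.abs_ofNat, abs_inv] at h1
  have := norm_add_le v w
  have := norm_sub_le v w
  unfold postStar; linarith

theorem rpow_sub_one_mul_self {R p : ℝ} (hR : 0 ≤ R) (hp : p ≠ 0) : R ^ (p - 1) * R = R ^ p := by
  rcases hR.eq_or_lt with rfl | hR
  · simp [Real.zero_rpow hp]
  · rw [← Real.rpow_add_one hR.ne', sub_add_cancel]

/-- Both velocities move by `‖v - w‖ sin(θ/2)`. The single factor `sin(θ/2)` makes the jump
integrable against the noncutoff kernel. This is too crude for the sign of the drift, but its square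
is the bound needed for the bracket. -/
theorem abs_momentJump_le {p : ℝ} (hp : 1 ≤ p) (v w : Vel d) (σ : Dir d) :
    |momentJump p v w σ|
      ≤ 2 * p * (‖v‖ + ‖w‖) ^ p * √(halfSinSq (cosAngle (v - w) σ)) := by
  set s := √(halfSinSq (cosAngle (v - w) σ)) with hs
  set R := ‖v‖ + ‖w‖ with hR
  have hR0 : 0 ≤ R := by positivity
  have hz : ‖v - w‖ ≤ R := norm_sub_le v w
  have hs0 : 0 ≤ s := Real.sqrt_nonneg _
  have hR1 : 0 ≤ p * R ^ (p - 1) := by positivity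
  have h1 : |‖post v w σ‖ ^ p - ‖v‖ ^ p| ≤ p * R ^ (p - 1) * (R * s) := by
    refine (abs_rpow_sub_rpow_le hp (norm_nonneg _) (norm_nonneg _) (norm_post_le v w σ)
      (by linarith [norm_nonneg w] : ‖v‖ ≤ R)).trans (mul_le_mul_of_nonneg_left ?_ hR1)
    refine (abs_norm_sub_norm_le _ _).trans ?_
    rw [norm_post_sub]
    gcongr
  have h2 : |‖postStar v w σ‖ ^ p - ‖w‖ ^ p| ≤ p * R ^ (p - 1) * (R * s) := by
    refine (abs_rpow_sub_rpow_le hp (norm_nonneg _) (norm_nonneg _) (norm_postStar_le v w σ)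
      (by linarith [norm_nonneg v] : ‖w‖ ≤ R)).trans (mul_le_mul_of_nonneg_left ?_ hR1)
    refine (abs_norm_sub_norm_le _ _).trans ?_
    rw [norm_postStar_sub]
    gcongr
  have e : momentJump p v w σ = (‖post v w σ‖ ^ p - ‖v‖ ^ p) + (‖postStar v w σ‖ ^ p - ‖w‖ ^ p) := by
    unfold momentJump; ring
  have h3 : p * R ^ (p - 1) * (R * s) = p * R ^ p * s := by
    rw [← rpow_sub_one_mul_self hR0 (by linarith : p ≠ 0)]; ring
  rw [e]
  refine (abs_add_le _ _).trans ?_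
  rw [h3] at h1 h2
  linarith

/-- The fluctuating part of the post-collisional energy. -/
def energyShift (v w σ : Vel d) : ℝ :=
  inner ℝ v (‖v - w‖ • σ - cosAngle (v - w) σ • (v - w))

theorem norm_post_sq (v w : Vel d) (σ : Dir d) :
    ‖post v w σ‖ ^ 2 = (1 - halfSinSq (cosAngle (v - w) σ)) * ‖v‖ ^ 2
      + halfSinSq (cosAngle (v - w) σ) * ‖w‖ ^ 2 + energyShift v w σ := by
  have hz := inner_eq_norm_mul_cosAngle (v - w) σ
  rw [inner_sub_left] at hz
  have hn := norm_sub_sq_real v w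
  unfold post energyShift halfSinSq
  rw [norm_add_sq_real, norm_smul, norm_smul, norm_sphere, real_inner_smul_left,
    real_inner_smul_right, inner_add_left, inner_sub_right, real_inner_smul_right,
    real_inner_smul_right, inner_sub_right, real_inner_self_eq_norm_sq]
  simp only [Real.norm_eq_abs, abs_div, abs_norm, Nat.abs_ofNat, abs_inv]
  rw [mul_pow, norm_add_sq_real]
  set x := cosAngle (v - w) σ
  have hw : inner ℝ w (σ : Vel d) = inner ℝ v (σ : Vel d) - ‖v - w‖ * x := by linarith
  rw [hw]
  have h4 : (‖v - w‖ / 2 * 1) ^ 2 = ‖v - w‖ ^ 2 / 4 := by ring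
  have h5 : (2:ℝ)⁻¹ * (‖v - w‖ / 2 * (inner ℝ v (σ : Vel d) + (inner ℝ v (σ : Vel d) - ‖v - w‖ * x)))
    = ‖v - w‖ * inner ℝ v (σ : Vel d) / 2 - ‖v - w‖ ^ 2 * x / 4 := by ring
  rw [h4, h5, hn]
  ring

theorem norm_post_sq_add_norm_postStar_sq (v w : Vel d) (σ : Dir d) :
    ‖post v w σ‖ ^ 2 + ‖postStar v w σ‖ ^ 2 = ‖v‖ ^ 2 + ‖w‖ ^ 2 := by
  unfold post postStar
  have h := parallelogram_law_with_norm ℝ ((2 : ℝ)⁻¹ • (v + w)) ((‖v - w‖ / 2) • (σ : Vel d))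
  have h2 := parallelogram_law_with_norm ℝ v w
  rw [norm_smul, norm_smul, norm_sphere] at h
  simp only [Real.norm_eq_abs, abs_div, abs_norm, Nat.abs_ofNat, abs_inv] at h
  nlinarith

theorem norm_postStar_sq (v w : Vel d) (σ : Dir d) :
    ‖postStar v w σ‖ ^ 2 = halfSinSq (cosAngle (v - w) σ) * ‖v‖ ^ 2
      + (1 - halfSinSq (cosAngle (v - w) σ)) * ‖w‖ ^ 2 - energyShift v w σ := by
  have h1 := norm_post_sq v w σ
  have h2 := norm_post_sq_add_norm_postStar_sq v w σ
  linarith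

/-- The vector `y` is orthogonal to `z = v - w` and has length `‖z‖ sin θ`, so only the component of
`v` orthogonal to `z` counts. Its length times `‖z‖` is the area of the parallelogram on `v` and
`z`, which is that on `v` and `w`, hence at most `‖v‖ ‖w‖`. Finally `sin² θ = 4 s (1 - s)` with `s =
sin²(θ/2)`. -/
theorem energyShift_sq_le (v w : Vel d) (σ : Dir d) :
    energyShift v w σ ^ 2 ≤ 4 * ‖v‖ ^ 2 * ‖w‖ ^ 2 * halfSinSq (cosAngle (v - w) σ)
      * (1 - halfSinSq (cosAngle (v - w) σ)) := by
  set z := v - w with hz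
  set x := cosAngle z σ with hx
  set y : Vel d := ‖z‖ • (σ : Vel d) - x • z with hy
  have he : energyShift v w σ = inner ℝ v y := rfl
  have hxle := abs_le.1 (abs_cosAngle_le_one z σ)
  have hR : 4 * ‖v‖ ^ 2 * ‖w‖ ^ 2 * halfSinSq x * (1 - halfSinSq x)
      = ‖v‖ ^ 2 * ‖w‖ ^ 2 * (1 - x ^ 2) := by unfold halfSinSq; ring
  rw [he, hR]
  rcases eq_or_ne z 0 with h0 | h0
  · have : y = 0 := by rw [hy, h0]; simp
    rw [this, inner_zero_right]
    have : 0 ≤ 1 - x ^ 2 := by nlinarith [hxle.1, hxle.2]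
    rw [zero_pow two_ne_zero]
    exact mul_nonneg (by positivity) this
  have hzpos : 0 < ‖z‖ := norm_pos_iff.2 h0
  have hzs : inner ℝ z (σ : Vel d) = ‖z‖ * x := inner_eq_norm_mul_cosAngle z σ
  have hzy : inner ℝ z y = 0 := by
    rw [hy, inner_sub_right, real_inner_smul_right, real_inner_smul_right, hzs,
      real_inner_self_eq_norm_sq]; ring
  have hyy : ‖y‖ ^ 2 = ‖z‖ ^ 2 * (1 - x ^ 2) := by
    rw [hy, norm_sub_sq_real, norm_smul, norm_smul, norm_sphere, real_inner_smul_left,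
      real_inner_smul_right, real_inner_comm, hzs]
    simp only [Real.norm_eq_abs, abs_norm, mul_pow, sq_abs]
    ring
  set u : Vel d := ‖z‖ ^ 2 • v - inner ℝ v z • z with hu
  have huy : inner ℝ u y = ‖z‖ ^ 2 * inner ℝ v y := by
    rw [hu, inner_sub_left, real_inner_smul_left, real_inner_smul_left, hzy]; ring
  have huu : ‖u‖ ^ 2 = ‖z‖ ^ 2 * (‖z‖ ^ 2 * ‖v‖ ^ 2 - inner ℝ v z ^ 2) := by
    rw [hu, norm_sub_sq_real, norm_smul, norm_smul, real_inner_smul_left,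
      real_inner_smul_right]
    simp only [Real.norm_eq_abs, mul_pow, sq_abs]
    ring
  have hgram : ‖z‖ ^ 2 * ‖v‖ ^ 2 - inner ℝ v z ^ 2 ≤ ‖v‖ ^ 2 * ‖w‖ ^ 2 := by
    rw [hz, norm_sub_sq_real, inner_sub_right, real_inner_self_eq_norm_sq]
    nlinarith [sq_nonneg (inner ℝ v w)]
  have hcs : (inner ℝ u y) ^ 2 ≤ ‖u‖ ^ 2 * ‖y‖ ^ 2 := by
    rw [← mul_pow, ← sq_abs]
    exact pow_le_pow_left₀ (abs_nonneg _) (abs_real_inner_le_norm u y) 2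
  rw [huy, huu, hyy] at hcs
  have h1 : 0 ≤ 1 - x ^ 2 := by nlinarith [hxle.1, hxle.2]
  have h4 : 0 < (‖z‖ ^ 2) ^ 2 := by positivity
  refine le_of_mul_le_mul_left ?_ h4
  calc (‖z‖ ^ 2) ^ 2 * inner ℝ v y ^ 2 = (‖z‖ ^ 2 * inner ℝ v y) ^ 2 := by ring
    _ ≤ _ := hcs
    _ = (‖z‖ ^ 2) ^ 2 * ((‖z‖ ^ 2 * ‖v‖ ^ 2 - inner ℝ v z ^ 2) * (1 - x ^ 2)) := by ring
    _ ≤ _ := by gcongr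

/-- Reflection of the sphere in the axis `z`. -/
def axisReflection (z : Vel d) : Vel d ≃ₗᵢ[ℝ] Vel d := (Submodule.span ℝ {z}).reflection

theorem axisReflection_apply (z σ : Vel d) :
    axisReflection z σ = (2 * (cosAngle z σ / ‖z‖)) • z - σ := by
  rw [axisReflection, Submodule.reflection_singleton_apply, cosAngle]
  rw [← Nat.cast_smul_eq_nsmul ℝ, smul_smul]
  congr 2
  simp only [RCLike.ofReal_real_eq_id, id]
  rw [div_div, Nat.cast_ofNat]; ring

theorem cosAngle_axisReflection (z σ : Vel d) :
    cosAngle z (axisReflection z σ) = cosAngle z σ := by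
  rcases eq_or_ne z 0 with rfl | hz
  · simp [cosAngle]
  · have hz' := norm_ne_zero_iff.2 hz
    rw [cosAngle, axisReflection_apply, inner_sub_right, real_inner_smul_right,
      real_inner_self_eq_norm_sq, inner_eq_norm_mul_cosAngle]
    field_simp; ring

/-- Reflection in `v - w` fixes `θ` and reverses the component of `σ` orthogonal to the axis, on
which the shift depends linearly. Averaging over the two directions removes the first order term. -/
theorem energyShift_axisReflection (v w σ : Vel d) :
    energyShift v w (axisReflection (v - w) σ) = -energyShift v w σ := by
  unfold energyShift
  rw [cosAngle_axisReflection, ← inner_neg_right]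
  congr 1
  rcases eq_or_ne (v - w) 0 with h | h
  · simp [h]
  · have hz' := norm_ne_zero_iff.2 h
    rw [axisReflection_apply, smul_sub, smul_smul]
    rw [show ‖v - w‖ * (2 * (cosAngle (v - w) σ / ‖v - w‖)) = 2 * cosAngle (v - w) σ by
      field_simp]
    module

theorem norm_rpow_eq_sq_rpow (p : ℝ) (v : Vel d) : ‖v‖ ^ p = (‖v‖ ^ 2) ^ (p / 2) := by
  rw [← Real.rpow_natCast, ← Real.rpow_mul (norm_nonneg _)]
  congr 1; push_cast; ring

/-- The bracket of the Povzner inequality. -/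
def povznerBracket (p : ℝ) (v w : Vel d) : ℝ :=
  -povznerGain (p / 2) * (‖v‖ ^ p + ‖w‖ ^ p)
    + povznerLoss (p / 2) * povznerMixed (p / 2) (‖v‖ ^ 2) (‖w‖ ^ 2)

/-- For equal energies, `s = 1 / 2` and `δ = 0`, the left side of the pointwise inequality vanishes.
Needed for pairs `v = w`, whose collisions are trivial. -/
theorem povznerBracket_self_nonneg {p : ℝ} (hp : 2 < p) (v : Vel d) :
    0 ≤ povznerBracket p v v := by
  have h := povzner_pointwise (r := p / 2) (a := ‖v‖ ^ 2) (b := ‖v‖ ^ 2) (s := 1 / 2) (δ := 0)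
    (by linarith) (sq_nonneg _) (sq_nonneg _) (by norm_num) le_rfl
    (by norm_num; positivity)
  rw [← norm_rpow_eq_sq_rpow] at h
  have e : (1 - 1 / 2 : ℝ) * ‖v‖ ^ 2 + 1 / 2 * ‖v‖ ^ 2 = ‖v‖ ^ 2 := by ring
  have e' : (1 / 2 : ℝ) * ‖v‖ ^ 2 + (1 - 1 / 2) * ‖v‖ ^ 2 = ‖v‖ ^ 2 := by ring
  rw [e, e', add_zero, sub_zero, ← norm_rpow_eq_sq_rpow] at h
  unfold povznerBracket
  linarith

/-- A direction and its reflection realise the two signs of `δ` in `povzner_pointwise`; `cos θ ≥ 0`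
is the condition `s ≤ 1 / 2`. -/
theorem momentJump_add_reflection_le {p : ℝ} (hp : 2 < p) (v w : Vel d) (σ : Dir d)
    (hσ : 0 ≤ cosAngle (v - w) σ) :
    momentJump p v w σ + momentJump p v w (axisReflection (v - w) σ)
      ≤ 2 * halfSinSq (cosAngle (v - w) σ) * povznerBracket p v w := by
  have hs := halfSinSq_mem (v - w) σ
  have h := povzner_pointwise (r := p / 2) (by linarith) (sq_nonneg ‖v‖) (sq_nonneg ‖w‖)
    hs.1 (by unfold halfSinSq; linarith) (energyShift_sq_le v w σ)
  have e1 := norm_post_sq v w σ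
  have e2 := norm_postStar_sq v w σ
  have e3 := norm_post_sq v w (sphereHomeomorph (axisReflection (v - w)) σ)
  have e4 := norm_postStar_sq v w (sphereHomeomorph (axisReflection (v - w)) σ)
  rw [coe_sphereHomeomorph, cosAngle_axisReflection, energyShift_axisReflection] at e3 e4
  rw [← sub_eq_add_neg] at e3
  rw [sub_neg_eq_add] at e4
  rw [← e1, ← e2, ← e3, ← e4] at h
  simp only [← norm_rpow_eq_sq_rpow] at h
  unfold momentJump povznerBracket
  linarith

/-! ## Averages over the collision direction -/

/-- `∫ φ(v,w,σ) |v-w|^γ k(cos θ) dσ`. -/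
def collisionMean (γ : ℝ) (k : ℝ → ℝ) (φ : Vel d → Vel d → Vel d → ℝ) (v w : Vel d) : ℝ :=
  ∫ σ : Dir d, φ v w σ * (‖v - w‖ ^ γ * k (cosAngle (v - w) σ)) ∂(surface d)

theorem measurable_post : Measurable fun x : (Vel d × Vel d) × Dir d =>
    post x.1.1 x.1.2 (x.2 : Vel d) := by
  unfold post; fun_prop

theorem measurable_postStar : Measurable fun x : (Vel d × Vel d) × Dir d =>
    postStar x.1.1 x.1.2 (x.2 : Vel d) := by
  unfold postStar; fun_prop

theorem measurable_momentJump (p : ℝ) : Measurable fun x : (Vel d × Vel d) × Dir d =>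
    momentJump p x.1.1 x.1.2 (x.2 : Vel d) := by
  have h1 := (measurable_post (d := d)).norm.pow_const p
  have h2 := (measurable_postStar (d := d)).norm.pow_const p
  have h3 : Measurable fun x : (Vel d × Vel d) × Dir d => ‖x.1.1‖ ^ p := by fun_prop
  have h4 : Measurable fun x : (Vel d × Vel d) × Dir d => ‖x.1.2‖ ^ p := by fun_prop
  exact ((h1.add h2).sub h3).sub h4

theorem measurable_collisionMean (γ : ℝ) {k : ℝ → ℝ} (hk : Measurable k)
    {φ : Vel d → Vel d → Vel d → ℝ}
    (hφ : Measurable fun x : (Vel d × Vel d) × Dir d => φ x.1.1 x.1.2 (x.2 : Vel d)) :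
    Measurable fun x : Vel d × Vel d => collisionMean γ k φ x.1 x.2 := by
  have h : Measurable fun x : (Vel d × Vel d) × Dir d => φ x.1.1 x.1.2 (x.2 : Vel d) *
      (‖x.1.1 - x.1.2‖ ^ γ * k (cosAngle (x.1.1 - x.1.2) (x.2 : Vel d))) := by
    refine hφ.mul (Measurable.mul (by fun_prop) (hk.comp ?_))
    unfold cosAngle; fun_prop
  exact (h.stronglyMeasurable.integral_prod_right').measurable

theorem measurable_section {φ : Vel d → Vel d → Vel d → ℝ}
    (hφ : Measurable fun x : (Vel d × Vel d) × Dir d => φ x.1.1 x.1.2 (x.2 : Vel d))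
    (v w : Vel d) : Measurable fun σ : Dir d => φ v w (σ : Vel d) :=
  hφ.comp (g := fun x : (Vel d × Vel d) × Dir d => φ x.1.1 x.1.2 (x.2 : Vel d))
    (f := fun σ : Dir d => ((v, w), σ)) measurable_prodMk_left

theorem integrable_momentJump {k : ℝ → ℝ} (hk : IsAngularKernel d k) (γ : ℝ) {p : ℝ} (hp : 1 ≤ p)
    (v w : Vel d) :
    Integrable (fun σ : Dir d => momentJump p v w σ * (‖v - w‖ ^ γ * k (cosAngle (v - w) σ)))
      (surface d) := by
  rcases eq_or_ne v w with rfl | hvw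
  · simp [momentJump_self]
  refine ((hk.integrable_sqrt (sub_ne_zero.2 hvw)).const_mul
    (2 * p * (‖v‖ + ‖w‖) ^ p * ‖v - w‖ ^ γ)).mono'
    ((measurable_section (measurable_momentJump p) v w).mul (measurable_const.mul
      (hk.measurable.comp (measurable_cosAngle_left _)))).aestronglyMeasurable
    (ae_of_all _ fun σ => ?_)
  have hk0 : 0 ≤ ‖v - w‖ ^ γ * k (cosAngle (v - w) σ) := mul_nonneg (by positivity) (hk.nonneg _)
  rw [norm_mul, Real.norm_eq_abs, Real.norm_of_nonneg hk0]
  refine (mul_le_mul_of_nonneg_right (abs_momentJump_le hp v w σ) hk0).trans (le_of_eq ?_)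
  ring

theorem sq_momentJump_le {p : ℝ} (hp : 1 ≤ p) (v w : Vel d) (σ : Dir d) :
    momentJump p v w σ ^ 2
      ≤ 4 * p ^ 2 * (‖v‖ + ‖w‖) ^ (2 * p) * halfSinSq (cosAngle (v - w) σ) := by
  rw [← sq_abs]
  refine (pow_le_pow_left₀ (abs_nonneg _) (abs_momentJump_le hp v w σ) 2).trans (le_of_eq ?_)
  rw [mul_pow, Real.sq_sqrt (halfSinSq_mem _ σ).1, mul_pow, mul_pow, ← Real.rpow_natCast _ 2,
    ← Real.rpow_natCast (_ ^ p) 2, ← Real.rpow_mul (by positivity)]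
  norm_num
  left; left; ring_nf

theorem integrable_sq_momentJump {k : ℝ → ℝ} (hk : IsAngularKernel d k) (γ : ℝ) {p : ℝ}
    (hp : 1 ≤ p) (v w : Vel d) :
    Integrable (fun σ : Dir d =>
      momentJump p v w σ ^ 2 * (‖v - w‖ ^ γ * k (cosAngle (v - w) σ))) (surface d) := by
  rcases eq_or_ne v w with rfl | hvw
  · simp [momentJump_self]
  refine ((hk.integrable_halfSinSq (sub_ne_zero.2 hvw)).const_mul
    (4 * p ^ 2 * (‖v‖ + ‖w‖) ^ (2 * p) * ‖v - w‖ ^ γ)).mono'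
    (((measurable_section (measurable_momentJump p) v w).pow_const 2).mul (measurable_const.mul
      (hk.measurable.comp (measurable_cosAngle_left _)))).aestronglyMeasurable
    (ae_of_all _ fun σ => ?_)
  have hk0 : 0 ≤ ‖v - w‖ ^ γ * k (cosAngle (v - w) σ) := mul_nonneg (by positivity) (hk.nonneg _)
  rw [Real.norm_of_nonneg (mul_nonneg (sq_nonneg _) hk0)]
  refine (mul_le_mul_of_nonneg_right (sq_momentJump_le hp v w σ) hk0).trans (le_of_eq ?_)
  ring

/-- Povzner inequality. -/
theorem collisionMean_momentJump_le {k : ℝ → ℝ} (hk : IsAngularKernel d k) (γ : ℝ) {p : ℝ}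
    (hp : 2 < p) {e : Vel d} (he : ‖e‖ = 1) (v w : Vel d) :
    collisionMean γ k (momentJump p) v w
      ≤ crossSection k e * (‖v - w‖ ^ γ * povznerBracket p v w) := by
  rcases eq_or_ne v w with rfl | hvw
  · have := hk.crossSection_nonneg e
    have := povznerBracket_self_nonneg hp v
    simp only [collisionMean, momentJump_self, zero_mul, integral_zero]
    positivity
  have hz := sub_ne_zero.2 hvw
  have hint := integrable_momentJump hk γ (by linarith : 1 ≤ p) v w
  -- The surface measure and `cos θ` are invariant under the reflection, so twice the mean is the
  -- integral of the symmetrised jump.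
  have hint' := ((measurePreserving_sphereHomeomorph (axisReflection (v - w))).integrable_comp_emb
    (sphereHomeomorph _).measurableEmbedding).2 hint
  have hrefl := integral_sphereHomeomorph (axisReflection (v - w)) (fun σ : Dir d =>
    momentJump p v w σ * (‖v - w‖ ^ γ * k (cosAngle (v - w) σ)))
  have hmono := integral_mono (hint.add hint') ((hk.integrable_halfSinSq hz).const_mul
    (2 * (‖v - w‖ ^ γ * povznerBracket p v w))) (fun σ => ?_)
  · have hadd := integral_add hint hint'
    rw [integral_const_mul] at hmono
    have hmono := hadd.symm.trans_le hmono
    simp only [Function.comp_def] at hmono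
    rw [hrefl, ← crossSection, crossSection_eq k he hz] at hmono
    unfold collisionMean
    linarith
  · simp only [Pi.add_apply, Function.comp_apply, coe_sphereHomeomorph, cosAngle_axisReflection]
    by_cases hx : cosAngle (v - w) σ ∈ Set.Ico (0 : ℝ) 1
    · have h := momentJump_add_reflection_le hp v w σ hx.1
      have hk0 : 0 ≤ ‖v - w‖ ^ γ * k (cosAngle (v - w) σ) :=
        mul_nonneg (by positivity) (hk.nonneg _)
      have := mul_le_mul_of_nonneg_right h hk0
      linarith
    · simp [hk.support _ hx]

/-- The squared jump carries `sin²(θ/2)`, which integrates to the cross section. The speed factor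
raises the order from `2 p` to `2 p + γ`, the source of the condition on `q`. -/
theorem collisionMean_sq_momentJump_le {k : ℝ → ℝ} (hk : IsAngularKernel d k) {γ : ℝ} (hγ : 0 ≤ γ)
    {p : ℝ} (hp : 1 ≤ p) {e : Vel d} (he : ‖e‖ = 1) (v w : Vel d) :
    collisionMean γ k (fun v w σ => momentJump p v w σ ^ 2) v w
      ≤ crossSection k e * (4 * p ^ 2 * 2 ^ (2 * p + γ)) *
        (‖v‖ ^ (2 * p + γ) + ‖w‖ ^ (2 * p + γ)) := by
  have hκ := hk.crossSection_nonneg e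
  rcases eq_or_ne v w with rfl | hvw
  · simp only [collisionMean, momentJump_self]
    simp only [ne_eq, OfNat.ofNat_ne_zero, not_false_eq_true, zero_pow, zero_mul, integral_zero]
    positivity
  have hz := sub_ne_zero.2 hvw
  set R := ‖v‖ + ‖w‖ with hR
  have hR0 : 0 < R := by
    have := norm_sub_le v w
    have := norm_pos_iff.2 hz
    linarith
  have hRle : R ^ (2 * p + γ) ≤ 2 ^ (2 * p + γ) * (‖v‖ ^ (2 * p + γ) + ‖w‖ ^ (2 * p + γ)) := by
    wlog h : ‖w‖ ≤ ‖v‖ generalizing v w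
    · have := this w v (Ne.symm hvw) (by simpa using sub_ne_zero.2 (Ne.symm hvw)) (by linarith)
        (by linarith) (le_of_not_ge h)
      rw [hR]
      rwa [add_comm ‖w‖, add_comm (‖w‖ ^ _)] at this
    calc R ^ (2 * p + γ) ≤ (2 * ‖v‖) ^ (2 * p + γ) :=
          Real.rpow_le_rpow hR0.le (by linarith) (by linarith)
      _ = 2 ^ (2 * p + γ) * ‖v‖ ^ (2 * p + γ) := Real.mul_rpow (by norm_num) (norm_nonneg _)
      _ ≤ _ := by
        gcongr
        have : 0 ≤ ‖w‖ ^ (2 * p + γ) := by positivity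
        linarith
  have hmono := integral_mono (integrable_sq_momentJump hk γ hp v w)
    ((hk.integrable_halfSinSq hz).const_mul (4 * p ^ 2 * R ^ (2 * p) * R ^ γ)) (fun σ => ?_)
  · rw [integral_const_mul, ← crossSection, crossSection_eq k he hz] at hmono
    refine hmono.trans ?_
    rw [mul_assoc (4 * p ^ 2), ← Real.rpow_add hR0]
    calc 4 * p ^ 2 * R ^ (2 * p + γ) * crossSection k e
        ≤ 4 * p ^ 2 * (2 ^ (2 * p + γ) * (‖v‖ ^ (2 * p + γ) + ‖w‖ ^ (2 * p + γ)))
          * crossSection k e := by gcongr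
      _ = _ := by ring
  · have hs := (halfSinSq_mem (v - w) σ).1
    have hk1 := hk.nonneg (cosAngle (v - w) σ)
    have hzR : ‖v - w‖ ^ γ ≤ R ^ γ := Real.rpow_le_rpow (norm_nonneg _) (norm_sub_le v w) hγ
    calc momentJump p v w σ ^ 2 * (‖v - w‖ ^ γ * k (cosAngle (v - w) σ))
        ≤ (4 * p ^ 2 * R ^ (2 * p) * halfSinSq (cosAngle (v - w) σ)) *
          (R ^ γ * k (cosAngle (v - w) σ)) := by
          have := sq_momentJump_le hp v w σ
          gcongr
      _ = _ := by ring

theorem collisionMean_sq_momentJump_nonneg {k : ℝ → ℝ} (hk : IsAngularKernel d k) (γ p : ℝ)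
    (v w : Vel d) : 0 ≤ collisionMean γ k (fun v w σ => momentJump p v w σ ^ 2) v w :=
  integral_nonneg fun _ => mul_nonneg (sq_nonneg _) (mul_nonneg (by positivity) (hk.nonneg _))

variable {N : ℕ}

/-! ## Empirical measures -/

/-- Finitely many point masses integrate every function, so integrals against states carry no
measurability conditions. -/
theorem integrable_empirical (hN : N ≠ 0) (V : Fin N → Vel d) (f : Vel d → ℝ) :
    Integrable f (empirical N V) := by
  refine Integrable.smul_measure ?_ (ENNReal.inv_ne_top.2 (by exact_mod_cast hN))
  exact integrable_finsetSum_measure.2 fun i _ => integrable_dirac (by simp)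

theorem integral_empirical (V : Fin N → Vel d) (f : Vel d → ℝ) :
    ∫ v, f v ∂(empirical N V) = (N : ℝ)⁻¹ * ∑ i, f (V i) := by
  rw [empirical, integral_smul_measure, integral_finsetSum_measure
    fun i _ => integrable_dirac (by simp)]
  simp

theorem kacSphere_ne_zero {μ : Measure (Vel d)} (hμ : μ ∈ kacSphere d N) : N ≠ 0 := by
  rintro rfl
  obtain ⟨⟨hp, -⟩, V, rfl⟩ := hμ
  have := hp.measure_univ
  simp [empirical] at this

theorem kacSphere_isProbabilityMeasure {μ : Measure (Vel d)} (hμ : μ ∈ kacSphere d N) :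
    IsProbabilityMeasure μ := hμ.1.1

theorem kacSphere_integrable {μ : Measure (Vel d)} (hμ : μ ∈ kacSphere d N) (f : Vel d → ℝ) :
    Integrable f μ := by
  have hN := kacSphere_ne_zero hμ
  obtain ⟨-, V, rfl⟩ := hμ
  exact integrable_empirical hN V f

theorem ae_empirical_mem_range (V : Fin N → Vel d) : ∀ᵐ v ∂(empirical N V), v ∈ Set.range V := by
  refine Measure.ae_smul_measure ?_ _
  rw [ae_iff, Measure.finsetSum_apply]
  refine Finset.sum_eq_zero fun i _ => ?_
  rw [Measure.dirac_apply]
  simp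

/-- The energies of the particles sum to `N`, so none exceeds `N`. For fixed `N` this makes all
moments bounded and Lipschitz. -/
theorem kacSphere_ae_norm_le {μ : Measure (Vel d)} (hμ : μ ∈ kacSphere d N) :
    ∀ᵐ v ∂μ, ‖v‖ ≤ √N := by
  have hN := kacSphere_ne_zero hμ
  obtain ⟨⟨-, -, -, hE⟩, V, rfl⟩ := hμ
  rw [integral_empirical V (fun v => ‖v‖ ^ 2)] at hE
  have hN' : (0 : ℝ) < N := by positivity
  filter_upwards [ae_empirical_mem_range V] with v hv
  obtain ⟨i, rfl⟩ := hv
  refine Real.le_sqrt_of_sq_le ?_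
  have h1 : ∑ i, ‖V i‖ ^ 2 = N := by
    field_simp at hE
    exact hE
  rw [← h1]
  exact Finset.single_le_sum (f := fun i => ‖V i‖ ^ 2) (fun _ _ => sq_nonneg _) (Finset.mem_univ i)

theorem kacSphere_integral_mono {μ : Measure (Vel d)} (hμ : μ ∈ kacSphere d N) {f g : Vel d → ℝ}
    (h : ∀ v, ‖v‖ ≤ √N → f v ≤ g v) : ∫ v, f v ∂μ ≤ ∫ v, g v ∂μ :=
  integral_mono_ae (kacSphere_integrable hμ f) (kacSphere_integrable hμ g)
    ((kacSphere_ae_norm_le hμ).mono h)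

theorem absMoment_nonneg (p : ℝ) (μ : Measure (Vel d)) : 0 ≤ absMoment p μ :=
  integral_nonneg fun _ => by positivity

theorem absMoment_le {p : ℝ} (hp : 0 ≤ p) {μ : Measure (Vel d)} (hμ : μ ∈ kacSphere d N) :
    absMoment p μ ≤ √N ^ p := by
  have := kacSphere_isProbabilityMeasure hμ
  refine (kacSphere_integral_mono hμ (g := fun _ => √N ^ p) fun v hv => ?_).trans (by simp)
  exact Real.rpow_le_rpow (norm_nonneg _) hv hp

/-! ## Lipschitz functionals -/

/-- Under any coupling the difference of the integrals is at most `L` times the transport cost. A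
local Lipschitz bound suffices, as both marginals live in the ball of radius `√N`. -/
theorem isLipschitzOnKacSphere_integral {f : Vel d → ℝ} (hf : Measurable f) {L : ℝ≥0}
    (hL : ∀ v w : Vel d, ‖v‖ ≤ √N → ‖w‖ ≤ √N → |f v - f w| ≤ L * ‖v - w‖) :
    IsLipschitzOnKacSphere N (fun μ : Measure (Vel d) => ∫ v, f v ∂μ) := by
  -- A nonzero constant is required to divide by it and compare with the infimum over couplings.
  refine ⟨L + 1, fun μ hμ ν hν => ?_⟩
  have hL0 : ((L + 1 : ℝ≥0) : ℝ≥0∞) ≠ 0 := by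
    simp
  rw [mul_comm, ← ENNReal.div_le_iff hL0 ENNReal.coe_ne_top]
  refine le_iInf₂ fun π hπ => ?_
  obtain ⟨rfl, rfl⟩ := hπ
  rw [ENNReal.div_le_iff hL0 ENNReal.coe_ne_top, mul_comm]
  have i1 := (kacSphere_integrable hμ f).comp_measurable measurable_fst
  have i2 := (kacSphere_integrable hν f).comp_measurable measurable_snd
  have a1 := ae_of_ae_map measurable_fst.aemeasurable (kacSphere_ae_norm_le hμ)
  have a2 := ae_of_ae_map measurable_snd.aemeasurable (kacSphere_ae_norm_le hν)
  dsimp only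
  rw [integral_map measurable_fst.aemeasurable hf.aestronglyMeasurable,
    integral_map measurable_snd.aemeasurable hf.aestronglyMeasurable, edist_eq_enorm_sub,
    ← integral_sub (f := fun z : Vel d × Vel d => f z.1) (g := fun z : Vel d × Vel d => f z.2)
      i1 i2, ← lintegral_const_mul' _ _ ENNReal.coe_ne_top]
  refine (enorm_integral_le_lintegral_enorm _).trans (lintegral_mono_ae ?_)
  filter_upwards [a1, a2] with z h1 h2
  have h := hL z.1 z.2 h1 h2
  rw [edist_eq_enorm_sub, Real.enorm_eq_ofReal_abs, ← ofReal_norm,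
    ← ENNReal.ofReal_coe_nnreal, ← ENNReal.ofReal_mul (by positivity)]
  refine ENNReal.ofReal_le_ofReal (h.trans ?_)
  gcongr
  simp

theorem isLipschitzOnKacSphere_absMoment {p : ℝ} (hp : 1 ≤ p) :
    IsLipschitzOnKacSphere N (absMoment (d := d) p) := by
  refine isLipschitzOnKacSphere_integral (L := (p * √N ^ (p - 1)).toNNReal) (by fun_prop)
    fun v w hv hw => ?_
  rw [Real.coe_toNNReal _ (by positivity)]
  refine (abs_rpow_sub_rpow_le hp (norm_nonneg _) (norm_nonneg _) hv hw).trans ?_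
  gcongr
  exact abs_norm_sub_norm_le v w

theorem IsLipschitzOnKacSphere.sq {F : Measure (Vel d) → ℝ} (hF : IsLipschitzOnKacSphere N F)
    {K : ℝ≥0} (hK : ∀ μ ∈ kacSphere d N, |F μ| ≤ K) :
    IsLipschitzOnKacSphere N (fun μ => F μ ^ 2) := by
  obtain ⟨L, hL⟩ := hF
  refine ⟨2 * K * L, fun μ hμ ν hν => ?_⟩
  have h := hL μ hμ ν hν
  rw [edist_eq_enorm_sub, Real.enorm_eq_ofReal_abs] at h ⊢
  have e : |F μ ^ 2 - F ν ^ 2| ≤ 2 * K * |F μ - F ν| := by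
    rw [sq_sub_sq, abs_mul]
    gcongr
    have := abs_add_le (F μ) (F ν)
    linarith [hK μ hμ, hK ν hν]
  calc ENNReal.ofReal |F μ ^ 2 - F ν ^ 2| ≤ ENNReal.ofReal (2 * K * |F μ - F ν|) :=
        ENNReal.ofReal_le_ofReal e
    _ = ((2 * K : ℝ≥0) : ℝ≥0∞) * ENNReal.ofReal |F μ - F ν| := by
        rw [ENNReal.ofReal_mul (by positivity), ← ENNReal.ofReal_coe_nnreal]
        simp
    _ ≤ _ := by
        rw [ENNReal.coe_mul (2 * K) L, mul_assoc]
        gcongr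

theorem IsLipschitzOnKacSphere.tendsto {F : Measure (Vel d) → ℝ}
    (hF : IsLipschitzOnKacSphere N F) {ι : Type*} {l : Filter ι} {m : ι → Measure (Vel d)}
    {μ : Measure (Vel d)} (hm : ∀ i, m i ∈ kacSphere d N) (hμ : μ ∈ kacSphere d N)
    (h : Tendsto (fun i => w1 (m i) μ) l (𝓝 0)) : Tendsto (fun i => F (m i)) l (𝓝 (F μ)) := by
  obtain ⟨L, hL⟩ := hF
  rw [tendsto_iff_edist_tendsto_0]
  refine tendsto_of_tendsto_of_tendsto_of_le_of_le tendsto_const_nhds ?_ (fun _ => zero_le)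
    (fun i => hL _ (hm i) _ hμ)
  simpa using ENNReal.Tendsto.const_mul h (Or.inr (ENNReal.coe_ne_top (r := L)))

/-! ## The generator on moments -/

theorem dirac_add_dirac_le_empirical (V : Fin N → Vel d) {i j : Fin N} (hij : i ≠ j) :
    (N : ℝ≥0∞)⁻¹ • (Measure.dirac (V i) + Measure.dirac (V j)) ≤ empirical N V := by
  rw [empirical]
  refine Measure.le_iff.2 fun s hs => ?_
  simp only [Measure.smul_apply, Measure.add_apply, Measure.finsetSum_apply, smul_eq_mul]
  gcongr
  rw [← Finset.sum_pair hij (f := fun i => Measure.dirac (V i) s)]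
  exact Finset.sum_le_sum_of_subset (Finset.subset_univ _)

/-- Subtraction of measures is truncated, so the removed masses must be present. For `i ≠ j` they
belong to the empirical measure; for `i = j` the collision is trivial and they are the masses just
added. -/
theorem collide_add (hN : N ≠ 0) (V : Fin N → Vel d) (i j : Fin N) (σ : Vel d) :
    collide N (empirical N V) (V i) (V j) σ
        + (N : ℝ≥0∞)⁻¹ • (Measure.dirac (V i) + Measure.dirac (V j))
      = empirical N V + (N : ℝ≥0∞)⁻¹ •
        (Measure.dirac (post (V i) (V j) σ) + Measure.dirac (postStar (V i) (V j) σ)) := by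
  have hfin : (N : ℝ≥0∞)⁻¹ ≠ ∞ := ENNReal.inv_ne_top.2 (by exact_mod_cast hN)
  have : IsFiniteMeasure ((N : ℝ≥0∞)⁻¹ • (Measure.dirac (V i) + Measure.dirac (V j))) :=
    Measure.smul_finite _ hfin
  refine Measure.sub_add_cancel_of_le ?_
  by_cases hij : i = j
  · subst hij
    rw [post_self, postStar_self]
    exact Measure.le_add_left le_rfl
  · exact Measure.le_add_right (dirac_add_dirac_le_empirical V hij)

theorem absMoment_collide (hN : N ≠ 0) (p : ℝ) (V : Fin N → Vel d) (i j : Fin N) (σ : Vel d) :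
    absMoment p (collide N (empirical N V) (V i) (V j) σ)
      = absMoment p (empirical N V) + (N : ℝ)⁻¹ * momentJump p (V i) (V j) σ := by
  have hfin : (N : ℝ≥0∞)⁻¹ ≠ ∞ := ENNReal.inv_ne_top.2 (by exact_mod_cast hN)
  have hpair : ∀ v w : Vel d, Integrable (fun x : Vel d => ‖x‖ ^ p)
      ((N : ℝ≥0∞)⁻¹ • (Measure.dirac v + Measure.dirac w)) := fun v w =>
    ((integrable_dirac (by simp)).add_measure (integrable_dirac (by simp))).smul_measure hfin
  have hval : ∀ v w : Vel d, ∫ x, ‖x‖ ^ p ∂((N : ℝ≥0∞)⁻¹ • (Measure.dirac v + Measure.dirac w))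
      = (N : ℝ)⁻¹ * (‖v‖ ^ p + ‖w‖ ^ p) := by
    intro v w
    rw [integral_smul_measure, integral_add_measure (integrable_dirac (by simp))
      (integrable_dirac (by simp))]
    simp
  have hemp := integrable_empirical hN V (fun x : Vel d => ‖x‖ ^ p)
  have hsum := hemp.add_measure (hpair (post (V i) (V j) σ) (postStar (V i) (V j) σ))
  have hc := collide_add hN V i j σ
  have hcol : Integrable (fun x : Vel d => ‖x‖ ^ p) (collide N (empirical N V) (V i) (V j) σ) := by
    refine hsum.mono_measure ?_
    rw [← hc]
    exact Measure.le_add_right le_rfl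
  have := congrArg (fun m => ∫ x, ‖x‖ ^ p ∂m) hc
  simp only [integral_add_measure hcol (hpair _ _), integral_add_measure hemp (hpair _ _),
    hval] at this
  unfold absMoment momentJump
  linarith

/-- The generator on a functional whose increments in a collision are `N⁻¹ φ`. -/
theorem generator_eq {γ : ℝ} {k : ℝ → ℝ} {B : Vel d → Vel d → ℝ}
    (hB : ∀ z, ∀ᵐ σ : Dir d ∂(surface d), B z σ = ‖z‖ ^ γ * k (cosAngle z σ))
    {F : Measure (Vel d) → ℝ} {φ : Vel d → Vel d → Vel d → ℝ} {V : Fin N → Vel d}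
    (hF : ∀ i j (σ : Vel d), F (collide N (empirical N V) (V i) (V j) σ) - F (empirical N V)
      = (N : ℝ)⁻¹ * φ (V i) (V j) σ) (hN : N ≠ 0) :
    generator N B F (empirical N V)
      = ∫ v, ∫ w, collisionMean γ k φ v w ∂(empirical N V) ∂(empirical N V) := by
  have h : ∀ i j, ∫ σ : Dir d, (F (collide N (empirical N V) (V i) (V j) σ) - F (empirical N V))
      * B (V i - V j) σ ∂(surface d) = (N : ℝ)⁻¹ * collisionMean γ k φ (V i) (V j) := by
    intro i j
    rw [collisionMean, ← integral_const_mul]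
    refine integral_congr_ae ?_
    filter_upwards [hB (V i - V j)] with σ hσ
    rw [hσ, hF]; ring
  unfold generator
  simp only [integral_empirical V, h]
  simp only [← Finset.mul_sum]
  have hN' : (N : ℝ) ≠ 0 := by exact_mod_cast hN
  field_simp

/-- `∬ H dμ dμ` for the mean increment `H` of the moment. -/
def momentDrift (γ : ℝ) (k : ℝ → ℝ) (p : ℝ) (μ : Measure (Vel d)) : ℝ :=
  ∫ v, ∫ w, collisionMean γ k (momentJump p) v w ∂μ ∂μ

/-- The rate of quadratic variation of the moment. -/
def momentBracket (N : ℕ) (γ : ℝ) (k : ℝ → ℝ) (p : ℝ) (μ : Measure (Vel d)) : ℝ :=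
  (N : ℝ)⁻¹ * ∫ v, ∫ w, collisionMean γ k (fun v w σ => momentJump p v w σ ^ 2) v w ∂μ ∂μ

theorem generator_absMoment {γ : ℝ} {k : ℝ → ℝ} {B : Vel d → Vel d → ℝ}
    (hB : ∀ z, ∀ᵐ σ : Dir d ∂(surface d), B z σ = ‖z‖ ^ γ * k (cosAngle z σ)) (p : ℝ)
    {μ : Measure (Vel d)} (hμ : μ ∈ kacSphere d N) :
    generator N B (absMoment p) μ = momentDrift γ k p μ := by
  have hN := kacSphere_ne_zero hμ
  obtain ⟨-, V, rfl⟩ := hμ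
  exact generator_eq hB (fun i j σ => by rw [absMoment_collide hN]; ring) hN

/-- An increment `j / N` changes the square by `2 F j / N + j² / N²`. The prefactor `N` of the
generator leaves `2 F` times the drift, and a bracket with one factor `N⁻¹`. -/
theorem generator_absMoment_sq {γ : ℝ} {k : ℝ → ℝ} (hk : IsAngularKernel d k)
    {B : Vel d → Vel d → ℝ}
    (hB : ∀ z, ∀ᵐ σ : Dir d ∂(surface d), B z σ = ‖z‖ ^ γ * k (cosAngle z σ)) {p : ℝ} (hp : 1 ≤ p)
    {μ : Measure (Vel d)} (hμ : μ ∈ kacSphere d N) :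
    generator N B (fun m => absMoment p m ^ 2) μ
      = 2 * absMoment p μ * momentDrift γ k p μ + momentBracket N γ k p μ := by
  have hN := kacSphere_ne_zero hμ
  obtain ⟨-, V, rfl⟩ := hμ
  rw [generator_eq hB (φ := fun v w σ => 2 * absMoment p (empirical N V) * momentJump p v w σ
    + (N : ℝ)⁻¹ * momentJump p v w σ ^ 2) (fun i j σ => by
      simp only [absMoment_collide hN]; ring) hN]
  have h : ∀ v w : Vel d, collisionMean γ k (fun v w σ => 2 * absMoment p (empirical N V)
      * momentJump p v w σ + (N : ℝ)⁻¹ * momentJump p v w σ ^ 2) v w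
      = 2 * absMoment p (empirical N V) * collisionMean γ k (momentJump p) v w
        + (N : ℝ)⁻¹ * collisionMean γ k (fun v w σ => momentJump p v w σ ^ 2) v w := by
    intro v w
    unfold collisionMean
    rw [← integral_const_mul, ← integral_const_mul, ← integral_add
      ((integrable_momentJump hk γ hp v w).const_mul _)
      ((integrable_sq_momentJump hk γ hp v w).const_mul _)]
    congr 1; ext σ; ring
  simp only [h]
  unfold momentDrift momentBracket
  rw [← integral_const_mul, ← integral_const_mul, ← integral_add (integrable_empirical hN V _)
    (integrable_empirical hN V _)]
  congr 1; ext v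
  rw [integral_add (integrable_empirical hN V _) (integrable_empirical hN V _),
    integral_const_mul, integral_const_mul]

/-! ## Bounds on drift and bracket -/

theorem exists_rpow_le_mul_rpow_add {A B η : ℝ} (hA : 0 ≤ A) (hAB : A < B) (hη : 0 < η) :
    ∃ K : ℝ, 0 ≤ K ∧ ∀ t : ℝ, 0 ≤ t → t ^ A ≤ η * t ^ B + K := by
  -- The point beyond which `η * t ^ B` dominates `t ^ A`.
  set T := (1 / η) ^ (1 / (B - A)) with hT
  have hT0 : 0 < T := by positivity
  refine ⟨T ^ A, by positivity, fun t ht => ?_⟩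
  rcases le_total t T with h | h
  · have := Real.rpow_le_rpow ht h hA
    have : 0 ≤ η * t ^ B := by positivity
    linarith
  · have ht0 : 0 < t := hT0.trans_le h
    have h1 : 1 / η ≤ t ^ (B - A) := by
      have h2 := Real.rpow_le_rpow hT0.le h (by linarith : 0 ≤ B - A)
      rwa [hT, ← Real.rpow_mul (by positivity), one_div_mul_cancel (by linarith),
        Real.rpow_one] at h2
    have h3 : t ^ B = t ^ (B - A) * t ^ A := by
      rw [← Real.rpow_add ht0]; ring_nf
    have h4 : 1 ≤ η * t ^ (B - A) := by
      rwa [div_le_iff₀ hη, mul_comm] at h1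
    have : 0 ≤ t ^ A := by positivity
    have : 0 ≤ T ^ A := by positivity
    rw [h3]
    nlinarith

theorem rpow_le_one_add_rpow {t a b : ℝ} (ht : 0 ≤ t) (ha : 0 ≤ a) (hab : a ≤ b) :
    t ^ a ≤ 1 + t ^ b := by
  rcases le_total t 1 with h | h
  · have := Real.rpow_le_one ht h ha
    have : 0 ≤ t ^ b := by positivity
    linarith
  · have := Real.rpow_le_rpow_of_exponent_le h hab
    linarith

theorem absMoment_le_one_add {a b : ℝ} (ha : 0 ≤ a) (hab : a ≤ b) {μ : Measure (Vel d)}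
    (hμ : μ ∈ kacSphere d N) : absMoment a μ ≤ 1 + absMoment b μ := by
  have := kacSphere_isProbabilityMeasure hμ
  refine (kacSphere_integral_mono hμ fun v _ =>
    rpow_le_one_add_rpow (norm_nonneg v) ha hab).trans (le_of_eq ?_)
  rw [integral_add (integrable_const _) (kacSphere_integrable hμ _)]
  simp [absMoment]

/-- Lower bound for the relative speed, in a form that integrates against a centred measure. -/
theorem relative_speed_lower {γ p : ℝ} (hγ : γ ∈ Set.Icc (0 : ℝ) 1) (hp : 0 < p) (v w : Vel d) :
    2 ^ (-γ) * (max (‖v‖ ^ (p + γ) - 4 ^ (p + γ)) 0 * (1 - ‖w‖ ^ 2 / 4))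
      ≤ ‖v - w‖ ^ γ * ‖v‖ ^ p := by
  have hR : 0 ≤ ‖v - w‖ ^ γ * ‖v‖ ^ p := by positivity
  -- The factor `1 - ‖w‖ ^ 2 / 4` is a minorant of the indicator of `‖w‖ < 2` whose integral is
  -- known from the energy alone. For `‖w‖ < 2` and `‖v‖ > 4` the relative speed is at least `‖v‖ /
  -- 2`; for smaller `v` the truncation makes the left side zero.
  rcases le_or_gt 2 ‖w‖ with hw | hw
  · refine le_trans (mul_nonpos_of_nonneg_of_nonpos (by positivity)
      (mul_nonpos_of_nonneg_of_nonpos (le_max_right _ _) ?_)) hR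
    nlinarith
  rcases le_or_gt ‖v‖ 4 with hv | hv
  · have : ‖v‖ ^ (p + γ) ≤ 4 ^ (p + γ) :=
      Real.rpow_le_rpow (norm_nonneg _) hv (by linarith [hγ.1])
    rw [max_eq_right (by linarith)]
    simpa using hR
  · have h1 : ‖v‖ / 2 ≤ ‖v - w‖ := by linarith [norm_sub_norm_le v w]
    have h2 : (‖v‖ / 2) ^ γ ≤ ‖v - w‖ ^ γ := Real.rpow_le_rpow (by positivity) h1 hγ.1
    have hv0 : 0 < ‖v‖ := by linarith
    have h3 : (‖v‖ / 2) ^ γ = 2 ^ (-γ) * ‖v‖ ^ γ := by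
      rw [Real.div_rpow hv0.le (by norm_num), Real.rpow_neg (by norm_num)]; ring
    calc 2 ^ (-γ) * (max (‖v‖ ^ (p + γ) - 4 ^ (p + γ)) 0 * (1 - ‖w‖ ^ 2 / 4))
        ≤ 2 ^ (-γ) * (‖v‖ ^ (p + γ) * 1) := by
          have h4 : (0 : ℝ) ≤ 4 ^ (p + γ) := by positivity
          have h5 : (0 : ℝ) ≤ ‖v‖ ^ (p + γ) := by positivity
          refine mul_le_mul_of_nonneg_left (mul_le_mul (max_le (by linarith) h5) ?_ ?_ h5)
            (by positivity)
          · linarith [sq_nonneg ‖w‖]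
          · nlinarith [norm_nonneg w]
      _ = (‖v‖ / 2) ^ γ * ‖v‖ ^ p := by
          rw [h3, mul_one, add_comm p, Real.rpow_add hv0]; ring
      _ ≤ _ := by gcongr

/-- The faster velocity carries the order `max (p - 2) 2 + γ`, strictly below the order `p + γ` of
the gain since `p > 2`; the slower one has a power at most two, controlled by the energy. -/
theorem mixed_term_le {γ p : ℝ} (hγ : γ ∈ Set.Icc (0 : ℝ) 1) (hp : 2 < p) (v w : Vel d) :
    ‖v - w‖ ^ γ * povznerMixed (p / 2) (‖v‖ ^ 2) (‖w‖ ^ 2)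
      ≤ 2 * (‖v‖ ^ (max (p - 2) 2 + γ) * (1 + ‖w‖ ^ 2)
        + ‖w‖ ^ (max (p - 2) 2 + γ) * (1 + ‖v‖ ^ 2)) := by
  wlog h : ‖w‖ ≤ ‖v‖ generalizing v w
  · have := this w v (le_of_not_ge h)
    rw [norm_sub_rev, povznerMixed_comm]
    linarith
  have e1 : max (p / 2 - 1) 1 = max (p - 2) 2 / 2 := by
    rcases le_total (p - 2) 2 with h | h
    · rw [max_eq_right h, max_eq_right (by linarith)]; norm_num
    · rw [max_eq_left h, max_eq_left (by linarith)]; ring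
  have e2 : min (p / 2 - 1) 1 = min (p - 2) 2 / 2 := by
    rcases le_total (p - 2) 2 with h | h
    · rw [min_eq_left h, min_eq_left (by linarith)]; ring
    · rw [min_eq_right h, min_eq_right (by linarith)]; norm_num
  unfold povznerMixed
  rw [max_eq_left (by gcongr), min_eq_right (by gcongr), e1, e2, ← norm_rpow_eq_sq_rpow,
    ← norm_rpow_eq_sq_rpow]
  set α := max (p - 2) 2
  set β := min (p - 2) 2 with hβ
  have hβ0 : 0 ≤ β := le_min (by linarith) (by norm_num)
  have hα : 0 < α := lt_of_lt_of_le two_pos (le_max_right _ _)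
  have hz : ‖v - w‖ ^ γ ≤ 2 * ‖v‖ ^ γ := by
    calc ‖v - w‖ ^ γ ≤ (2 * ‖v‖) ^ γ :=
          Real.rpow_le_rpow (norm_nonneg _) (by linarith [norm_sub_le v w]) hγ.1
      _ = 2 ^ γ * ‖v‖ ^ γ := Real.mul_rpow (by norm_num) (norm_nonneg _)
      _ ≤ 2 * ‖v‖ ^ γ := by
          gcongr
          calc (2 : ℝ) ^ γ ≤ 2 ^ (1 : ℝ) := Real.rpow_le_rpow_of_exponent_le (by norm_num) hγ.2
            _ = 2 := by norm_num
  have hw : ‖w‖ ^ β ≤ 1 + ‖w‖ ^ 2 := by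
    have := rpow_le_one_add_rpow (norm_nonneg w) hβ0 (min_le_right (p - 2) 2)
    rwa [Real.rpow_two] at this
  have hva : ‖v‖ ^ γ * ‖v‖ ^ α = ‖v‖ ^ (α + γ) := by
    rw [add_comm, Real.rpow_add_of_nonneg (norm_nonneg _) hγ.1 hα.le]
  calc ‖v - w‖ ^ γ * (‖v‖ ^ α * ‖w‖ ^ β) ≤ (2 * ‖v‖ ^ γ) * (‖v‖ ^ α * (1 + ‖w‖ ^ 2)) := by gcongr
    _ = 2 * (‖v‖ ^ (α + γ) * (1 + ‖w‖ ^ 2)) := by rw [← hva]; ring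
    _ ≤ _ := by
        have : 0 ≤ ‖w‖ ^ (α + γ) * (1 + ‖v‖ ^ 2) := by positivity
        linarith

theorem kacSphere_integral_integral_mul {μ : Measure (Vel d)} (f g : Vel d → ℝ) :
    ∫ v, ∫ w, f v * g w ∂μ ∂μ = (∫ v, f v ∂μ) * ∫ w, g w ∂μ := by
  simp_rw [integral_const_mul, integral_mul_const]

theorem kacSphere_integral_integral_mono {μ : Measure (Vel d)} (hμ : μ ∈ kacSphere d N)
    {f g : Vel d → Vel d → ℝ} (h : ∀ v w, ‖v‖ ≤ √N → ‖w‖ ≤ √N → f v w ≤ g v w) :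
    ∫ v, ∫ w, f v w ∂μ ∂μ ≤ ∫ v, ∫ w, g v w ∂μ ∂μ :=
  kacSphere_integral_mono hμ fun v hv => kacSphere_integral_mono hμ fun w hw => h v w hv hw

theorem kacSphere_integral_integral_add {μ : Measure (Vel d)} (hμ : μ ∈ kacSphere d N)
    (f g : Vel d → Vel d → ℝ) :
    ∫ v, ∫ w, (f v w + g v w) ∂μ ∂μ = ∫ v, ∫ w, f v w ∂μ ∂μ + ∫ v, ∫ w, g v w ∂μ ∂μ := by
  rw [← integral_add (kacSphere_integrable hμ _) (kacSphere_integrable hμ _)]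
  congr 1; ext v
  exact integral_add (kacSphere_integrable hμ _) (kacSphere_integrable hμ _)

theorem kacSphere_integral_integral_const_mul {μ : Measure (Vel d)} (c : ℝ)
    (f : Vel d → Vel d → ℝ) :
    ∫ v, ∫ w, c * f v w ∂μ ∂μ = c * ∫ v, ∫ w, f v w ∂μ ∂μ := by
  simp_rw [integral_const_mul]

theorem kacSphere_integral_one_add_sq {μ : Measure (Vel d)} (hμ : μ ∈ kacSphere d N) :
    ∫ v, (1 + ‖v‖ ^ 2) ∂μ = 2 := by
  have := kacSphere_isProbabilityMeasure hμ
  rw [integral_add (integrable_const _) (kacSphere_integrable hμ _), hμ.1.2.2.2]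
  norm_num

theorem kacSphere_integral_one_sub_sq {μ : Measure (Vel d)} (hμ : μ ∈ kacSphere d N) :
    ∫ v, (1 - ‖v‖ ^ 2 / 4) ∂μ = 3 / 4 := by
  have := kacSphere_isProbabilityMeasure hμ
  rw [integral_sub (integrable_const _) (kacSphere_integrable hμ _), integral_div, hμ.1.2.2.2]
  norm_num

/-- Moment production: the drift is strongly negative for large moments. -/
theorem exists_momentDrift_le {γ p : ℝ} (hγ : γ ∈ Set.Icc (0 : ℝ) 1) (hp : 2 < p) :
    ∃ C c : ℝ, 0 < C ∧ 0 < c ∧ ∀ (N : ℕ) (k : ℝ → ℝ), IsAngularKernel d k →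
      ∀ e : Vel d, ‖e‖ = 1 → ∀ μ ∈ kacSphere d N,
        momentDrift γ k p μ ≤ crossSection k e * (C - c * absMoment p μ) := by
  set g := povznerGain (p / 2) with hg
  set l := povznerLoss (p / 2) with hl
  have hg0 : 0 < g := povznerGain_pos (by linarith)
  have hl0 : 0 ≤ l := povznerLoss_nonneg (by linarith)
  set α := max (p - 2) 2 with hα
  have hαp : α < p := max_lt (by linarith) hp
  have hα0 : 0 < α := lt_of_lt_of_le two_pos (le_max_right _ _)
  -- Povzner gain, times the loss `2 ^ (-γ)` in relative speed, times `∫ (1 - ‖w‖² / 4) dμ`.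
  set c₁ : ℝ := g * 2 ^ (-γ) * (3 / 4) with hc₁
  have hc₁0 : 0 < c₁ := by positivity
  -- The mixed term contributes `8 l` times the moment of order `α + γ` (prefactor `2 l`, two
  -- symmetric terms, `∫ (1 + ‖v‖²) dμ = 2`). This choice of `η` makes it consume at most half of
  -- the gain; the `+ 1` covers `l = 0`.
  obtain ⟨K, hK0, hK⟩ := exists_rpow_le_mul_rpow_add (A := α + γ) (B := p + γ)
    (η := c₁ / 2 / (8 * l + 1)) (by linarith [hγ.1]) (by linarith) (by positivity)
  refine ⟨c₁ * 4 ^ (p + γ) + 8 * l * K + c₁ / 2, c₁ / 2, by positivity, by positivity,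
    fun N k hk e he μ hμ => ?_⟩
  have hprob := kacSphere_isProbabilityMeasure hμ
  have hκ := hk.crossSection_nonneg e
  have hpt : ∀ v w : Vel d, ‖v - w‖ ^ γ * povznerBracket p v w ≤
      (-(g * 2 ^ (-γ))) * (max (‖v‖ ^ (p + γ) - 4 ^ (p + γ)) 0 * (1 - ‖w‖ ^ 2 / 4))
      + (2 * l) * (‖v‖ ^ (α + γ) * (1 + ‖w‖ ^ 2) + (1 + ‖v‖ ^ 2) * ‖w‖ ^ (α + γ)) := by
    intro v w
    have h1 := mul_le_mul_of_nonneg_left (relative_speed_lower hγ (by linarith : 0 < p) v w) hg0.le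
    have h2 := mul_le_mul_of_nonneg_left (mixed_term_le hγ hp v w) hl0
    -- The gain from `w` is discarded; the one from `v` suffices.
    have h3 : 0 ≤ g * (‖v - w‖ ^ γ * ‖w‖ ^ p) := by positivity
    unfold povznerBracket
    rw [← hg, ← hl]
    linarith
  have h1 : momentDrift γ k p μ ≤ crossSection k e *
      ∫ v, ∫ w, ‖v - w‖ ^ γ * povznerBracket p v w ∂μ ∂μ := by
    rw [← kacSphere_integral_integral_const_mul]
    exact kacSphere_integral_integral_mono hμ fun v w _ _ =>
      collisionMean_momentJump_le hk γ hp he v w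
  refine h1.trans (mul_le_mul_of_nonneg_left ?_ hκ)
  refine (kacSphere_integral_integral_mono hμ fun v w _ _ => hpt v w).trans ?_
  rw [kacSphere_integral_integral_add hμ, kacSphere_integral_integral_const_mul,
    kacSphere_integral_integral_const_mul, kacSphere_integral_integral_add hμ,
    kacSphere_integral_integral_mul (fun v => max (‖v‖ ^ (p + γ) - 4 ^ (p + γ)) 0)
      (fun w => 1 - ‖w‖ ^ 2 / 4),
    kacSphere_integral_integral_mul (fun v => ‖v‖ ^ (α + γ)) (fun w => 1 + ‖w‖ ^ 2),
    kacSphere_integral_integral_mul (fun v => 1 + ‖v‖ ^ 2) (fun w => ‖w‖ ^ (α + γ)),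
    kacSphere_integral_one_add_sq hμ, kacSphere_integral_one_sub_sq hμ]
  have h2 : absMoment (p + γ) μ - 4 ^ (p + γ)
      ≤ ∫ v, max (‖v‖ ^ (p + γ) - 4 ^ (p + γ)) 0 ∂μ := by
    have := kacSphere_integral_mono hμ (f := fun v => ‖v‖ ^ (p + γ) - 4 ^ (p + γ))
      (g := fun v => max (‖v‖ ^ (p + γ) - 4 ^ (p + γ)) 0) fun v _ => le_max_left _ _
    rw [integral_sub (kacSphere_integrable hμ _) (integrable_const _)] at this
    simpa [absMoment] using this
  have h3 : ∫ v, ‖v‖ ^ (α + γ) ∂μ ≤ c₁ / 2 / (8 * l + 1) * absMoment (p + γ) μ + K := by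
    refine (kacSphere_integral_mono hμ fun v _ => hK ‖v‖ (norm_nonneg v)).trans (le_of_eq ?_)
    rw [integral_add (kacSphere_integrable hμ _) (integrable_const _), integral_const_mul]
    simp [absMoment]
  -- The gain has order `p + γ`; this step lowers it to `p`, at the cost of the summand `c₁ / 2` in
  -- the constant.
  have h4 := absMoment_le_one_add (by linarith : 0 ≤ p) (by linarith [hγ.1] : p ≤ p + γ) hμ
  have h5 : 8 * l * (c₁ / 2 / (8 * l + 1)) ≤ c₁ / 2 := by
    rw [mul_div_assoc', div_le_iff₀ (by positivity)]
    nlinarith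
  have h6 := mul_le_mul_of_nonneg_right h5 (absMoment_nonneg (p + γ) μ)
  have h7 := mul_le_mul_of_nonneg_left h3 (by positivity : 0 ≤ 8 * l)
  have h8 := mul_le_mul_of_nonneg_left h2 hc₁0.le
  have h9 := mul_le_mul_of_nonneg_left h4 hc₁0.le
  have e1 : -(g * 2 ^ (-γ)) * ((∫ v, max (‖v‖ ^ (p + γ) - 4 ^ (p + γ)) 0 ∂μ) * (3 / 4))
      = -(c₁ * ∫ v, max (‖v‖ ^ (p + γ) - 4 ^ (p + γ)) 0 ∂μ) := by rw [hc₁]; ring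
  rw [e1]
  linarith

theorem momentBracket_le {γ p : ℝ} (hγ : 0 ≤ γ) (hp : 1 ≤ p) {k : ℝ → ℝ}
    (hk : IsAngularKernel d k) {e : Vel d} (he : ‖e‖ = 1) {μ : Measure (Vel d)}
    (hμ : μ ∈ kacSphere d N) :
    momentBracket N γ k p μ
      ≤ (N : ℝ)⁻¹ * (crossSection k e * (8 * p ^ 2 * 2 ^ (2 * p + γ)) *
        absMoment (2 * p + γ) μ) := by
  have := kacSphere_isProbabilityMeasure hμ
  unfold momentBracket
  refine mul_le_mul_of_nonneg_left ((kacSphere_integral_integral_mono hμ fun v w _ _ =>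
    collisionMean_sq_momentJump_le hk hγ hp he v w).trans (le_of_eq ?_)) (by positivity)
  rw [kacSphere_integral_integral_const_mul, kacSphere_integral_integral_add hμ]
  simp only [integral_const, probReal_univ, one_smul]
  unfold absMoment
  ring

theorem momentBracket_nonneg {k : ℝ → ℝ} (hk : IsAngularKernel d k) (N : ℕ) (γ p : ℝ)
    (μ : Measure (Vel d)) : 0 ≤ momentBracket N γ k p μ :=
  mul_nonneg (by positivity) (integral_nonneg fun v => integral_nonneg fun w =>
    collisionMean_sq_momentJump_nonneg hk γ p v w)

/-- A bound depending on `N` and `k`, used only to know that the drift is a bounded process. -/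
theorem exists_abs_momentDrift_le {γ p : ℝ} (hγ : 0 ≤ γ) (hp : 1 ≤ p) (hd : d ≠ 0) (N : ℕ)
    {k : ℝ → ℝ} (hk : IsAngularKernel d k) :
    ∃ D : ℝ, ∀ μ ∈ kacSphere d N, |momentDrift γ k p μ| ≤ D := by
  obtain ⟨e, he⟩ : ∃ e : Vel d, ‖e‖ = 1 :=
    ⟨EuclideanSpace.single ⟨0, Nat.pos_of_ne_zero hd⟩ 1, by simp⟩
  set κ := ∫ σ : Dir d, √(halfSinSq (cosAngle e σ)) * k (cosAngle e σ) ∂(surface d) with hκ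
  have hκ0 : 0 ≤ κ := integral_nonneg fun σ => mul_nonneg (Real.sqrt_nonneg _) (hk.nonneg _)
  set D := 2 * p * (2 * √N) ^ p * (2 * √N) ^ γ * κ with hD
  have hD0 : 0 ≤ D := by positivity
  have hpt : ∀ v w : Vel d, ‖v‖ ≤ √N → ‖w‖ ≤ √N →
      |collisionMean γ k (momentJump p) v w| ≤ D := by
    intro v w hv hw
    rcases eq_or_ne v w with rfl | hvw
    · simpa [collisionMean, momentJump_self] using hD0
    have hz := sub_ne_zero.2 hvw
    have hle := norm_integral_le_of_norm_le (f := fun σ : Dir d => momentJump p v w σ *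
      (‖v - w‖ ^ γ * k (cosAngle (v - w) σ))) ((hk.integrable_sqrt hz).const_mul
      (2 * p * (2 * √N) ^ p * (2 * √N) ^ γ)) (ae_of_all _ fun σ => ?_)
    · rw [integral_const_mul,
        integral_cosAngle_eq (fun x => √(halfSinSq x) * k x) he hz] at hle
      exact hle
    · have hk1 := hk.nonneg (cosAngle (v - w) σ)
      rw [norm_mul, Real.norm_eq_abs, Real.norm_of_nonneg (by positivity)]
      calc |momentJump p v w σ| * (‖v - w‖ ^ γ * k (cosAngle (v - w) σ))
          ≤ (2 * p * (‖v‖ + ‖w‖) ^ p * √(halfSinSq (cosAngle (v - w) σ))) *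
            ((‖v‖ + ‖w‖) ^ γ * k (cosAngle (v - w) σ)) := by
            have := abs_momentJump_le hp v w σ
            have := Real.rpow_le_rpow (norm_nonneg _) (norm_sub_le v w) hγ
            gcongr
        _ ≤ (2 * p * (2 * √N) ^ p * √(halfSinSq (cosAngle (v - w) σ))) *
            ((2 * √N) ^ γ * k (cosAngle (v - w) σ)) := by
            have : ‖v‖ + ‖w‖ ≤ 2 * √N := by linarith
            gcongr
        _ = _ := by ring
  refine ⟨D, fun μ hμ => ?_⟩
  have := kacSphere_isProbabilityMeasure hμ
  unfold momentDrift
  have hc : ∫ _ : Vel d, ∫ _ : Vel d, D ∂μ ∂μ = D := by simp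
  have hc' : ∫ _ : Vel d, ∫ _ : Vel d, -D ∂μ ∂μ = -D := by simp
  refine abs_le.2 ⟨?_, ?_⟩
  · rw [← hc']
    exact kacSphere_integral_integral_mono hμ fun v w hv hw => (abs_le.1 (hpt v w hv hw)).1
  · conv_rhs => rw [← hc]
    exact kacSphere_integral_integral_mono hμ fun v w hv hw => (abs_le.1 (hpt v w hv hw)).2

/-! ## Bounded processes -/

section Paths

variable {Ω : Type*} [mΩ : MeasurableSpace Ω]

/-- A jointly measurable process bounded by `K`. -/
structure IsBddProcess (h : ℝ≥0 → Ω → ℝ) (K : ℝ) : Prop where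
  measurable : Measurable fun x : ℝ≥0 × Ω => h x.1 x.2
  bdd : ∀ t ω, |h t ω| ≤ K

variable {h : ℝ≥0 → Ω → ℝ} {K : ℝ}

theorem IsBddProcess.measurable_path (hh : IsBddProcess h K) (ω : Ω) :
    Measurable fun s : ℝ => h s.toNNReal ω :=
  hh.measurable.comp (measurable_real_toNNReal.prodMk measurable_const)

theorem IsBddProcess.measurable_apply (hh : IsBddProcess h K) (t : ℝ≥0) : Measurable (h t) :=
  hh.measurable.comp measurable_prodMk_left

theorem IsBddProcess.integrable (hh : IsBddProcess h K) (P : Measure Ω) [IsFiniteMeasure P]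
    (t : ℝ≥0) : Integrable (h t) P :=
  Integrable.of_bound (hh.measurable_apply t).aestronglyMeasurable K (ae_of_all _ (hh.bdd t))

theorem IsBddProcess.intervalIntegrable (hh : IsBddProcess h K) (ω : Ω) (s t : ℝ) :
    IntervalIntegrable (fun u => h u.toNNReal ω) volume s t := by
  constructor <;> exact Integrable.of_bound (hh.measurable_path ω).aestronglyMeasurable K
    (ae_of_all _ fun u => hh.bdd _ ω)

theorem IsBddProcess.abs_integral_le (hh : IsBddProcess h K) (ω : Ω) {s t : ℝ} (hst : s ≤ t) :
    |∫ u in s..t, h u.toNNReal ω| ≤ K * (t - s) := by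
  have := intervalIntegral.norm_integral_le_of_norm_le_const (a := s) (b := t)
    (f := fun u => h u.toNNReal ω) (C := K) fun u _ => hh.bdd _ ω
  rwa [abs_of_nonneg (by linarith : 0 ≤ t - s)] at this

theorem IsBddProcess.measurable_swap (hh : IsBddProcess h K) :
    Measurable fun x : Ω × ℝ => h x.2.toNNReal x.1 :=
  hh.measurable.comp ((measurable_real_toNNReal.comp measurable_snd).prodMk measurable_fst)

theorem IsBddProcess.measurable_integral (hh : IsBddProcess h K) (s t : ℝ) :
    Measurable fun ω => ∫ u in s..t, h u.toNNReal ω := by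
  unfold intervalIntegral
  exact (hh.measurable_swap.stronglyMeasurable.integral_prod_right'.measurable).sub
    (hh.measurable_swap.stronglyMeasurable.integral_prod_right'.measurable)

theorem IsBddProcess.integrable_integral (hh : IsBddProcess h K) (P : Measure Ω)
    [IsFiniteMeasure P] {s t : ℝ} (hst : s ≤ t) :
    Integrable (fun ω => ∫ u in s..t, h u.toNNReal ω) P :=
  Integrable.of_bound (hh.measurable_integral s t).aestronglyMeasurable (K * (t - s))
    (ae_of_all _ fun ω => hh.abs_integral_le ω hst)

theorem IsBddProcess.integral_integral_swap (hh : IsBddProcess h K) (P : Measure Ω)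
    [IsFiniteMeasure P] {s t : ℝ} (hst : s ≤ t) :
    ∫ ω, (∫ u in s..t, h u.toNNReal ω) ∂P = ∫ u in s..t, (∫ ω, h u.toNNReal ω ∂P) := by
  simp only [intervalIntegral.integral_of_le hst]
  exact MeasureTheory.integral_integral_swap (Integrable.of_bound
    hh.measurable_swap.aestronglyMeasurable K (ae_of_all _ fun x => hh.bdd _ _))

theorem IsBddProcess.measurable_expectation (hh : IsBddProcess h K) (P : Measure Ω)
    [IsFiniteMeasure P] : Measurable fun u : ℝ => ∫ ω, h u.toNNReal ω ∂P :=
  ((hh.measurable_swap.comp _root_.measurable_swap).stronglyMeasurable.integral_prod_right').measurable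

theorem IsBddProcess.abs_expectation_le (hh : IsBddProcess h K) (P : Measure Ω)
    [IsProbabilityMeasure P] (t : ℝ≥0) : |∫ ω, h t ω ∂P| ≤ K := by
  have := norm_integral_le_of_norm_le_const (μ := P) (f := h t) (C := K)
    (ae_of_all _ (hh.bdd t))
  simpa using this

theorem IsBddProcess.integral_integral_le (hh : IsBddProcess h K) (P : Measure Ω)
    [IsProbabilityMeasure P] {s t : ℝ≥0} (hst : s ≤ t) {c : ℝ}
    (hc : ∀ u, s ≤ u → u ≤ t → ∫ ω, h u ω ∂P ≤ c) :
    ∫ ω, (∫ u in (s : ℝ)..t, h u.toNNReal ω) ∂P ≤ c * (t - s) := by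
  have hst' : (s : ℝ) ≤ t := hst
  rw [hh.integral_integral_swap P hst']
  have hint : IntervalIntegrable (fun u : ℝ => ∫ ω, h u.toNNReal ω ∂P) volume s t := by
    constructor <;> exact Integrable.of_bound (hh.measurable_expectation P).aestronglyMeasurable K
      (ae_of_all _ fun u => hh.abs_expectation_le P _)
  have := intervalIntegral.integral_mono_on hst' hint intervalIntegrable_const
    (g := fun _ => c) fun u hu => hc u.toNNReal
      (NNReal.le_toNNReal_of_coe_le hu.1) (Real.toNNReal_le_iff_le_coe.2 hu.2)
  simpa [mul_comm] using this

/-! ## Second moments of martingales -/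

theorem integral_mul_martingale {P : Measure Ω} [IsFiniteMeasure P] {ℱ : Filtration ℝ≥0 mΩ}
    {M : ℝ≥0 → Ω → ℝ} (hM : Martingale M ℱ P) {s t : ℝ≥0} (hst : s ≤ t) {Z : Ω → ℝ}
    (hZ : StronglyMeasurable[ℱ s] Z) {C : ℝ} (hC : ∀ ω, |Z ω| ≤ C) :
    ∫ ω, Z ω * M t ω ∂P = ∫ ω, Z ω * M s ω ∂P := by
  have hZt : Integrable (Z * M t) P := (hM.integrable t).bdd_mul
    (hZ.mono (ℱ.le s)).aestronglyMeasurable (ae_of_all _ hC)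
  have h1 := condExp_mul_of_stronglyMeasurable_left (μ := P) hZ hZt (hM.integrable t)
  calc ∫ ω, Z ω * M t ω ∂P = ∫ ω, (P[Z * M t | ℱ s]) ω ∂P := (integral_condExp (ℱ.le s)).symm
    _ = ∫ ω, Z ω * M s ω ∂P := by
        refine integral_congr_ae ?_
        filter_upwards [h1, hM.condExp_ae_eq hst] with ω h2 h3
        rw [h2, Pi.mul_apply, h3]

theorem integral_martingale_eq {P : Measure Ω} [IsFiniteMeasure P] {ℱ : Filtration ℝ≥0 mΩ}
    {M : ℝ≥0 → Ω → ℝ} (hM : Martingale M ℱ P) {s t : ℝ≥0} (hst : s ≤ t) :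
    ∫ ω, M t ω ∂P = ∫ ω, M s ω ∂P := by
  simpa using integral_mul_martingale hM hst (Z := fun _ => 1) stronglyMeasurable_const (C := 1)
    (by simp)

theorem integral_sub_sub_two_mul_sub {P : Measure Ω} {f₁ f₂ f₃ f₄ : Ω → ℝ} (h₁ : Integrable f₁ P)
    (h₂ : Integrable f₂ P) (h₃ : Integrable f₃ P) (h₄ : Integrable f₄ P) :
    Integrable (fun ω => f₁ ω - f₂ ω - 2 * (f₃ ω - f₄ ω)) P ∧
    ∫ ω, (f₁ ω - f₂ ω - 2 * (f₃ ω - f₄ ω)) ∂P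
      = ∫ ω, f₁ ω ∂P - ∫ ω, f₂ ω ∂P - 2 * (∫ ω, f₃ ω ∂P - ∫ ω, f₄ ω ∂P) := by
  refine ⟨(h₁.sub h₂).sub ((h₃.sub h₄).const_mul 2), ?_⟩
  rw [← integral_sub h₁ h₂, ← integral_sub h₃ h₄, ← integral_const_mul]
  exact integral_sub (h₁.sub h₂) ((h₃.sub h₄).const_mul 2)

/-- A function with increments of higher order than its argument does not increase. -/
theorem le_zero_of_increment_le {F : ℝ≥0 → ℝ} (h0 : F 0 = 0) {A B : ℝ}
    (hF : ∀ l : ℝ, 0 < l → ∀ s t : ℝ≥0, s ≤ t →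
      F t - F s ≤ A * (l + 1) * (t - s : ℝ) ^ 2 + B * (t - s : ℝ) / l) (T : ℝ≥0) : F T ≤ 0 := by
  -- Over `n` equal steps the quadratic terms add up to `O(1/n)`. The limit `n → ∞` at fixed `l`
  -- removes them, and `l → ∞` removes the rest.
  have hgrid : ∀ l : ℝ, 0 < l → ∀ n : ℕ, 0 < n →
      F T ≤ A * (l + 1) * (T : ℝ) ^ 2 / n + B * T / l := by
    intro l hl n hn
    have hn' : (0 : ℝ) < n := by exact_mod_cast hn
    have hk : ∀ k : ℕ, F (T * k / n) ≤
        k * (A * (l + 1) * (T / n : ℝ) ^ 2 + B * (T / n : ℝ) / l) := by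
      intro k
      induction k with
      | zero => simp [h0]
      | succ k ih =>
        have h1 := hF l hl (T * k / n) (T * (k + 1 : ℕ) / n) (by gcongr; simp)
        have e : ((T * (k + 1 : ℕ) / n : ℝ≥0) : ℝ) - ((T * k / n : ℝ≥0) : ℝ) = T / n := by
          push_cast; field_simp; ring
        rw [e] at h1
        push_cast at h1 ⊢
        linarith
    have h2 := hk n
    rw [mul_div_cancel_right₀ _ (by exact_mod_cast hn.ne')] at h2
    refine h2.trans (le_of_eq ?_)
    field_simp
  have hlim1 : ∀ l : ℝ, 0 < l → F T ≤ B * T / l := by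
    intro l hl
    have ht : Tendsto (fun n : ℕ => A * (l + 1) * (T : ℝ) ^ 2 / n + B * T / l) atTop
        (𝓝 (0 + B * T / l)) :=
      (tendsto_const_div_atTop_nhds_zero_nat _).add tendsto_const_nhds
    rw [zero_add] at ht
    exact ge_of_tendsto ht ((eventually_gt_atTop 0).mono fun n hn => hgrid l hl n hn)
  exact ge_of_tendsto (tendsto_const_nhds.div_atTop tendsto_id)
    ((eventually_gt_atTop 0).mono fun l hl => hlim1 l hl)

/-- The data of a bounded semimartingale `X` with drift `a` and bracket rate `g`. -/
structure IsBddSemimartingale (P : Measure Ω) (ℱ : Filtration ℝ≥0 mΩ) (X a g : ℝ≥0 → Ω → ℝ)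
    (K D G : ℝ) : Prop where
  bdd_X : IsBddProcess X K
  bdd_a : IsBddProcess a D
  bdd_g : IsBddProcess g G
  adapted : ∀ t, StronglyMeasurable[ℱ t] (X t)
  martingale : Martingale (fun (t : ℝ≥0) ω => X t ω - X 0 ω - ∫ s in (0 : ℝ)..t, a s.toNNReal ω) ℱ P
  martingale_sq : Martingale (fun (t : ℝ≥0) ω => X t ω ^ 2 - X 0 ω ^ 2
    - ∫ s in (0 : ℝ)..t, (2 * X s.toNNReal ω * a s.toNNReal ω + g s.toNNReal ω)) ℱ P

/-- The martingale part of a semimartingale. -/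
def martingalePart (X a : ℝ≥0 → Ω → ℝ) (t : ℝ≥0) (ω : Ω) : ℝ :=
  X t ω - X 0 ω - ∫ s in (0 : ℝ)..t, a s.toNNReal ω

variable {P : Measure Ω} {ℱ : Filtration ℝ≥0 mΩ} {X a g : ℝ≥0 → Ω → ℝ} {K D G : ℝ}

theorem IsBddProcess.add {h' : ℝ≥0 → Ω → ℝ} {K' : ℝ} (hh : IsBddProcess h K)
    (hh' : IsBddProcess h' K') : IsBddProcess (fun t ω => h t ω + h' t ω) (K + K') :=
  ⟨hh.measurable.add hh'.measurable, fun t ω =>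
    (abs_add_le _ _).trans (add_le_add (hh.bdd t ω) (hh'.bdd t ω))⟩

theorem IsBddProcess.mul {h' : ℝ≥0 → Ω → ℝ} {K' : ℝ} (hh : IsBddProcess h K)
    (hh' : IsBddProcess h' K') : IsBddProcess (fun t ω => h t ω * h' t ω) (K * K') :=
  ⟨hh.measurable.mul hh'.measurable, fun t ω => by
    rw [abs_mul]
    exact mul_le_mul (hh.bdd t ω) (hh'.bdd t ω) (abs_nonneg _)
      ((abs_nonneg _).trans (hh.bdd t ω))⟩

theorem IsBddProcess.const_mul (hh : IsBddProcess h K) (c : ℝ) :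
    IsBddProcess (fun t ω => c * h t ω) (|c| * K) :=
  ⟨hh.measurable.const_mul c, fun t ω => by
    rw [abs_mul]
    exact mul_le_mul_of_nonneg_left (hh.bdd t ω) (abs_nonneg _)⟩

theorem IsBddProcess.increment (hh : IsBddProcess h K) (s : ℝ≥0) :
    IsBddProcess (fun t ω => h t ω - h s ω) (K + K) :=
  ⟨hh.measurable.sub ((hh.measurable_apply s).comp measurable_snd), fun t ω =>
    (abs_sub _ _).trans (add_le_add (hh.bdd t ω) (hh.bdd s ω))⟩

theorem IsBddProcess.integral_interval_sub (hh : IsBddProcess h K) (ω : Ω) (s t : ℝ) :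
    (∫ u in (0 : ℝ)..t, h u.toNNReal ω) - ∫ u in (0 : ℝ)..s, h u.toNNReal ω
      = ∫ u in s..t, h u.toNNReal ω :=
  intervalIntegral.integral_interval_sub_left (hh.intervalIntegrable ω 0 t)
    (hh.intervalIntegrable ω 0 s)

namespace IsBddSemimartingale

theorem bdd_sq_drift (S : IsBddSemimartingale P ℱ X a g K D G) :
    IsBddProcess (fun t ω => 2 * X t ω * a t ω + g t ω) (|2| * K * D + G) :=
  ((S.bdd_X.const_mul 2).mul S.bdd_a).add S.bdd_g

/-- `E (X_t - X_s)² = E ∫_s^t (2 (X_u - X_s) a_u + g_u) du`. -/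
theorem integral_increment_sq [IsProbabilityMeasure P]
    (S : IsBddSemimartingale P ℱ X a g K D G) {s t : ℝ≥0} (hst : s ≤ t) :
    ∫ ω, (X t ω - X s ω) ^ 2 ∂P
      = ∫ ω, (∫ u in (s : ℝ)..t,
          (2 * (X u.toNNReal ω - X s ω) * a u.toNNReal ω + g u.toNNReal ω)) ∂P := by
  have hst' : (s : ℝ) ≤ t := hst
  have h1 := integral_martingale_eq S.martingale_sq hst
  have h2 := integral_mul_martingale S.martingale hst (S.adapted s) (S.bdd_X.bdd s)
  have i1 : Integrable (fun ω => X s ω * (X t ω - X 0 ω - ∫ u in (0 : ℝ)..t, a u.toNNReal ω)) P :=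
    (S.martingale.integrable t).bdd_mul (S.bdd_X.measurable_apply s).aestronglyMeasurable
      (ae_of_all _ (S.bdd_X.bdd s))
  have i2 : Integrable (fun ω => X s ω * (X s ω - X 0 ω - ∫ u in (0 : ℝ)..s, a u.toNNReal ω)) P :=
    (S.martingale.integrable s).bdd_mul (S.bdd_X.measurable_apply s).aestronglyMeasurable
      (ae_of_all _ (S.bdd_X.bdd s))
  have i3 := S.martingale_sq.integrable t
  have i4 := S.martingale_sq.integrable s
  have i5 := (((S.bdd_X.increment s).const_mul 2).mul S.bdd_a).add S.bdd_g
  -- Write `(X_t - X_s)² = X_t² - X_s² - 2 X_s (X_t - X_s)` and split both increments into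
  -- compensator and martingale increment; the latter have mean zero, also after multiplication by
  -- `X_s`.
  have hpt : ∀ ω, (X t ω - X s ω) ^ 2 =
      (∫ u in (s : ℝ)..t, (2 * (X u.toNNReal ω - X s ω) * a u.toNNReal ω + g u.toNNReal ω))
      + (((X t ω ^ 2 - X 0 ω ^ 2
        - ∫ u in (0 : ℝ)..t, (2 * X u.toNNReal ω * a u.toNNReal ω + g u.toNNReal ω))
      - (X s ω ^ 2 - X 0 ω ^ 2
        - ∫ u in (0 : ℝ)..s, (2 * X u.toNNReal ω * a u.toNNReal ω + g u.toNNReal ω)))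
      - 2 * (X s ω * (X t ω - X 0 ω - ∫ u in (0 : ℝ)..t, a u.toNNReal ω)
        - X s ω * (X s ω - X 0 ω - ∫ u in (0 : ℝ)..s, a u.toNNReal ω))) := by
    intro ω
    have e1 := S.bdd_sq_drift.integral_interval_sub ω s t
    have e2 := S.bdd_a.integral_interval_sub ω s t
    have e3 : (∫ u in (s : ℝ)..t, (2 * (X u.toNNReal ω - X s ω) * a u.toNNReal ω
        + g u.toNNReal ω))
        = (∫ u in (s : ℝ)..t, (2 * X u.toNNReal ω * a u.toNNReal ω + g u.toNNReal ω))
          - 2 * X s ω * ∫ u in (s : ℝ)..t, a u.toNNReal ω := by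
      rw [← intervalIntegral.integral_const_mul, ← intervalIntegral.integral_sub
        (S.bdd_sq_drift.intervalIntegrable ω s t) ((S.bdd_a.intervalIntegrable ω s t).const_mul _)]
      congr 1; ext u; ring
    rw [e3, ← e1, ← e2]
    ring
  simp only [hpt]
  obtain ⟨i6, h6⟩ := integral_sub_sub_two_mul_sub i3 i4 i1 i2
  rw [integral_add (i5.integrable_integral P hst') i6, h6, h1, h2]
  simp

theorem bdd_increment_sq (S : IsBddSemimartingale P ℱ X a g K D G) (s : ℝ≥0) :
    IsBddProcess (fun u ω => (X u ω - X s ω) ^ 2) ((K + K) * (K + K)) := by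
  simpa only [sq] using (S.bdd_X.increment s).mul (S.bdd_X.increment s)

theorem integral_increment_sq_le [IsProbabilityMeasure P]
    (S : IsBddSemimartingale P ℱ X a g K D G) {s t : ℝ≥0} (hst : s ≤ t) :
    ∫ ω, (X t ω - X s ω) ^ 2 ∂P ≤ (4 * K * D + G) * (t - s) := by
  rw [S.integral_increment_sq hst]
  have i5 := (((S.bdd_X.increment s).const_mul 2).mul S.bdd_a).add S.bdd_g
  refine i5.integral_integral_le P hst fun u _ _ => (le_abs_self _).trans
    ((i5.abs_expectation_le P u).trans (le_of_eq ?_))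
  rw [abs_of_pos two_pos]; ring

/-- Young's inequality with parameter `l` splits the cross term `2 (X_u - X_s) a_u`. The rough bound
`O(u - s)` on the squared increment makes one part quadratic in `t - s`; the other is linear but
carries `1 / l`. -/
theorem integral_increment_sq_le' [IsProbabilityMeasure P]
    (S : IsBddSemimartingale P ℱ X a g K D G) {s t : ℝ≥0} (hst : s ≤ t) {l : ℝ} (hl : 0 < l) :
    ∫ ω, (X t ω - X s ω) ^ 2 ∂P ≤ ∫ ω, (∫ u in (s : ℝ)..t, g u.toNNReal ω) ∂P
      + (l * ((4 * K * D + G) * (t - s)) + D ^ 2 / l) * (t - s) := by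
  have hst' : (s : ℝ) ≤ t := hst
  rw [S.integral_increment_sq hst]
  have i5 := (((S.bdd_X.increment s).const_mul 2).mul S.bdd_a)
  have hsplit : ∀ ω, (∫ u in (s : ℝ)..t, (2 * (X u.toNNReal ω - X s ω) * a u.toNNReal ω
      + g u.toNNReal ω)) = (∫ u in (s : ℝ)..t, 2 * (X u.toNNReal ω - X s ω) * a u.toNNReal ω)
      + ∫ u in (s : ℝ)..t, g u.toNNReal ω := fun ω =>
    intervalIntegral.integral_add (i5.intervalIntegrable ω s t) (S.bdd_g.intervalIntegrable ω s t)
  simp only [hsplit]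
  rw [integral_add (i5.integrable_integral P hst') (S.bdd_g.integrable_integral P hst'), add_comm]
  gcongr
  refine i5.integral_integral_le P hst fun u hsu hut => ?_
  have hsq := (S.bdd_increment_sq s).integrable P u
  have hmono : ∫ ω, 2 * (X u ω - X s ω) * a u ω ∂P
      ≤ ∫ ω, (l * (X u ω - X s ω) ^ 2 + D ^ 2 / l) ∂P := by
    refine integral_mono (i5.integrable P u) ((hsq.const_mul l).add (integrable_const _))
      fun ω => ?_
    have ha2 : a u ω ^ 2 ≤ D ^ 2 := by
      have := S.bdd_a.bdd u ω
      rw [← sq_abs]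
      exact pow_le_pow_left₀ (abs_nonneg _) this 2
    have h1 : a u ω ^ 2 / l ≤ D ^ 2 / l := by gcongr
    have h2 : 2 * (X u ω - X s ω) * a u ω ≤ l * (X u ω - X s ω) ^ 2 + a u ω ^ 2 / l := by
      have e : l * (X u ω - X s ω) ^ 2 + a u ω ^ 2 / l - 2 * (X u ω - X s ω) * a u ω
          = (l * (X u ω - X s ω) - a u ω) ^ 2 / l := by field_simp; ring
      have : 0 ≤ (l * (X u ω - X s ω) - a u ω) ^ 2 / l := by positivity
      linarith
    simp only
    linarith
  refine hmono.trans ?_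
  rw [integral_add (hsq.const_mul l) (integrable_const _), integral_const_mul]
  have h3 := S.integral_increment_sq_le hsu
  have hC : 0 ≤ 4 * K * D + G := by
    obtain ⟨ω⟩ := nonempty_of_isProbabilityMeasure P
    have hK := (abs_nonneg _).trans (S.bdd_X.bdd 0 ω)
    have hD := (abs_nonneg _).trans (S.bdd_a.bdd 0 ω)
    have hG := (abs_nonneg _).trans (S.bdd_g.bdd 0 ω)
    positivity
  have h4 : (4 * K * D + G) * ((u : ℝ) - s) ≤ (4 * K * D + G) * (t - s) := by
    gcongr
  simp only [integral_const, probReal_univ, one_smul]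
  gcongr
  linarith

theorem abs_martingalePart_le (S : IsBddSemimartingale P ℱ X a g K D G) (t : ℝ≥0) (ω : Ω) :
    |martingalePart X a t ω| ≤ K + K + D * t := by
  have h1 := S.bdd_a.abs_integral_le ω t.coe_nonneg
  have h2 := (S.bdd_X.increment 0).bdd t ω
  rw [sub_zero] at h1
  exact (abs_sub _ _).trans (add_le_add h2 h1)

theorem martingale_martingalePart (S : IsBddSemimartingale P ℱ X a g K D G) :
    Martingale (martingalePart X a) ℱ P := S.martingale

theorem integrable_martingalePart_mul [IsFiniteMeasure P]
    (S : IsBddSemimartingale P ℱ X a g K D G) (s t : ℝ≥0) :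
    Integrable (fun ω => martingalePart X a s ω * martingalePart X a t ω) P :=
  (S.martingale_martingalePart.integrable t).bdd_mul
    (S.martingale_martingalePart.integrable s).aestronglyMeasurable
    (ae_of_all _ (S.abs_martingalePart_le s))

/-- `E M_t² ≤ 2 E ∫_0^t g_s ds`. -/
theorem integral_martingalePart_sq_le [IsProbabilityMeasure P]
    (S : IsBddSemimartingale P ℱ X a g K D G) (T : ℝ≥0) :
    ∫ ω, martingalePart X a T ω ^ 2 ∂P ≤ 2 * ∫ ω, (∫ u in (0 : ℝ)..T, g u.toNNReal ω) ∂P := by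
  set F : ℝ≥0 → ℝ := fun t => ∫ ω, martingalePart X a t ω ^ 2 ∂P
    - 2 * ∫ ω, (∫ u in (0 : ℝ)..t, g u.toNNReal ω) ∂P with hF
  have hC : 0 ≤ 4 * K * D + G := by
    obtain ⟨ω⟩ := nonempty_of_isProbabilityMeasure P
    have hK := (abs_nonneg _).trans (S.bdd_X.bdd 0 ω)
    have hD := (abs_nonneg _).trans (S.bdd_a.bdd 0 ω)
    have hG := (abs_nonneg _).trans (S.bdd_g.bdd 0 ω)
    positivity
  suffices hle : F T ≤ 0 by simp only [hF] at hle; linarith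
  refine le_zero_of_increment_le (by simp [hF, martingalePart])
    (A := 2 * (4 * K * D + G) + 2 * D ^ 2) (B := 2 * D ^ 2)
    (fun l hl s t hst => ?_) T
  have hst' : (s : ℝ) ≤ t := hst
  have hMs := (S.martingale_martingalePart.stronglyMeasurable s)
  have horth := integral_mul_martingale S.martingale_martingalePart hst hMs
    (S.abs_martingalePart_le s)
  have itt := S.integrable_martingalePart_mul t t
  have iss := S.integrable_martingalePart_mul s s
  have ist := S.integrable_martingalePart_mul s t
  -- Orthogonality of martingale increments.
  have h1 : ∫ ω, (martingalePart X a t ω - martingalePart X a s ω) ^ 2 ∂P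
      = ∫ ω, martingalePart X a t ω ^ 2 ∂P - ∫ ω, martingalePart X a s ω ^ 2 ∂P := by
    have e : ∀ ω, (martingalePart X a t ω - martingalePart X a s ω) ^ 2
        = martingalePart X a t ω * martingalePart X a t ω
          - martingalePart X a s ω * martingalePart X a s ω
          - 2 * (martingalePart X a s ω * martingalePart X a t ω
            - martingalePart X a s ω * martingalePart X a s ω) := fun ω => by ring
    simp only [e]
    rw [(integral_sub_sub_two_mul_sub itt iss ist iss).2, horth]
    simp [sq]
  -- The increments of the martingale and of `X` differ by an integral of size `D (t - s)`. The
  -- inequality `(x - y)² ≤ 2 x² + 2 y²` is the origin of the factor two in the result.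
  have h2 : ∫ ω, (martingalePart X a t ω - martingalePart X a s ω) ^ 2 ∂P
      ≤ 2 * ∫ ω, (X t ω - X s ω) ^ 2 ∂P + 2 * D ^ 2 * (t - s : ℝ) ^ 2 := by
    have isq := (S.bdd_increment_sq s).integrable P t
    have hi : Integrable (fun ω => (martingalePart X a t ω - martingalePart X a s ω) ^ 2) P := by
      refine ((itt.sub iss).sub ((ist.sub iss).const_mul 2)).congr (ae_of_all _ fun ω => ?_)
      simp only [Pi.sub_apply]; ring
    have := integral_mono hi ((isq.const_mul 2).add (integrable_const (2 * D ^ 2 * (t - s : ℝ) ^ 2)))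
      fun ω => ?_
    · change _ ≤ ∫ ω, (2 * (X t ω - X s ω) ^ 2 + 2 * D ^ 2 * (t - s : ℝ) ^ 2) ∂P at this
      rw [integral_add (isq.const_mul 2) (integrable_const _), integral_const_mul] at this
      simpa using this
    · have e1 := S.bdd_a.integral_interval_sub ω s t
      have e2 := S.bdd_a.abs_integral_le ω hst'
      have e3 : martingalePart X a t ω - martingalePart X a s ω
          = (X t ω - X s ω) - ∫ u in (s : ℝ)..t, a u.toNNReal ω := by
        rw [← e1]; unfold martingalePart; ring
      have e4 : (∫ u in (s : ℝ)..t, a u.toNNReal ω) ^ 2 ≤ (D * (t - s)) ^ 2 := by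
        rw [← sq_abs]
        exact pow_le_pow_left₀ (abs_nonneg _) e2 2
      simp only [Pi.add_apply, e3]
      nlinarith [sq_nonneg ((X t ω - X s ω) + ∫ u in (s : ℝ)..t, a u.toNNReal ω)]
  have h3 := S.integral_increment_sq_le' hst hl
  have h4 : ∫ ω, (∫ u in (0 : ℝ)..t, g u.toNNReal ω) ∂P
      - ∫ ω, (∫ u in (0 : ℝ)..s, g u.toNNReal ω) ∂P
      = ∫ ω, (∫ u in (s : ℝ)..t, g u.toNNReal ω) ∂P := by
    rw [← integral_sub (S.bdd_g.integrable_integral P t.coe_nonneg)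
      (S.bdd_g.integrable_integral P s.coe_nonneg)]
    simp only [S.bdd_g.integral_interval_sub]
  have h5 : (l * ((4 * K * D + G) * (t - s)) + D ^ 2 / l) * (t - s : ℝ)
      = (4 * K * D + G) * l * (t - s : ℝ) ^ 2 + D ^ 2 * (t - s) / l := by ring
  rw [h5] at h3
  have h6 : 0 ≤ D ^ 2 * l * (t - s : ℝ) ^ 2 := by positivity
  have h7 : 0 ≤ (4 * K * D + G) * (t - s : ℝ) ^ 2 := by positivity
  have h8 : (2 * (4 * K * D + G) + 2 * D ^ 2) * (l + 1) * (t - s : ℝ) ^ 2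
      + 2 * D ^ 2 * (t - s) / l = 2 * ((4 * K * D + G) * l * (t - s : ℝ) ^ 2
        + D ^ 2 * (t - s) / l) + 2 * ((4 * K * D + G) * (t - s : ℝ) ^ 2)
        + 2 * (D ^ 2 * l * (t - s : ℝ) ^ 2) + 2 * D ^ 2 * (t - s : ℝ) ^ 2 := by ring
  rw [h8]
  simp only [hF]
  linarith

end IsBddSemimartingale

end Paths

section Paths

variable {Ω : Type*} [mΩ : MeasurableSpace Ω]

/-! ## Maximal inequality in continuous time -/

/-- The filtration `k ↦ ℱ (τ k)` along a monotone sequence of times. -/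
def sampledFiltration (ℱ : Filtration ℝ≥0 mΩ) (τ : ℕ → ℝ≥0) (hτ : Monotone τ) :
    Filtration ℕ mΩ where
  seq k := ℱ (τ k)
  mono' _ _ h := ℱ.mono (hτ h)
  le' k := ℱ.le (τ k)

theorem submartingale_sq_sampled {P : Measure Ω} [IsFiniteMeasure P] {ℱ : Filtration ℝ≥0 mΩ}
    {M : ℝ≥0 → Ω → ℝ} (hM : Martingale M ℱ P) (hsq : ∀ t, Integrable (fun ω => M t ω ^ 2) P)
    (τ : ℕ → ℝ≥0) (hτ : Monotone τ) :
    Submartingale (fun k ω => M (τ k) ω ^ 2) (sampledFiltration ℱ τ hτ) P := by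
  refine ⟨fun k => (hM.stronglyMeasurable (τ k)).pow 2, fun i j hij => ?_, fun k => hsq _⟩
  have h1 := (even_two.convexOn_pow (𝕜 := ℝ)).map_condExp_le_of_finiteDimensional
    (ℱ.le (τ i)) (hM.integrable (τ j)) (hsq (τ j))
  filter_upwards [h1, hM.condExp_ae_eq (hτ hij)] with ω h2 h3
  rw [Function.comp_apply, h3] at h2
  exact h2

theorem measure_exists_grid_le {P : Measure Ω} [IsFiniteMeasure P] {ℱ : Filtration ℝ≥0 mΩ}
    {M : ℝ≥0 → Ω → ℝ} (hM : Martingale M ℱ P) (hsq : ∀ t, Integrable (fun ω => M t ω ^ 2) P)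
    (τ : ℕ → ℝ≥0) (hτ : Monotone τ) {l : ℝ} (hl : 0 < l) (n : ℕ) :
    P {ω | ∃ k ≤ n, l < |M (τ k) ω|}
      ≤ ENNReal.ofReal ((∫ ω, M (τ n) ω ^ 2 ∂P) / l ^ 2) := by
  have h := maximal_ineq (submartingale_sq_sampled hM hsq τ hτ) (fun k ω => sq_nonneg _)
    (ε := (l ^ 2).toNNReal) n
  have hl2 : (0 : ℝ) < l ^ 2 := by positivity
  rw [ENNReal.ofReal_div_of_pos hl2, ENNReal.le_div_iff_mul_le (Or.inl (by simpa using hl.ne'))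
    (Or.inl ENNReal.ofReal_ne_top), mul_comm]
  refine le_trans ?_ (h.trans (ENNReal.ofReal_le_ofReal
    (setIntegral_le_integral (hsq _) (ae_of_all _ fun ω => sq_nonneg _))))
  refine mul_le_mul_right (measure_mono ?_) _
  rintro ω ⟨k, hk, hlk⟩
  rw [Set.mem_ofPred_eq, Real.coe_toNNReal _ hl2.le]
  refine le_trans ?_ (Finset.le_sup' (fun k => M (τ k) ω ^ 2) (Finset.mem_range.2
    (Nat.lt_succ_of_le hk)))
  rw [← sq_abs (M (τ k) ω)]
  exact pow_le_pow_left₀ hl.le hlk.le 2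

/-- The dyadic grid of `[0, T]`. -/
def dyadicTime (T : ℝ≥0) (n k : ℕ) : ℝ≥0 := T * k / 2 ^ n

theorem monotone_dyadicTime (T : ℝ≥0) (n : ℕ) : Monotone (dyadicTime T n) := by
  intro i j h
  unfold dyadicTime
  gcongr

theorem dyadicTime_last (T : ℝ≥0) (n : ℕ) : dyadicTime T n (2 ^ n) = T := by
  unfold dyadicTime
  push_cast
  exact mul_div_cancel_right₀ _ (by positivity)

theorem dyadicTime_succ (T : ℝ≥0) (n k : ℕ) : dyadicTime T (n + 1) (2 * k) = dyadicTime T n k := by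
  unfold dyadicTime
  rw [pow_succ]
  push_cast
  field_simp

/-- The floor plus one gives grid points strictly to the right of `t`, as right limits require, and
still at most `T` because `t < T`. -/
theorem exists_dyadicTime_tendsto {T t : ℝ≥0} (ht : t < T) :
    ∃ k : ℕ → ℕ, (∀ n, k n ≤ 2 ^ n) ∧
      Tendsto (fun n => dyadicTime T n (k n)) atTop (𝓝[>] t) := by
  have hT : 0 < T := (zero_le).trans_lt ht
  refine ⟨fun n => ⌊t / T * 2 ^ n⌋₊ + 1, fun n => ?_, tendsto_nhdsWithin_iff.2 ⟨?_, ?_⟩⟩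
  · have h1 : t / T * 2 ^ n < ((2 ^ n : ℕ) : ℝ≥0) := by
      push_cast
      calc t / T * 2 ^ n < 1 * 2 ^ n := by
            gcongr
            exact (div_lt_one hT).2 ht
        _ = 2 ^ n := one_mul _
    exact (Nat.floor_lt zero_le).2 h1
  · have hub : ∀ n : ℕ, dyadicTime T n (⌊t / T * 2 ^ n⌋₊ + 1) ≤ t + T * (1 / 2) ^ n := by
      intro n
      have h1 : ((⌊t / T * 2 ^ n⌋₊ : ℕ) : ℝ≥0) ≤ t / T * 2 ^ n := Nat.floor_le zero_le
      unfold dyadicTime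
      push_cast
      calc T * ((⌊t / T * 2 ^ n⌋₊ : ℝ≥0) + 1) / 2 ^ n ≤ T * (t / T * 2 ^ n + 1) / 2 ^ n := by gcongr
        _ = t + T * (1 / 2) ^ n := by
            rw [div_pow, one_pow]
            field_simp
    have hlb : ∀ n : ℕ, t ≤ dyadicTime T n (⌊t / T * 2 ^ n⌋₊ + 1) := by
      intro n
      have h1 := (Nat.lt_floor_add_one (t / T * 2 ^ n)).le
      unfold dyadicTime
      push_cast
      calc t = T * (t / T * 2 ^ n) / 2 ^ n := by field_simp
        _ ≤ _ := by gcongr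
    refine tendsto_of_tendsto_of_tendsto_of_le_of_le tendsto_const_nhds ?_ hlb hub
    have : Tendsto (fun n : ℕ => t + T * (1 / 2 : ℝ≥0) ^ n) atTop (𝓝 (t + T * 0)) :=
      ((NNReal.tendsto_pow_atTop_nhds_zero_of_lt_one
        ((div_lt_one two_pos).2 one_lt_two)).const_mul T).const_add t
    simpa using this
  · refine Eventually.of_forall fun n => ?_
    have h1 := Nat.lt_floor_add_one (t / T * 2 ^ n)
    rw [Set.mem_Ioi]
    unfold dyadicTime
    push_cast
    calc t = T * (t / T * 2 ^ n) / 2 ^ n := by field_simp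
      _ < _ := by gcongr

/-- Maximal inequality for right-continuous square integrable martingales. -/
theorem measure_exists_abs_gt_le {P : Measure Ω} [IsFiniteMeasure P] {ℱ : Filtration ℝ≥0 mΩ}
    {M : ℝ≥0 → Ω → ℝ} (hM : Martingale M ℱ P) (hsq : ∀ t, Integrable (fun ω => M t ω ^ 2) P)
    (hrc : ∀ ω t, Tendsto (fun s => M s ω) (𝓝[>] t) (𝓝 (M t ω))) {l : ℝ} (hl : 0 < l)
    (T : ℝ≥0) :
    P {ω | ∃ t ≤ T, l < |M t ω|} ≤ ENNReal.ofReal ((∫ ω, M T ω ^ 2 ∂P) / l ^ 2) := by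
  set A : ℕ → Set Ω := fun n => {ω | ∃ k ≤ 2 ^ n, l < |M (dyadicTime T n k) ω|} with hA
  have hmono : Monotone A := by
    refine monotone_nat_of_le_succ fun n ω hω => ?_
    obtain ⟨k, hk, h⟩ := hω
    refine ⟨2 * k, by rw [pow_succ]; omega, ?_⟩
    rwa [dyadicTime_succ]
  -- Strict exceedance is an open condition, so right continuity transfers it to a dyadic time; the
  -- end point `T` is itself on the grid.
  have hsub : {ω | ∃ t ≤ T, l < |M t ω|} ⊆ ⋃ n, A n := by
    rintro ω ⟨t, ht, h⟩
    rw [Set.mem_iUnion]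
    rcases ht.eq_or_lt with rfl | ht
    · exact ⟨0, 2 ^ 0, le_rfl, by rwa [dyadicTime_last]⟩
    · obtain ⟨k, hk, hlim⟩ := exists_dyadicTime_tendsto ht
      have h1 := ((hrc ω t).comp hlim).abs.eventually (lt_mem_nhds h)
      obtain ⟨n, hn⟩ := h1.exists
      exact ⟨n, k n, hk n, hn⟩
  refine (measure_mono hsub).trans ?_
  rw [hmono.measure_iUnion]
  refine iSup_le fun n => ?_
  have := measure_exists_grid_le hM hsq (dyadicTime T n) (monotone_dyadicTime T n) hl (2 ^ n)
  rwa [dyadicTime_last] at this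

/-! ## Last exit argument -/

/-- If the drift is nonpositive above the level `L`, then `x` exceeds `L` by at most twice the
fluctuation of its martingale part. -/
theorem le_add_of_drift_nonpos {x m : ℝ≥0 → ℝ} {a : ℝ → ℝ} {D L l : ℝ} {T : ℝ≥0}
    (ha : ∀ s t, IntervalIntegrable a volume s t) (haD : ∀ u, |a u| ≤ D)
    (hx : ∀ s t : ℝ≥0, s ≤ t → x t - x s ≤ m t - m s + ∫ u in (s : ℝ)..t, a u)
    (hdrift : ∀ u : ℝ, L ≤ x u.toNNReal → a u ≤ 0) (h0 : x 0 ≤ L)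
    (hm : ∀ t ≤ T, |m t| ≤ l) {t : ℝ≥0} (ht : t ≤ T) : x t ≤ L + 2 * l := by
  -- `r` is the last exit time from `{x ≤ L}` before `t`; on `(r, t]` the drift is nonpositive.
  set S : Set ℝ≥0 := {s | s ≤ t ∧ x s ≤ L} with hS
  have hne : S.Nonempty := ⟨0, zero_le, h0⟩
  have hbd : BddAbove S := ⟨t, fun s hs => hs.1⟩
  set r := sSup S with hr
  have hrt : r ≤ t := csSup_le hne fun s hs => hs.1
  have hrt' : (r : ℝ) ≤ t := hrt
  have hneg : ∫ u in (r : ℝ)..t, a u ≤ 0 := by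
    rw [intervalIntegral.integral_of_le hrt']
    refine setIntegral_nonpos measurableSet_Ioc fun u hu => hdrift u ?_
    by_contra hcon
    have hu0 : 0 ≤ u := r.coe_nonneg.trans hu.1.le
    have hmem : u.toNNReal ∈ S := ⟨Real.toNNReal_le_iff_le_coe.2 hu.2, (not_le.1 hcon).le⟩
    have h1 := le_csSup hbd hmem
    have h2 : u ≤ r := (Real.toNNReal_le_iff_le_coe.1 h1)
    exact absurd hu.1 (not_lt.2 h2)
  have hD : 0 ≤ D := (abs_nonneg _).trans (haD 0)
  refine le_of_forall_pos_le_add fun ε hε => ?_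
  -- The supremum need not be attained, and no regularity of `x` is assumed. A time `s` of `S` close
  -- to `r` is used instead, with drift at most `ε` on `[s, r]`; `D + 1` avoids division by zero.
  obtain ⟨s, hs, hsr⟩ : ∃ s ∈ S, (r : ℝ) - ε / (D + 1) ≤ s := by
    by_contra! hcon
    have hlt : 0 < ε / (D + 1) := by positivity
    have h1 : r ≤ ((r : ℝ) - ε / (D + 1)).toNNReal :=
      csSup_le hne fun s hs => NNReal.le_toNNReal_of_coe_le (hcon s hs).le
    have h2 : (0 : ℝ) ≤ r - ε / (D + 1) := by
      obtain ⟨s, hs⟩ := hne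
      exact s.coe_nonneg.trans (hcon s hs).le
    have h3 : (r : ℝ) ≤ ((r : ℝ) - ε / (D + 1)).toNNReal := h1
    rw [Real.coe_toNNReal _ h2] at h3
    linarith
  have hsr' : (s : ℝ) ≤ r := le_csSup hbd hs
  have h1 := hx s t hs.1
  have h2 := intervalIntegral.integral_add_adjacent_intervals (ha s r) (ha r t)
  have h3 := intervalIntegral.norm_integral_le_of_norm_le_const (a := (s : ℝ)) (b := r)
    (f := a) (C := D) fun u _ => haD u
  rw [abs_of_nonneg (by linarith : 0 ≤ (r : ℝ) - s), Real.norm_eq_abs] at h3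
  have h4 : D * ((r : ℝ) - s) ≤ ε := by
    calc D * ((r : ℝ) - s) ≤ (D + 1) * (ε / (D + 1)) := by
          gcongr <;> linarith
      _ = ε := by field_simp
  have h5 := (abs_le.1 (hm t ht)).2
  have h6 := (abs_le.1 (hm s (hs.1.trans ht))).1
  have h7 := hs.2
  linarith [le_abs_self (∫ u in (s : ℝ)..r, a u)]

namespace IsBddSemimartingale

variable {P : Measure Ω} {ℱ : Filtration ℝ≥0 mΩ} {X a g : ℝ≥0 → Ω → ℝ} {K D G : ℝ}

theorem martingalePart_tendsto (S : IsBddSemimartingale P ℱ X a g K D G)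
    (hrc : ∀ ω t, Tendsto (fun s => X s ω) (𝓝[>] t) (𝓝 (X t ω))) (ω : Ω) (t : ℝ≥0) :
    Tendsto (fun s => martingalePart X a s ω) (𝓝[>] t) (𝓝 (martingalePart X a t ω)) := by
  unfold martingalePart
  refine ((hrc ω t).sub_const _).sub ?_
  have hc : Continuous fun s : ℝ => ∫ u in (0 : ℝ)..s, a u.toNNReal ω :=
    intervalIntegral.continuous_primitive (fun s t => S.bdd_a.intervalIntegrable ω s t) 0
  exact ((hc.comp NNReal.continuous_coe).tendsto t).mono_left nhdsWithin_le_nhds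

/-- Concentration: a semimartingale whose drift is nonpositive above the level `L₀`. -/
theorem measure_exists_gt_le [IsProbabilityMeasure P] (S : IsBddSemimartingale P ℱ X a g K D G)
    (hrc : ∀ ω t, Tendsto (fun s => X s ω) (𝓝[>] t) (𝓝 (X t ω))) {L₀ : ℝ}
    (hdrift : ∀ t ω, L₀ ≤ X t ω → a t ω ≤ 0) {R : ℝ} (T : ℝ≥0)
    (hg : ∀ t ≤ T, ∫ ω, g t ω ∂P ≤ R) {ε : ℝ} (hε : 0 < ε) :
    P {ω | ∃ t ≤ T, max (X 0 ω) L₀ + ε < X t ω}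
      ≤ ENNReal.ofReal (8 * R * T / ε ^ 2) := by
  have hsub : {ω | ∃ t ≤ T, max (X 0 ω) L₀ + ε < X t ω}
      ⊆ {ω | ∃ t ≤ T, ε / 2 < |martingalePart X a t ω|} := by
    intro ω hω
    by_contra hcon
    simp only [Set.mem_ofPred_eq, not_exists, not_and, not_lt] at hcon
    obtain ⟨t, ht, hlt⟩ := hω
    have := le_add_of_drift_nonpos (x := fun t => X t ω) (m := fun t => martingalePart X a t ω)
      (a := fun u => a u.toNNReal ω) (L := max (X 0 ω) L₀)
      (fun s t => S.bdd_a.intervalIntegrable ω s t) (fun u => S.bdd_a.bdd _ ω)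
      (fun s t _ => by
        rw [← S.bdd_a.integral_interval_sub]
        simp only [martingalePart]; linarith)
      (fun u hu => hdrift _ ω ((le_max_right _ _).trans hu)) (le_max_left _ _)
      (fun t ht => hcon t ht) ht
    linarith
  refine (measure_mono hsub).trans ((measure_exists_abs_gt_le S.martingale_martingalePart
    (fun t => ?_) (S.martingalePart_tendsto hrc) (by positivity) T).trans
    (ENNReal.ofReal_le_ofReal ?_))
  · simpa only [sq] using S.integrable_martingalePart_mul t t
  · have h1 := S.integral_martingalePart_sq_le T
    have h2 := S.bdd_g.integral_integral_le P (zero_le : 0 ≤ T) fun u _ hu => hg u hu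
    simp only [NNReal.coe_zero, sub_zero] at h2
    -- The `8` is the `4` from `(ε / 2) ^ 2` times the factor two of the second moment bound.
    rw [div_pow, div_le_div_iff₀ (by positivity) (by positivity)]
    have : 0 < ε ^ 2 := by positivity
    nlinarith

end IsBddSemimartingale

/-- Uniform bound for the expectation of a process with drift at most `κ (C - c X)`. -/
theorem expectation_le_of_drift {P : Measure Ω} [IsProbabilityMeasure P] {ℱ : Filtration ℝ≥0 mΩ}
    {X a : ℝ≥0 → Ω → ℝ} {K D : ℝ} (hX : IsBddProcess X K) (ha : IsBddProcess a D)
    (hM : Martingale (fun (t : ℝ≥0) ω => X t ω - X 0 ω - ∫ s in (0 : ℝ)..t, a s.toNNReal ω) ℱ P)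
    {κ C c : ℝ} (hκ : 0 ≤ κ) (hc : 0 < c) (hdrift : ∀ t ω, a t ω ≤ κ * (C - c * X t ω))
    (t : ℝ≥0) : ∫ ω, X t ω ∂P ≤ max (∫ ω, X 0 ω ∂P) (C / c) := by
  -- The last exit argument for the deterministic function `t ↦ E X_t`, with zero fluctuation,
  -- replaces a Gronwall estimate.
  have h := le_add_of_drift_nonpos (x := fun t => ∫ ω, X t ω ∂P) (m := fun _ => 0)
    (a := fun u => ∫ ω, a u.toNNReal ω ∂P) (D := D) (L := max (∫ ω, X 0 ω ∂P) (C / c)) (l := 0)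
    (T := t) (fun s t => ?_) (fun u => ha.abs_expectation_le P _) (fun s t hst => ?_)
    (fun u hu => ?_) (le_max_left _ _) (fun _ _ => by simp) le_rfl
  · simpa using h
  · constructor <;> exact Integrable.of_bound (ha.measurable_expectation P).aestronglyMeasurable D
      (ae_of_all _ fun u => ha.abs_expectation_le P _)
  · have hst' : (s : ℝ) ≤ t := hst
    have h1 := integral_martingale_eq hM hst
    have h2 : ∀ r : ℝ≥0, ∫ ω, (X r ω - X 0 ω - ∫ s in (0 : ℝ)..r, a s.toNNReal ω) ∂P
        = ∫ ω, X r ω ∂P - ∫ ω, X 0 ω ∂P - ∫ ω, (∫ s in (0 : ℝ)..r, a s.toNNReal ω) ∂P := by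
      intro r
      rw [← integral_sub (hX.integrable P r) (hX.integrable P 0)]
      exact integral_sub ((hX.integrable P r).sub (hX.integrable P 0))
        (ha.integrable_integral P r.coe_nonneg)
    rw [h2, h2] at h1
    have h3 : ∫ ω, (∫ u in (0 : ℝ)..t, a u.toNNReal ω) ∂P
        - ∫ ω, (∫ u in (0 : ℝ)..s, a u.toNNReal ω) ∂P
        = ∫ u in (s : ℝ)..t, (∫ ω, a u.toNNReal ω ∂P) := by
      rw [← integral_sub (ha.integrable_integral P t.coe_nonneg)
        (ha.integrable_integral P s.coe_nonneg), ← ha.integral_integral_swap P hst']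
      simp only [ha.integral_interval_sub]
    linarith
  · have h1 : ∫ ω, a u.toNNReal ω ∂P ≤ ∫ ω, κ * (C - c * X u.toNNReal ω) ∂P :=
      integral_mono (ha.integrable P _) (((integrable_const C).sub
        ((hX.integrable P _).const_mul c)).const_mul κ) (hdrift _)
    rw [integral_const_mul, integral_sub (integrable_const C) ((hX.integrable P _).const_mul c),
      integral_const_mul] at h1
    simp only [integral_const, probReal_univ, one_smul] at h1
    have h2 := (div_le_iff₀ hc).1 ((le_max_right _ _).trans hu)
    exact h1.trans (mul_nonpos_of_nonneg_of_nonpos hκ (by linarith))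

/-! ## Joint measurability of right-continuous processes -/

/-- The first point of the grid `(n+1)⁻¹ ℕ` beyond `t`. -/
def upperGrid (n : ℕ) (t : ℝ≥0) : ℝ≥0 := ((⌊t * (n + 1)⌋₊ : ℝ≥0) + 1) / (n + 1)

theorem lt_upperGrid (n : ℕ) (t : ℝ≥0) : t < upperGrid n t := by
  rw [upperGrid, lt_div_iff₀ (by positivity)]
  exact Nat.lt_floor_add_one _

theorem upperGrid_le (n : ℕ) (t : ℝ≥0) : upperGrid n t ≤ t + 1 / (n + 1) := by
  have h1 : ((⌊t * (n + 1)⌋₊ : ℕ) : ℝ≥0) ≤ t * (n + 1) := Nat.floor_le zero_le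
  calc upperGrid n t ≤ (t * (n + 1) + 1) / (n + 1) := by unfold upperGrid; gcongr
    _ = t + 1 / (n + 1) := by field_simp

theorem tendsto_upperGrid (t : ℝ≥0) : Tendsto (fun n => upperGrid n t) atTop (𝓝[>] t) := by
  refine tendsto_nhdsWithin_iff.2 ⟨?_, Eventually.of_forall fun n => lt_upperGrid n t⟩
  refine tendsto_of_tendsto_of_tendsto_of_le_of_le tendsto_const_nhds ?_
    (fun n => (lt_upperGrid n t).le) (fun n => upperGrid_le n t)
  simpa using (tendsto_one_div_add_atTop_nhds_zero_nat (𝕜 := ℝ≥0)).const_add t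

theorem measurable_uncurry_nat {g : ℕ → Ω → ℝ} (hg : ∀ n, Measurable (g n)) :
    Measurable fun x : ℕ × Ω => g x.1 x.2 := by
  have : Measurable (Function.uncurry g) := measurable_from_prod_countable_right hg
  exact this

theorem measurable_upperGrid (n : ℕ) {f : ℝ≥0 → Ω → ℝ} (hf : ∀ t, Measurable (f t)) :
    Measurable fun x : ℝ≥0 × Ω => f (upperGrid n x.1) x.2 := by
  have h1 := measurable_uncurry_nat fun k : ℕ => hf (((k : ℝ≥0) + 1) / (n + 1))
  have h2 : Measurable fun x : ℝ≥0 × Ω => (⌊x.1 * (n + 1)⌋₊, x.2) :=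
    (Nat.measurable_floor.comp (measurable_fst.mul_const _)).prodMk measurable_snd
  have h3 := h1.comp h2
  simpa only [Function.comp_def, upperGrid] using h3

/-- The process is the pointwise limit of its values at the next grid point, which are jointly
measurable as only countably many times occur. -/
theorem measurable_uncurry_of_rightContinuous {f : ℝ≥0 → Ω → ℝ} (hf : ∀ t, Measurable (f t))
    (hrc : ∀ ω t, Tendsto (fun s => f s ω) (𝓝[>] t) (𝓝 (f t ω))) :
    Measurable fun x : ℝ≥0 × Ω => f x.1 x.2 :=
  measurable_of_tendsto_metrizable (fun n => measurable_upperGrid n hf)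
    (tendsto_pi_nhds.2 fun x => (hrc x.2 x.1).comp (tendsto_upperGrid x.1))

end Paths

/-! ## Measurability of integrals against random measures -/

section RandomMeasure

variable {α E : Type*} [MeasurableSpace α] [MeasurableSpace E] {κ : α → Measure E}

theorem measurable_integral_randomMeasure (hκ : Measurable κ)
    (hp : ∀ a, IsProbabilityMeasure (κ a)) {f : E → ℝ} (hf : Measurable f) :
    Measurable fun a => ∫ v, f v ∂κ a :=
  have : IsMarkovKernel (⟨κ, hκ⟩ : Kernel α E) := ⟨hp⟩
  (hf.stronglyMeasurable.integral_kernel (κ := ⟨κ, hκ⟩)).measurable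

theorem measurable_integral_integral_randomMeasure (hκ : Measurable κ)
    (hp : ∀ a, IsProbabilityMeasure (κ a)) {f : E → E → ℝ}
    (hf : Measurable fun x : E × E => f x.1 x.2) :
    Measurable fun a => ∫ v, ∫ w, f v w ∂κ a ∂κ a := by
  have hK : IsMarkovKernel (⟨κ, hκ⟩ : Kernel α E) := ⟨hp⟩
  have h1 : StronglyMeasurable fun x : (α × E) × E => f x.1.2 x.2 :=
    (hf.comp ((measurable_snd.comp measurable_fst).prodMk measurable_snd)).stronglyMeasurable
  have h2 := h1.integral_kernel_prod_right'
    (κ := (⟨κ, hκ⟩ : Kernel α E).comap Prod.fst measurable_fst)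
  exact (h2.integral_kernel_prod_right' (κ := ⟨κ, hκ⟩)).measurable

end RandomMeasure

/-! ## The moments of a Kac process -/

section Paths

variable {Ω : Type*} [mΩ : MeasurableSpace Ω] {P : Measure Ω} {ℱ : Filtration ℝ≥0 mΩ}
  {B : Vel d → Vel d → ℝ} {μ : ℝ≥0 → Ω → Measure (Vel d)}

namespace IsKacProcess

theorem tendsto_of_isLipschitz (h : IsKacProcess P ℱ N B μ) {F : Measure (Vel d) → ℝ}
    (hF : IsLipschitzOnKacSphere N F) (ω : Ω) (t : ℝ≥0) :
    Tendsto (fun s => F (μ s ω)) (𝓝[>] t) (𝓝 (F (μ t ω))) :=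
  hF.tendsto (fun s => h.mem s ω) (h.mem t ω) (h.right_cont ω t)

theorem isProbabilityMeasure (h : IsKacProcess P ℱ N B μ) (t : ℝ≥0) (ω : Ω) :
    IsProbabilityMeasure (μ t ω) :=
  kacSphere_isProbabilityMeasure (h.mem t ω)

theorem measurable_apply (h : IsKacProcess P ℱ N B μ) (t : ℝ≥0) : Measurable (μ t) :=
  (h.adapted t).mono (ℱ.le t) le_rfl

theorem measurable_uncurry_integral (h : IsKacProcess P ℱ N B μ) {f : Vel d → ℝ} {L : ℝ≥0}
    (hf : LipschitzWith L f) : Measurable fun x : ℝ≥0 × Ω => ∫ v, f v ∂(μ x.1 x.2) := by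
  have hm : Measurable f := hf.continuous.measurable
  refine measurable_uncurry_of_rightContinuous (f := fun t ω => ∫ v, f v ∂(μ t ω))
    (fun t => measurable_integral_randomMeasure (h.measurable_apply t)
      (h.isProbabilityMeasure t) hm) fun ω t => ?_
  exact h.tendsto_of_isLipschitz (F := fun m => ∫ v, f v ∂m)
    (isLipschitzOnKacSphere_integral hm fun v w _ _ => by
      simpa [dist_eq_norm, Real.dist_eq] using hf.dist_le_mul v w) ω t

/-- Right continuity in `w₁` controls integrals of Lipschitz functions only. The mass of a closed
set is the limit of integrals of its Lipschitz thickened indicators, and closed sets form a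
generating π-system. Joint measurability is what allows exchanging time integrals and expectations.
-/
theorem measurable_uncurry (h : IsKacProcess P ℱ N B μ) :
    Measurable fun x : ℝ≥0 × Ω => μ x.1 x.2 := by
  have := fun x : ℝ≥0 × Ω => h.isProbabilityMeasure x.1 x.2
  refine .measure_of_isPiSystem_of_isProbabilityMeasure
    (BorelSpace.measurable_eq.trans borel_eq_generateFrom_isClosed) isPiSystem_isClosed
    fun F hF => ?_
  have hpos : ∀ n : ℕ, (0 : ℝ) < 1 / (n + 1) := fun n => by positivity
  have hmeas : Measurable fun x : ℝ≥0 × Ω => (μ x.1 x.2).real F :=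
    measurable_of_tendsto_metrizable (f := fun (n : ℕ) (x : ℝ≥0 × Ω) =>
      ∫ v, (thickenedIndicator (hpos n) F v : ℝ) ∂(μ x.1 x.2))
      (fun n => h.measurable_uncurry_integral
        ((NNReal.isometry_coe.lipschitz).comp (lipschitzWith_thickenedIndicator (hpos n) F)))
      (tendsto_pi_nhds.2 fun x => tendsto_integral_thickenedIndicator_of_isClosed _ hF hpos
        tendsto_one_div_add_atTop_nhds_zero_nat)
  have e : (fun x : ℝ≥0 × Ω => μ x.1 x.2 F) = fun x => ENNReal.ofReal ((μ x.1 x.2).real F) :=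
    funext fun x => (ofReal_measureReal (measure_ne_top _ _)).symm
  rw [e]
  exact hmeas.ennreal_ofReal

theorem isBddProcess_absMoment (h : IsKacProcess P ℱ N B μ) {p : ℝ} (hp : 0 ≤ p) :
    IsBddProcess (fun t ω => absMoment p (μ t ω)) (√N ^ p) where
  measurable := measurable_integral_randomMeasure h.measurable_uncurry
    (fun x => h.isProbabilityMeasure x.1 x.2) (by fun_prop)
  bdd t ω := by
    rw [abs_of_nonneg (absMoment_nonneg _ _)]
    exact absMoment_le hp (h.mem t ω)

theorem exists_isBddProcess_momentDrift (h : IsKacProcess P ℱ N B μ) {γ p : ℝ} (hγ : 0 ≤ γ)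
    (hp : 1 ≤ p) (hd : d ≠ 0) {k : ℝ → ℝ} (hk : IsAngularKernel d k) :
    ∃ D, IsBddProcess (fun t ω => momentDrift γ k p (μ t ω)) D := by
  obtain ⟨D, hD⟩ := exists_abs_momentDrift_le hγ hp hd N hk
  refine ⟨D, ?_, fun t ω => hD _ (h.mem t ω)⟩
  exact measurable_integral_integral_randomMeasure h.measurable_uncurry
    (fun x => h.isProbabilityMeasure x.1 x.2)
    (measurable_collisionMean γ hk.measurable (measurable_momentJump p))

theorem isBddProcess_momentBracket (h : IsKacProcess P ℱ N B μ) {γ p : ℝ} (hγ : 0 ≤ γ)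
    (hp : 1 ≤ p) {k : ℝ → ℝ} (hk : IsAngularKernel d k) {e : Vel d} (he : ‖e‖ = 1) :
    IsBddProcess (fun t ω => momentBracket N γ k p (μ t ω))
      ((N : ℝ)⁻¹ * (crossSection k e * (8 * p ^ 2 * 2 ^ (2 * p + γ)) * √N ^ (2 * p + γ))) where
  measurable := (measurable_integral_integral_randomMeasure h.measurable_uncurry
    (fun x => h.isProbabilityMeasure x.1 x.2)
    (measurable_collisionMean γ hk.measurable ((measurable_momentJump p).pow_const 2))).const_mul _
  bdd t ω := by
    rw [abs_of_nonneg (momentBracket_nonneg hk _ _ _ _)]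
    refine (momentBracket_le hγ hp hk he (h.mem t ω)).trans ?_
    have := absMoment_le (by linarith : 0 ≤ 2 * p + γ) (h.mem t ω)
    have := hk.crossSection_nonneg e
    gcongr

theorem exists_isBddSemimartingale (h : IsKacProcess P ℱ N B μ) {γ p : ℝ} (hγ : 0 ≤ γ)
    (hp : 1 ≤ p) (hd : d ≠ 0) {k : ℝ → ℝ} (hk : IsAngularKernel d k)
    (hB : ∀ z, ∀ᵐ σ : Dir d ∂(surface d), B z σ = ‖z‖ ^ γ * k (cosAngle z σ)) :
    ∃ K D G, IsBddSemimartingale P ℱ (fun t ω => absMoment p (μ t ω))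
      (fun t ω => momentDrift γ k p (μ t ω)) (fun t ω => momentBracket N γ k p (μ t ω)) K D G := by
  obtain ⟨e, he⟩ : ∃ e : Vel d, ‖e‖ = 1 :=
    ⟨EuclideanSpace.single ⟨0, Nat.pos_of_ne_zero hd⟩ 1, by simp⟩
  obtain ⟨D, hD⟩ := h.exists_isBddProcess_momentDrift hγ hp hd hk
  refine ⟨_, D, _, h.isBddProcess_absMoment (by linarith), hD,
    h.isBddProcess_momentBracket hγ hp hk he, fun t => ?_, ?_, ?_⟩
  · exact (@measurable_integral_randomMeasure Ω (Vel d) (ℱ t) _ (μ t) (h.adapted t)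
      (h.isProbabilityMeasure t) _ (by fun_prop)).stronglyMeasurable
  · have := h.martingale (absMoment p) (isLipschitzOnKacSphere_absMoment hp)
    simpa only [generator_absMoment hB p (h.mem _ _)] using this
  · have := h.martingale (fun m => absMoment p m ^ 2)
      ((isLipschitzOnKacSphere_absMoment hp).sq (K := (√N ^ p).toNNReal) fun m hm => by
        rw [Real.coe_toNNReal _ (by positivity), abs_of_nonneg (absMoment_nonneg _ _)]
        exact absMoment_le (by linarith) hm)
    simpa only [generator_absMoment_sq hk hB hp (h.mem _ _)] using this

end IsKacProcess

end Paths

/-! ## Comparison of `Λ_p` with the moments -/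

theorem one_le_Lam {q : ℝ} (hq : 0 ≤ q) {μ : Measure (Vel d)} (hμ : μ ∈ kacSphere d N) :
    1 ≤ Lam q μ := by
  have := kacSphere_isProbabilityMeasure hμ
  have h := kacSphere_integral_mono hμ (f := fun _ => (1 : ℝ))
    (g := fun v => (1 + ‖v‖ ^ 2) ^ (q / 2)) fun v _ =>
      Real.one_le_rpow (by nlinarith [sq_nonneg ‖v‖]) (by linarith)
  unfold Lam
  simpa using h

theorem absMoment_le_Lam {p q : ℝ} (hp : 0 ≤ p) (hpq : p ≤ q) {μ : Measure (Vel d)}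
    (hμ : μ ∈ kacSphere d N) : absMoment p μ ≤ Lam q μ := by
  refine kacSphere_integral_mono hμ fun v _ => ?_
  have h1 : ‖v‖ ^ p = (‖v‖ ^ 2) ^ (p / 2) := by
    rw [← Real.rpow_natCast, ← Real.rpow_mul (norm_nonneg _)]
    congr 1
    push_cast
    ring
  rw [h1]
  calc (‖v‖ ^ 2) ^ (p / 2) ≤ (1 + ‖v‖ ^ 2) ^ (p / 2) :=
        Real.rpow_le_rpow (by positivity) (by linarith) (by linarith)
    _ ≤ (1 + ‖v‖ ^ 2) ^ (q / 2) :=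
        Real.rpow_le_rpow_of_exponent_le (by nlinarith [sq_nonneg ‖v‖]) (by linarith)

theorem Lam_le {p : ℝ} (hp : 0 ≤ p) {μ : Measure (Vel d)} (hμ : μ ∈ kacSphere d N) :
    Lam p μ ≤ 2 ^ (p / 2) * (1 + absMoment p μ) := by
  have := kacSphere_isProbabilityMeasure hμ
  have hpt : ∀ v : Vel d, (1 + ‖v‖ ^ 2) ^ (p / 2) ≤ 2 ^ (p / 2) * (1 + ‖v‖ ^ p) := by
    intro v
    have h1 : (‖v‖ ^ 2) ^ (p / 2) = ‖v‖ ^ p := by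
      rw [← Real.rpow_natCast, ← Real.rpow_mul (norm_nonneg _)]
      congr 1
      push_cast
      ring
    have h2 : (max 1 (‖v‖ ^ 2)) ^ (p / 2) ≤ 1 + ‖v‖ ^ p := by
      rcases le_total (‖v‖ ^ 2) 1 with h | h
      · rw [max_eq_left h, Real.one_rpow]
        have : 0 ≤ ‖v‖ ^ p := by positivity
        linarith
      · rw [max_eq_right h, h1]
        linarith
    calc (1 + ‖v‖ ^ 2) ^ (p / 2) ≤ (2 * max 1 (‖v‖ ^ 2)) ^ (p / 2) :=
          Real.rpow_le_rpow (by positivity)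
            (by linarith [le_max_left 1 (‖v‖ ^ 2), le_max_right 1 (‖v‖ ^ 2)]) (by linarith)
      _ = 2 ^ (p / 2) * (max 1 (‖v‖ ^ 2)) ^ (p / 2) := Real.mul_rpow (by norm_num) (by positivity)
      _ ≤ 2 ^ (p / 2) * (1 + ‖v‖ ^ p) := by gcongr
  refine (kacSphere_integral_mono hμ fun v _ => hpt v).trans (le_of_eq ?_)
  rw [integral_const_mul, integral_add (integrable_const _) (kacSphere_integrable hμ _)]
  simp [absMoment]

theorem absMoment_two {μ : Measure (Vel d)} (hμ : μ ∈ kacSphere d N) : absMoment 2 μ = 1 := by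
  rw [← hμ.1.2.2.2]
  simp [absMoment]

/-! ## Concentration of moments -/

/-- Propagation in mean of a moment of order `p > 2`, uniformly over Kac processes. -/
theorem exists_expectation_absMoment_le (hd : 2 ≤ d) {γ ν : ℝ} (hγ : γ ∈ Set.Icc (0 : ℝ) 1)
    (hν : ν ∈ Set.Ico (0 : ℝ) 1) {b : ℝ → ℝ} (hb : IsAngularProfile ν b) {p : ℝ} (hp : 2 < p) :
    ∃ A : ℝ, 0 < A ∧ ∀ q : ℝ, p ≤ q → ∀ B : Vel d → Vel d → ℝ, IsKacKernel γ b B →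
      ∀ (N : ℕ) (Ω : Type u) [mΩ : MeasurableSpace Ω] (P : Measure Ω) [IsProbabilityMeasure P]
        (ℱ : Filtration ℝ≥0 mΩ) (μ : ℝ≥0 → Ω → Measure (Vel d)), IsKacProcess P ℱ N B μ →
      ∀ a : ℝ, (∀ᵐ ω ∂P, Lam q (μ 0 ω) ≤ a) → ∀ t, ∫ ω, absMoment p (μ t ω) ∂P ≤ A * a := by
  obtain ⟨C, c, hC, hc, hdrift⟩ := exists_momentDrift_le (d := d) hγ hp
  refine ⟨1 + C / c, by positivity, fun q hq B hB N Ω _ P _ ℱ μ h a ha t => ?_⟩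
  obtain ⟨k, hk, -, hBk⟩ := hB.exists_angularKernel hd hν hb
  obtain ⟨e, he⟩ : ∃ e : Vel d, ‖e‖ = 1 := ⟨EuclideanSpace.single ⟨0, by omega⟩ 1, by simp⟩
  obtain ⟨K, D, G, S⟩ := h.exists_isBddSemimartingale (p := p) hγ.1 (by linarith) (by omega) hk hBk
  have h1 := expectation_le_of_drift S.bdd_X S.bdd_a S.martingale (hk.crossSection_nonneg e) hc
    (fun t ω => hdrift N k hk e he _ (h.mem t ω)) t
  -- Since `Λ_q ≥ 1`, the additive constant `C / c` can be absorbed into a multiple of `a`.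
  have ha1 : 1 ≤ a := by
    obtain ⟨ω, hω⟩ := ha.exists
    exact (one_le_Lam (by linarith) (h.mem 0 ω)).trans hω
  have h2 : ∫ ω, absMoment p (μ 0 ω) ∂P ≤ a := by
    have := integral_mono_ae (S.bdd_X.integrable P 0) (integrable_const a)
      (ha.mono fun ω hω => (absMoment_le_Lam (by linarith) hq (h.mem 0 ω)).trans hω)
    simpa using this
  have h3 : 0 ≤ C / c := by positivity
  refine h1.trans (max_le ?_ ?_) <;> nlinarith

/-- Concentration of the moment of order `p`, uniformly over Kac processes. -/
theorem exists_measure_absMoment_gt_le (hd : 2 ≤ d) {γ ν : ℝ} (hγ : γ ∈ Set.Icc (0 : ℝ) 1)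
    (hν : ν ∈ Set.Ico (0 : ℝ) 1) {b : ℝ → ℝ} (hb : IsAngularProfile ν b) {p : ℝ} (hp : 2 ≤ p) :
    ∃ C R : ℝ, 0 < C ∧ 0 < R ∧ ∀ q : ℝ, 2 * p + γ ≤ q →
      ∀ B : Vel d → Vel d → ℝ, IsKacKernel γ b B →
      ∀ (N : ℕ) (Ω : Type u) [mΩ : MeasurableSpace Ω] (P : Measure Ω) [IsProbabilityMeasure P]
        (ℱ : Filtration ℝ≥0 mΩ) (μ : ℝ≥0 → Ω → Measure (Vel d)), IsKacProcess P ℱ N B μ →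
      ∀ a : ℝ, (∀ᵐ ω ∂P, Lam q (μ 0 ω) ≤ a) → ∀ (T : ℝ≥0) (ε : ℝ), 0 < ε →
        P.real {ω | ∃ t ≤ T, max (absMoment p (μ 0 ω)) C + ε < absMoment p (μ t ω)}
          ≤ R * T * a * (N : ℝ)⁻¹ * (ε ^ 2)⁻¹ := by
  obtain ⟨e, he⟩ : ∃ e : Vel d, ‖e‖ = 1 := ⟨EuclideanSpace.single ⟨0, by omega⟩ 1, by simp⟩
  have hγ0 := hγ.1
  have nonneg_of_ae : ∀ q : ℝ, 2 * p + γ ≤ q → ∀ (N : ℕ) (Ω : Type u) [MeasurableSpace Ω]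
      (P : Measure Ω) [IsProbabilityMeasure P] (m : Ω → Measure (Vel d)),
      (∀ ω, m ω ∈ kacSphere d N) → ∀ a : ℝ, (∀ᵐ ω ∂P, Lam q (m ω) ≤ a) → 0 ≤ a := by
    intro q hq N Ω _ P _ m hm a ha
    obtain ⟨ω, hω⟩ := ha.exists
    exact zero_le_one.trans ((one_le_Lam (by linarith) (hm ω)).trans hω)
  -- For `p = 2` the Povzner gain vanishes, but the moment is the conserved energy and the event is
  -- empty.
  rcases hp.eq_or_lt with rfl | hp
  · refine ⟨1, 1, one_pos, one_pos, fun q hq B hB N Ω _ P _ ℱ μ h a ha T ε hε => ?_⟩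
    have hemp : {ω | ∃ t ≤ T, max (absMoment 2 (μ 0 ω)) 1 + ε < absMoment 2 (μ t ω)} = ∅ := by
      refine Set.eq_empty_of_forall_notMem fun ω hω => ?_
      obtain ⟨t, -, ht⟩ := hω
      rw [absMoment_two (h.mem _ _), absMoment_two (h.mem _ _), max_self] at ht
      linarith
    have := nonneg_of_ae q hq N Ω P (μ 0) (h.mem 0) a ha
    rw [hemp, measureReal_empty]
    positivity
  obtain ⟨C, c, hC, hc, hdrift⟩ := exists_momentDrift_le (d := d) hγ hp
  obtain ⟨A, hA, hmom⟩ := exists_expectation_absMoment_le.{u} (d := d) hd hγ hν hb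
    (p := 2 * p + γ) (by linarith)
  have hk₀ := isAngularKernel_angularPart hd hν hb
  -- The noncutoff cross section dominates that of every cutoff kernel; `+ 1` ensures positivity.
  set κ := crossSection (angularPart d b) e + 1 with hκ
  have hκ0 : 0 < κ := by linarith [hk₀.crossSection_nonneg e]
  refine ⟨C / c, 8 * (κ * (8 * p ^ 2 * 2 ^ (2 * p + γ)) * A), by positivity, by positivity,
    fun q hq B hB N Ω _ P _ ℱ μ h a ha T ε hε => ?_⟩
  have ha0 := nonneg_of_ae q hq N Ω P (μ 0) (h.mem 0) a ha
  obtain ⟨k, hk, hkle, hBk⟩ := hB.exists_angularKernel hd hν hb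
  obtain ⟨K, D, G, S⟩ := h.exists_isBddSemimartingale (p := p) hγ0 (by linarith) (by omega) hk hBk
  have hkκ : crossSection k e ≤ κ := by
    have := crossSection_mono hk hk₀ hkle (z := e) (by rintro rfl; simp at he)
    linarith
  -- `C / c` is the level where `C - c X` changes sign, whatever the kernel.
  have hmain := S.measure_exists_gt_le (L₀ := C / c)
    (R := (N : ℝ)⁻¹ * (κ * (8 * p ^ 2 * 2 ^ (2 * p + γ)) * (A * a)))
    (fun ω t => h.tendsto_of_isLipschitz (isLipschitzOnKacSphere_absMoment (p := p) (by linarith)) ω t)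
    (fun t ω hLt => ?_) T (fun t _ => ?_) hε
  · have hnn : 0 ≤ 8 * (κ * (8 * p ^ 2 * 2 ^ (2 * p + γ)) * A) * T * a * (N : ℝ)⁻¹
        * (ε ^ 2)⁻¹ := by positivity
    refine ENNReal.toReal_le_of_le_ofReal hnn (hmain.trans (le_of_eq ?_))
    congr 1
    ring
  · refine (hdrift N k hk e he _ (h.mem t ω)).trans
      (mul_nonpos_of_nonneg_of_nonpos (hk.crossSection_nonneg e) ?_)
    have := (div_le_iff₀ hc).1 hLt
    linarith
  · have hX := (h.isBddProcess_absMoment (p := 2 * p + γ) (by linarith)).integrable P t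
    calc ∫ ω, momentBracket N γ k p (μ t ω) ∂P
        ≤ ∫ ω, (N : ℝ)⁻¹ * (κ * (8 * p ^ 2 * 2 ^ (2 * p + γ)) * absMoment (2 * p + γ) (μ t ω)) ∂P := by
          refine integral_mono (S.bdd_g.integrable P t) ((hX.const_mul _).const_mul _) fun ω => ?_
          refine (momentBracket_le hγ0 (by linarith) hk he (h.mem t ω)).trans ?_
          have := absMoment_nonneg (2 * p + γ) (μ t ω)
          gcongr
      _ = (N : ℝ)⁻¹ * (κ * (8 * p ^ 2 * 2 ^ (2 * p + γ)) *
            ∫ ω, absMoment (2 * p + γ) (μ t ω) ∂P) := by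
          rw [integral_const_mul, integral_const_mul]
      _ ≤ _ := by
          have := hmom q hq B hB N Ω P ℱ μ h a ha t
          gcongr

theorem exists_gt_of_le_iSup {f : ℝ≥0 → ℝ} {T : ℝ≥0} {x y : ℝ} (hxy : x < y)
    (h : y ≤ ⨆ t : Set.Iic T, f t) : ∃ t ≤ T, x < f t := by
  have : Nonempty (Set.Iic T) := ⟨⟨0, Set.mem_Iic.2 zero_le⟩⟩
  obtain ⟨t, ht⟩ := exists_lt_of_lt_ciSup (hxy.trans_le h)
  exact ⟨t, t.2, ht⟩

/-- The infimum need not be attained, so the crossing is only guaranteed before times strictly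
beyond `T`. -/
theorem exists_lt_of_hittingTime_le {Ω : Type*} {p : ℝ} {μ : ℝ≥0 → Ω → Measure (Vel d)} {b : ℝ}
    {ω : Ω} {T T' : ℝ≥0} (h : hittingTime p μ b ω ≤ T) (hT : T < T') :
    ∃ t ≤ T', b / 2 ^ (p / 2 + 1) < Lam p (μ t ω) := by
  obtain ⟨-, ⟨t, ht, rfl⟩, hlt⟩ := sInf_lt_iff.1 (h.trans_lt (ENNReal.coe_lt_coe.2 hT))
  exact ⟨t, (ENNReal.coe_lt_coe.1 hlt).le, ht⟩

/-- If `Λ_p` exceeds a large multiple of its initial bound, so does the moment of order `p`. -/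
theorem max_absMoment_add_one_lt {p C C₁ a : ℝ} (hp : 0 ≤ p) (hC₁ : 0 ≤ C₁)
    (hC : (C₁ + 3) * 2 ^ (p + 1) ≤ C) {μ μ₀ : Measure (Vel d)} (hμ : μ ∈ kacSphere d N)
    (hμ₀ : μ₀ ∈ kacSphere d N) (h₀ : Lam p μ₀ ≤ a) (h : C * a / 2 ^ (p / 2 + 1) < Lam p μ) :
    max (absMoment p μ₀) C₁ + 1 < absMoment p μ := by
  have ha : 1 ≤ a := (one_le_Lam hp hμ₀).trans h₀
  have hm := (absMoment_le_Lam hp le_rfl hμ₀).trans h₀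
  have h1 := h.trans_le (Lam_le hp hμ)
  rw [div_lt_iff₀ (by positivity)] at h1
  have e : (2 : ℝ) ^ (p / 2) * (1 + absMoment p μ) * 2 ^ (p / 2 + 1)
      = (1 + absMoment p μ) * 2 ^ (p + 1) := by
    have : (2 : ℝ) ^ (p + 1) = 2 ^ (p / 2) * 2 ^ (p / 2 + 1) := by
      rw [← Real.rpow_add two_pos]
      ring_nf
    rw [this]
    ring
  rw [e] at h1
  -- The constant `C₁ + 3` is what `(C₁ + 3) a - 1 ≥ a + C₁ + 1` requires, given `a ≥ 1`.
  have h2 : (C₁ + 3) * a * 2 ^ (p + 1) < (1 + absMoment p μ) * 2 ^ (p + 1) := by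
    refine lt_of_le_of_lt ?_ h1
    calc (C₁ + 3) * a * 2 ^ (p + 1) = (C₁ + 3) * 2 ^ (p + 1) * a := by ring
      _ ≤ C * a := by gcongr
  have h3 := lt_of_mul_lt_mul_right h2 (by positivity)
  have h4 : max (absMoment p μ₀) C₁ ≤ a + C₁ :=
    max_le (by linarith) (by linarith)
  nlinarith

end Kac
end

/-! ### The concentration lemma -/

theorem mainTheorem4 (d : ℕ) (hd : 2 ≤ d) (γ ν : ℝ) (hγ : γ ∈ Set.Icc (0 : ℝ) 1)
    (hν : ν ∈ Set.Ico (0 : ℝ) 1) (b : ℝ → ℝ) (hb : Kac.IsAngularProfile ν b)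
    (p : ℝ) (hp : 2 ≤ p) :
    (∃ C₁ C₂ : ℝ, 0 < C₁ ∧ 0 < C₂ ∧
      ∀ (q : ℝ), 2 * p + γ ≤ q →
      ∀ (B : EuclideanSpace ℝ (Fin d) → EuclideanSpace ℝ (Fin d) → ℝ), Kac.IsKacKernel γ b B →
      ∀ (N : ℕ) (Ω : Type u) [mΩ : MeasurableSpace Ω] (P : Measure Ω) [IsProbabilityMeasure P]
        (ℱ : Filtration ℝ≥0 mΩ) (μ : ℝ≥0 → Ω → Measure (EuclideanSpace ℝ (Fin d))),
      Kac.IsKacProcess P ℱ N B μ →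
      ∀ a₃ : ℝ, (∀ᵐ ω ∂P, Kac.Lam q (μ 0 ω) ≤ a₃) →
      ∀ (tfin : ℝ≥0) (ε : ℝ), 0 < ε →
        P.real {ω | max (Kac.absMoment p (μ 0 ω)) C₁ + ε
            ≤ ⨆ t : Set.Iic tfin, Kac.absMoment p (μ t ω)}
          ≤ C₂ * tfin * a₃ * (N : ℝ)⁻¹ * (ε ^ 2)⁻¹) ∧
    (∃ C : ℝ, 1 ≤ C ∧
      ∀ (q : ℝ), 2 * p + γ ≤ q →
      ∀ (B : EuclideanSpace ℝ (Fin d) → EuclideanSpace ℝ (Fin d) → ℝ), Kac.IsKacKernel γ b B →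
      ∀ (N : ℕ) (Ω : Type u) [mΩ : MeasurableSpace Ω] (P : Measure Ω) [IsProbabilityMeasure P]
        (ℱ : Filtration ℝ≥0 mΩ) (μ : ℝ≥0 → Ω → Measure (EuclideanSpace ℝ (Fin d))),
      Kac.IsKacProcess P ℱ N B μ →
      ∀ a₁ a₃ : ℝ, (∀ᵐ ω ∂P, Kac.Lam p (μ 0 ω) ≤ a₁) → (∀ᵐ ω ∂P, Kac.Lam q (μ 0 ω) ≤ a₃) →
      ∀ tfin : ℝ≥0,
        P.real {ω | Kac.hittingTime p μ (C * a₁) ω ≤ tfin}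
          ≤ C * tfin * a₃ * (N : ℝ)⁻¹) := by
  obtain ⟨C₁, R, hC₁, hR, hconc⟩ := Kac.exists_measure_absMoment_gt_le hd hγ hν hb hp
  have hγ0 := hγ.1
  -- The `4` pays for replacing `ε` by `ε / 2`, which turns an inequality for the supremum into a
  -- strict one at some time. In the second part `C` must exceed the threshold factor of
  -- `max_absMoment_add_one_lt` as well as `R`.
  refine ⟨⟨C₁, 4 * R, hC₁, by positivity, ?_⟩,
    ⟨max (max 1 R) ((C₁ + 3) * 2 ^ (p + 1)), (le_max_left _ _).trans (le_max_left _ _), ?_⟩⟩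
  · intro q hq B hB N Ω _ P _ ℱ μ h a₃ ha₃ T ε hε
    calc P.real {ω | max (Kac.absMoment p (μ 0 ω)) C₁ + ε
            ≤ ⨆ t : Set.Iic T, Kac.absMoment p (μ t ω)}
        ≤ P.real {ω | ∃ t ≤ T, max (Kac.absMoment p (μ 0 ω)) C₁ + ε / 2
            < Kac.absMoment p (μ t ω)} :=
          measureReal_mono fun ω hω => Kac.exists_gt_of_le_iSup
            (f := fun t => Kac.absMoment p (μ t ω)) (by linarith) hω
      _ ≤ R * T * a₃ * (N : ℝ)⁻¹ * ((ε / 2) ^ 2)⁻¹ :=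
          hconc q hq B hB N Ω P ℱ μ h a₃ ha₃ T (ε / 2) (by positivity)
      _ = 4 * R * T * a₃ * (N : ℝ)⁻¹ * (ε ^ 2)⁻¹ := by
          field_simp
          ring
  · intro q hq B hB N Ω _ P _ ℱ μ h a₁ a₃ ha₁ ha₃ T
    have ha₃0 : 0 ≤ a₃ := by
      obtain ⟨ω, hω⟩ := ha₃.exists
      exact zero_le_one.trans ((Kac.one_le_Lam (by linarith) (h.mem 0 ω)).trans hω)
    set C := max (max 1 R) ((C₁ + 3) * 2 ^ (p + 1)) with hC
    have hbound : ∀ T' : ℝ≥0, T < T' → P.real {ω | Kac.hittingTime p μ (C * a₁) ω ≤ T}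
        ≤ C * T' * a₃ * (N : ℝ)⁻¹ := by
      intro T' hT'
      have h1 := hconc q hq B hB N Ω P ℱ μ h a₃ ha₃ T' 1 one_pos
      have h2 : P.real {ω | Kac.hittingTime p μ (C * a₁) ω ≤ T} ≤
          P.real {ω | ∃ t ≤ T', max (Kac.absMoment p (μ 0 ω)) C₁ + 1
            < Kac.absMoment p (μ t ω)} := by
        -- The initial bound holds almost surely, so the inclusion of events is only almost
        -- everywhere.
        refine ENNReal.toReal_mono (measure_ne_top _ _) (measure_mono_ae ?_)
        filter_upwards [ha₁] with ω hω hhit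
        obtain ⟨t, ht, hlt⟩ := Kac.exists_lt_of_hittingTime_le hhit hT'
        exact ⟨t, ht, Kac.max_absMoment_add_one_lt (by linarith) hC₁.le (le_max_right _ _)
          (h.mem t ω) (h.mem 0 ω) hω hlt⟩
      have hRC : R ≤ C := (le_max_right _ _).trans (le_max_left _ _)
      refine (h2.trans h1).trans ?_
      simp only [one_pow, inv_one, mul_one]
      gcongr
    -- The limit `T' ↓ T` removes the slack left by the infimum.
    have hlim : Tendsto (fun T' : ℝ≥0 => C * (T' : ℝ) * a₃ * (N : ℝ)⁻¹) (𝓝[>] T)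
        (𝓝 (C * T * a₃ * (N : ℝ)⁻¹)) :=
      ((by fun_prop : Continuous fun T' : ℝ≥0 => C * (T' : ℝ) * a₃ * (N : ℝ)⁻¹).tendsto T).mono_left
        nhdsWithin_le_nhds
    exact ge_of_tendsto hlim (eventually_nhdsWithin_of_forall hbound)
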